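/- **Weak-strong uniqueness for wave maps.** Points of space-time $\mathbb R^{1+3}$ are written $(t,x)$, $\nabla=(\partial_1,\partial_2,\partial_3)$ is the gradient in $x$, and $\Box=\partial_t^2-\Delta$. Fix $p\in\mathbb R^3$ and $0<T\le\tau$. Let $D(t)=\{x:|x-p|<\tau-t\}$, let $K=\{(t,x):0\le t\le T,\ x\in D(t)\}$ be the truncated backward light cone with base $D(0)$, and let $M_0^t=\{(s,x):0<s<t,\ |x-p|=\tau-s\}$ be its side up to time $t$, with surface measure $\sigma$. Let $u$ be a smooth classical wave map into $\mathbb S^2\subset\mathbb R^3$ on an open neighbourhood of $\overline K$, i.e. $u$ is $C^\infty$ with $|u|=1$ and $$\Box u+\big(|\partial_tu|^2-|\nabla u|^2\big)u=0 .$$ Let $v$ be a weak wave map into $\mathbb S^2$ on $K$: $|v|=1$ almost everywhere; $v$ is weakly continuous in $t$ with values in $\dot H^1$ (both $\nabla v$, in $L^2$ of the time slices, and $v$ itself, in $L^2$ of bounded sets, are weakly continuous in $t$); $\partial_tv$ is weakly continuous in $t$ with values in $L^2$; and $\Box v+(|\partial_tv|^2-|\nabla v|^2)v=0$ in the sense of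 distributions in the interior of $K$. Suppose that $v$ satisfies the local energy inequality $$E(v;D(0))\ \ge\ E(v;D(t))+\mathrm{Flux}(v;M_0^t)\qquad\text{for all }0<t<T,$$ where $$E(v;D(t))=\frac12\int_{D(t)}|\partial_tv|^2+|\nabla v|^2\,dx,\qquad \mathrm{Flux}(v;M_0^t)=\frac1{2\sqrt2}\int_{M_0^t}\Big|\nabla v-\frac{x-p}{|x-p|}\,\partial_tv\Big|^2d\sigma .$$ In the flux, the values on $M_0^t$ of $\nabla v-\frac{x-p}{|x-p|}\partial_tv$ (which involves only derivatives of $v$ tangential to $M_0^t$) are those of its trace, the weak limit of its averages over thin shells inside the cone along the side; the flux is $+\infty$ if this trace is not square integrable. If $v(0,\cdot)=u(0,\cdot)$ and $\partial_tv(0,\cdot)=\partial_tu(0,\cdot)$ almost everywhere on $D(0)$, then $v=u$ on the whole of $K$: for every $t\in[0,T]$, $v(t,x)=u(t,x)$ for almost every $x\in D(t)$. -/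

import Mathlib

open MeasureTheory Set Filter Topology
open scoped ContDiff

namespace WaveMap

/-- Euclidean three-space; it is both the space `ℝ³` of positions and the ambient space of the
target sphere `𝕊² = {y ∈ ℝ³ : |y| = 1}`. -/
abbrev E3 : Type := EuclideanSpace ℝ (Fin 3)

/-- The space-time `ℝ^{1+3}`, with points `z = (t, x)`. -/
abbrev SpaceTime : Type := ℝ × E3

/-! ### Classical derivatives -/

/-- The time derivative `∂ₜ f`. -/
noncomputable def timeDeriv {F : Type*} [NormedAddCommGroup F] [NormedSpace ℝ F]
    (f : SpaceTime → F) (z : SpaceTime) : F :=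
  fderiv ℝ f z (1, 0)

/-- The space derivative `∂ᵢ f`. -/
noncomputable def spaceDeriv {F : Type*} [NormedAddCommGroup F] [NormedSpace ℝ F]
    (i : Fin 3) (f : SpaceTime → F) (z : SpaceTime) : F :=
  fderiv ℝ f z (0, EuclideanSpace.single i 1)

/-- The wave operator `□ = ∂ₜ² - ∂₁² - ∂₂² - ∂₃²`. -/
noncomputable def box (u : SpaceTime → E3) (z : SpaceTime) : E3 :=
  timeDeriv (timeDeriv u) z - ∑ i, spaceDeriv i (spaceDeriv i u) z

/-- `u` is a smooth classical wave map into `𝕊²` on the open set `U`: it is `C^∞`, has values in the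
sphere and solves `□u + (|∂ₜu|² - |∇u|²) u = 0` pointwise. -/
structure IsClassicalWaveMapOn (U : Set SpaceTime) (u : SpaceTime → E3) : Prop where
  smooth : ContDiffOn ℝ ∞ u U
  norm_eq_one : ∀ z ∈ U, ‖u z‖ = 1
  equation : ∀ z ∈ U,
    box u z + (‖timeDeriv u z‖ ^ 2 - ∑ i, ‖spaceDeriv i u z‖ ^ 2) • u z = 0

/-! ### Weak wave maps -/

/-- `φ` is a test function on the interior of `Ω`: it is `C^∞` with compact support there. -/
def IsTestOn {X F : Type*} [NormedAddCommGroup X] [NormedSpace ℝ X]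
    [NormedAddCommGroup F] [NormedSpace ℝ F] (Ω : Set X) (φ : X → F) : Prop :=
  ContDiff ℝ ∞ φ ∧ HasCompactSupport φ ∧ tsupport φ ⊆ interior Ω

/-- The time slice `{x : (t, x) ∈ Ω}`. -/
def slice (Ω : Set SpaceTime) (t : ℝ) : Set E3 := {x | (t, x) ∈ Ω}

/-- The times at which `S` is contained in the time slice of `Ω`. -/
def timesOf (Ω : Set SpaceTime) (S : Set E3) : Set ℝ := {t | S ⊆ slice Ω t}

/-- The time slices of `w` are in `L²(S)` and depend weakly continuously on `t ∈ I` there. -/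
def WeaklyContinuousL2 (I : Set ℝ) (S : Set E3) (w : SpaceTime → E3) : Prop :=
  (∀ t ∈ I, MemLp (fun x => w (t, x)) 2 (volume.restrict S)) ∧
  ∀ φ : E3 → E3, MemLp φ 2 (volume.restrict S) →
    ContinuousOn (fun t => ∫ x in S, inner ℝ (w (t, x)) (φ x)) I

/-- `v` is a (local) weak wave map into `𝕊²` on the subset `Ω` of space-time, with weak time
derivative `vt` and weak space derivatives `dv i` (`i = 1, 2, 3`); `Ω = univ` is the global notion.
The function `v` is given through its time slices `v(t, ·)`.

* `|v| = 1` almost everywhere;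
* `t ↦ v(t)` is weakly continuous with values in `Ḣ¹`: the `dv i (t, ·)` are the weak derivatives of
  `v(t, ·)` and are weakly continuous with values in `L²`. As elements of `Ḣ¹` are determined by
  their gradients only up to constants, `v` itself is required to be weakly continuous with values
  in `L²` of bounded sets;
* `∂ₜv` is weakly continuous with values in `L²`;
* `□v + (|∂ₜv|² - |∇v|²) v = 0` in the sense of distributions on the interior of `Ω`. -/
structure IsWeakWaveMapOn (Ω : Set SpaceTime)
    (v vt : SpaceTime → E3) (dv : Fin 3 → SpaceTime → E3) : Prop where
  measurable_v : AEStronglyMeasurable v (volume.restrict Ω)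
  measurable_vt : AEStronglyMeasurable vt (volume.restrict Ω)
  measurable_dv : ∀ i, AEStronglyMeasurable (dv i) (volume.restrict Ω)
  norm_eq_one : ∀ t : ℝ, ∀ᵐ x : E3, (t, x) ∈ Ω → ‖v (t, x)‖ = 1
  weak_timeDeriv : ∀ φ : SpaceTime → ℝ, IsTestOn Ω φ →
    ∫ z, timeDeriv φ z • v z = - ∫ z, φ z • vt z
  weak_spaceDeriv : ∀ (t : ℝ) (i : Fin 3) (φ : E3 → ℝ), IsTestOn (slice Ω t) φ →
    ∫ x, fderiv ℝ φ x (EuclideanSpace.single i 1) • v (t, x) = - ∫ x, φ x • dv i (t, x)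
  continuous_v : ∀ S : Set E3, MeasurableSet S → Bornology.IsBounded S →
    WeaklyContinuousL2 (timesOf Ω S) S v
  continuous_dv : ∀ S : Set E3, MeasurableSet S → ∀ i,
    WeaklyContinuousL2 (timesOf Ω S) S (dv i)
  continuous_vt : ∀ S : Set E3, MeasurableSet S →
    WeaklyContinuousL2 (timesOf Ω S) S vt
  equation : ∀ ψ : SpaceTime → E3, IsTestOn Ω ψ →
    ∫ z, (- inner ℝ (vt z) (timeDeriv ψ z) + ∑ i, inner ℝ (dv i z) (spaceDeriv i ψ z)
      + (‖vt z‖ ^ 2 - ∑ i, ‖dv i z‖ ^ 2) * inner ℝ (v z) (ψ z)) = 0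

/-! ### Cones, energy and flux -/

/-- The time slice `D(t, p)`, a disk of radius `τ - t`, of the backward light cone with vertex
`(τ, p)`. -/
def disk (τ : ℝ) (p : E3) (t : ℝ) : Set E3 := Metric.ball p (τ - t)

/-- The backward light cone with vertex `(τ, p)`, truncated to the times `0 ≤ t ≤ T`. -/
def truncCone (τ : ℝ) (p : E3) (T : ℝ) : Set SpaceTime :=
  {z | z.1 ∈ Icc 0 T ∧ z.2 ∈ disk τ p z.1}

/-- The closed truncated cone: base, top, side and interior. -/
def closedTruncCone (τ : ℝ) (p : E3) (T : ℝ) : Set SpaceTime :=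
  {z | z.1 ∈ Icc 0 T ∧ z.2 ∈ Metric.closedBall p (τ - z.1)}

/-- The energy `E(v; D(t, p)) = ½ ∫_{D(t, p)} |∂ₜv|² + |∇v|² dx`. -/
noncomputable def energy (τ : ℝ) (p : E3) (t : ℝ)
    (vt : SpaceTime → E3) (dv : Fin 3 → SpaceTime → E3) : ENNReal :=
  ENNReal.ofReal (1 / 2) *
    ∫⁻ x in disk τ p t, (‖vt (t, x)‖ₑ ^ 2 + ∑ i, ‖dv i (t, x)‖ₑ ^ 2)

/-- The surface measure `σ` on the side `M = {(s, x) : 0 < s < t, |x - p| = τ - s}` of the truncated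
cone. In the coordinates `(s, ω) ↦ (s, p + (τ - s) ω)`, `ω ∈ 𝕊²`, it is `√2 (τ - s)² ds dω`. -/
noncomputable def sideMeasure (τ : ℝ) (p : E3) (t : ℝ) : Measure SpaceTime :=
  (((volume.restrict (Ioo 0 t)).prod (volume : Measure E3).toSphere).withDensity
    (fun q => ENNReal.ofReal (√2 * (τ - q.1) ^ 2))).map
    (fun q => (q.1, p + (τ - q.1) • (q.2 : E3)))

/-- The part of the open cone at horizontal distance less than `h` from its side, for times between
`0` and `t`. -/
def shell (τ : ℝ) (p : E3) (t h : ℝ) : Set SpaceTime :=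
  {z | z.1 ∈ Ioo 0 t ∧ τ - z.1 - h < dist z.2 p ∧ dist z.2 p < τ - z.1}

/-- The components `∂ᵢv - nᵢ ∂ₜv`, `n = (x - p) / |x - p|`, of the field `∇v - n ∂ₜv` which enters
the flux. On the side of the cone they only involve derivatives of `v` tangential to the side. -/
noncomputable def fluxField (p : E3) (vt : SpaceTime → E3) (dv : Fin 3 → SpaceTime → E3)
    (i : Fin 3) (z : SpaceTime) : E3 :=
  dv i z - ((z.2 i - p i) / ‖z.2 - p‖) • vt z

/-- `G ∈ L²(M)` is the trace of `∇v - n ∂ₜv` on the side `M` of the truncated cone: the averages over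
thin shells (whose thickness is `h / √2`) inside the cone converge weakly to `G dσ`. Such a `G` is
unique up to null sets; if `∇v - n ∂ₜv` is continuous up to `M` it is its restriction to `M`. -/
def IsSideTrace (τ : ℝ) (p : E3) (t : ℝ) (vt : SpaceTime → E3) (dv : Fin 3 → SpaceTime → E3)
    (G : Fin 3 → SpaceTime → E3) : Prop :=
  (∀ i, MemLp (G i) 2 (sideMeasure τ p t)) ∧
  ∀ F : Fin 3 → SpaceTime → E3, (∀ i, IsTestOn (Ioo 0 t ×ˢ univ) (F i)) →
    Tendsto
      (fun h : ℝ => √2 / h * ∫ z in shell τ p t h, ∑ i, inner ℝ (fluxField p vt dv i z) (F i z))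
      (𝓝[>] 0)
      (𝓝 (∫ z, ∑ i, inner ℝ (G i z) (F i z) ∂(sideMeasure τ p t)))

/-- The flux `1 / (2√2) ∫_M |∇v - n ∂ₜv|² dσ` through the side `M` of the truncated cone, for times
between `0` and `t`. Here `∇v - n ∂ₜv` on `M` is the trace, and the flux is `∞` if there is no
square integrable trace. -/
noncomputable def flux (τ : ℝ) (p : E3) (t : ℝ)
    (vt : SpaceTime → E3) (dv : Fin 3 → SpaceTime → E3) : ENNReal :=
  ⨅ (G : Fin 3 → SpaceTime → E3) (_ : IsSideTrace τ p t vt dv G),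
    ENNReal.ofReal (1 / (2 * √2)) * ∫⁻ z, ∑ i, ‖G i z‖ₑ ^ 2 ∂(sideMeasure τ p t)

end WaveMap

/-!
The two maps are compared through the energy of their difference `w = v - u`. Its density is that of
`v` plus the relative energy density `½ (|∂ₜu|² + |∇u|²) - (∂ₜv · ∂ₜu + ∇v · ∇u)` (`relEnergy`),
which is linear in the derivatives of `v`. The local energy inequality controls the nonlinear part;
the relative part satisfies an exact balance law.

*The balance law.* Formally, `∂ₜ(∂ₜv · ∂ₜu + ∇v · ∇u)` is a divergence up to a source which the two
equations express without second derivatives. For the weak map `v` this is obtained by testing its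
equation with `ζ ∂ₜu` and by using that the mixed weak derivatives of `v` commute
(`integral_crossEnergy_law`). As `u` is smooth, no further regularity of `v` is needed.

*The side of the cone.* The balance law is tested with cutoffs `η(s) g(τ - s - |x - p|)`, constant on
parallel cones for fixed `s`, so that `g'` produces averages over thin shells along the side
(`tendsto_shell_average`). The averaged density, the relative energy minus the radial component of
its current, is `½ |F(u)|² - F(v) · F(u)` with the flux fields `F` (`relEnergy_sub_relCurrent`). As
`F(v)` enters linearly, the averages converge, by polar coordinates for `u` and by the definition of the trace for `v`. Completing the
square bounds the boundary term by the flux of `v` (`neg_flux_le_integral_relEnergy`), and this is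
the flux which the energy inequality provides.

*Top and base.* The cutoff in time is removed with the help of the continuity of the relative energy
of the slices, which follows from the weak continuity and the boundedness of the derivatives of `v`
(`IsWeakWaveMapOn.continuousOn_integral_relEnergy`). As the energy of `w` vanishes at time `0`, it is
bounded at time `t` by the integral of the source over the cone up to the time `t`
(`IsWeakWaveMapOn.integral_energyDensity_sub_le`).

*Gronwall.* The source is quadratic in `w` and its derivatives (`abs_source_le`). This uses that both
maps have values in the sphere, so that `u · ∂ₜu = 0` and `v · ∂ₜv = 0`. The second relation is a
statement on weak derivatives; it holds since `v` is the integral in time of `∂ₜv`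
(`IsWeakWaveMapOn.inner_v_vt_eq_zero`). As the `L²` norm of `w` is controlled by that of `∂ₜw`
(`IsWeakWaveMapOn.integral_norm_sub_sq_le`), Gronwall's lemma shows `w = 0`.
-/

namespace WaveMap

/-! ### Calculus in space-time -/

section Calculus

variable {F : Type*} [NormedAddCommGroup F] [NormedSpace ℝ F]

theorem contDiff_timeDeriv {f : SpaceTime → F} (hf : ContDiff ℝ ∞ f) :
    ContDiff ℝ ∞ (timeDeriv f) :=
  (hf.fderiv_right (m := ∞) le_rfl).clm_apply contDiff_const

theorem contDiff_spaceDeriv {f : SpaceTime → F} (hf : ContDiff ℝ ∞ f) (i : Fin 3) :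
    ContDiff ℝ ∞ (spaceDeriv i f) :=
  (hf.fderiv_right (m := ∞) le_rfl).clm_apply contDiff_const

theorem tsupport_timeDeriv_subset (f : SpaceTime → F) : tsupport (timeDeriv f) ⊆ tsupport f :=
  tsupport_fderiv_apply_subset ℝ _

theorem tsupport_spaceDeriv_subset (i : Fin 3) (f : SpaceTime → F) :
    tsupport (spaceDeriv i f) ⊆ tsupport f :=
  tsupport_fderiv_apply_subset ℝ _

theorem timeDeriv_smul {ζ : SpaceTime → ℝ} {a : SpaceTime → F} (hζ : ContDiff ℝ ∞ ζ)
    (ha : ContDiff ℝ ∞ a) (z : SpaceTime) :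
    timeDeriv (fun z => ζ z • a z) z = ζ z • timeDeriv a z + timeDeriv ζ z • a z := by
  simp only [timeDeriv]
  rw [fderiv_fun_smul (hζ.differentiable (by simp) z) (ha.differentiable (by simp) z)]
  simp

theorem spaceDeriv_smul (i : Fin 3) {ζ : SpaceTime → ℝ} {a : SpaceTime → F}
    (hζ : ContDiff ℝ ∞ ζ) (ha : ContDiff ℝ ∞ a) (z : SpaceTime) :
    spaceDeriv i (fun z => ζ z • a z) z = ζ z • spaceDeriv i a z + spaceDeriv i ζ z • a z := by
  simp only [spaceDeriv]
  rw [fderiv_fun_smul (hζ.differentiable (by simp) z) (ha.differentiable (by simp) z)]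
  simp

theorem timeDeriv_spaceDeriv_comm {f : SpaceTime → F} (hf : ContDiff ℝ ∞ f) (i : Fin 3)
    (z : SpaceTime) : timeDeriv (spaceDeriv i f) z = spaceDeriv i (timeDeriv f) z := by
  have hd : DifferentiableAt ℝ (fderiv ℝ f) z :=
    (hf.fderiv_right (m := ∞) le_rfl).differentiable (by simp) z
  have key : ∀ a b : SpaceTime,
      fderiv ℝ (fun z => fderiv ℝ f z b) z a = fderiv ℝ (fderiv ℝ f) z a b := by
    intro a b
    rw [fderiv_clm_apply hd (differentiableAt_const b)]
    simp
  have hs : IsSymmSndFDerivAt ℝ f z := hf.contDiffAt.isSymmSndFDerivAt (by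
    rw [minSmoothness_of_isRCLikeNormedField]; exact WithTop.coe_le_coe.2 le_top)
  change fderiv ℝ (fun z => fderiv ℝ f z _) z _ = fderiv ℝ (fun z => fderiv ℝ f z _) z _
  rw [key, key]
  exact hs _ _

theorem timeDeriv_congr {f g : SpaceTime → F} {z : SpaceTime} (h : f =ᶠ[𝓝 z] g) :
    timeDeriv f =ᶠ[𝓝 z] timeDeriv g :=
  (h.fderiv (𝕜 := ℝ)).mono fun _ hy => by simp only [timeDeriv, hy]

theorem spaceDeriv_congr {f g : SpaceTime → F} {z : SpaceTime} (i : Fin 3) (h : f =ᶠ[𝓝 z] g) :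
    spaceDeriv i f =ᶠ[𝓝 z] spaceDeriv i g :=
  (h.fderiv (𝕜 := ℝ)).mono fun _ hy => by simp only [spaceDeriv, hy]

end Calculus

instance : (volume : Measure SpaceTime).IsAddHaarMeasure :=
  inferInstanceAs ((volume : Measure ℝ).prod (volume : Measure E3)).IsAddHaarMeasure

/-- Integration by parts for the pointwise inner product of two smooth fields, one of them
compactly supported. -/
theorem integral_inner_fderiv_eq_neg {X : Type*} [NormedAddCommGroup X] [NormedSpace ℝ X]
    [FiniteDimensional ℝ X] [MeasureSpace X] [BorelSpace X]
    [(volume : Measure X).IsAddHaarMeasure] {a b : X → E3} (ha : ContDiff ℝ ∞ a)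
    (hb : ContDiff ℝ ∞ b) (hbc : HasCompactSupport b) (e : X) :
    ∫ z, inner ℝ (a z) (fderiv ℝ b z e) = - ∫ z, inner ℝ (fderiv ℝ a z e) (b z) := by
  have ha' : Continuous fun z => fderiv ℝ a z e :=
    (ha.continuous_fderiv (by simp)).clm_apply continuous_const
  have hb' : Continuous fun z => fderiv ℝ b z e :=
    (hb.continuous_fderiv (by simp)).clm_apply continuous_const
  have hbc' : HasCompactSupport fun z => fderiv ℝ b z e := hbc.fderiv_apply ℝ e
  have key : ∀ f g : X → E3, Continuous f → Continuous g → HasCompactSupport g →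
      Integrable (fun z => inner ℝ (f z) (g z)) := by
    intro f g hf hg hgc
    refine (hf.inner hg).integrable_of_hasCompactSupport ?_
    refine hgc.mono fun z hz hg0 => hz ?_
    simp only [hg0, inner_zero_right]
  exact integral_bilinear_fderiv_right_eq_neg_left_of_integrable (B := innerSL ℝ)
    (key _ _ ha' hb.continuous hbc) (key _ _ ha.continuous hb' hbc')
    (key _ _ ha.continuous hb.continuous hbc)
    (fun z _ => ha.differentiable (by simp) z) (fun z _ => hb.differentiable (by simp) z)

theorem isCompact_closedTruncCone (τ : ℝ) (p : E3) (T : ℝ) :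
    IsCompact (closedTruncCone τ p T) := by
  refine Metric.isCompact_of_isClosed_isBounded ?_ ?_
  · have h1 : IsClosed {z : SpaceTime | z.1 ∈ Icc 0 T} := isClosed_Icc.preimage continuous_fst
    have h2 : IsClosed {z : SpaceTime | dist z.2 p ≤ τ - z.1} :=
      isClosed_le (by fun_prop) (by fun_prop)
    exact h1.inter h2
  · refine ((Metric.isBounded_Icc (0 : ℝ) T).prod
      (Metric.isBounded_closedBall (x := p) (r := τ))).subset ?_
    rintro ⟨t, x⟩ ⟨h1, h2⟩
    exact ⟨h1, Metric.closedBall_subset_closedBall (by linarith [h1.1]) h2⟩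

/-- A smooth map near a compact set agrees near that set with a smooth compactly supported map
defined everywhere. -/
theorem exists_contDiff_hasCompactSupport_eventuallyEq {K U : Set SpaceTime} (hK : IsCompact K)
    (hU : IsOpen U) (hKU : K ⊆ U) {u : SpaceTime → E3} (hu : ContDiffOn ℝ ∞ u U) :
    ∃ u' : SpaceTime → E3, ContDiff ℝ ∞ u' ∧ HasCompactSupport u' ∧ ∀ z ∈ K, u' =ᶠ[𝓝 z] u := by
  obtain ⟨L, hL, hKL, hLU⟩ := exists_compact_between hK hU hKU
  obtain ⟨f, hf1, hf0, -⟩ := exists_contMDiffMap_one_nhds_of_subset_interior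
    (n := ⊤) (modelWithCornersSelf ℝ SpaceTime) hK.isClosed hKL
  have hf : ContDiff ℝ ∞ f := f.contMDiff.contDiff
  refine ⟨fun z => f z • u z, contDiff_iff_contDiffAt.2 fun z => ?_, ?_, fun z hz => ?_⟩
  · by_cases hz : z ∈ U
    · exact hf.contDiffAt.smul (hu.contDiffAt (hU.mem_nhds hz))
    · have : (fun z => f z • u z) =ᶠ[𝓝 z] fun _ => 0 := by
        filter_upwards [hL.isClosed.isOpen_compl.mem_nhds fun h => hz (hLU h)] with y hy
        simp [hf0 y hy]
      exact contDiffAt_const.congr_of_eventuallyEq this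
  · refine HasCompactSupport.intro hL fun z hz => ?_
    simp [hf0 z hz]
  · filter_upwards [(eventually_nhdsSet_iff_forall.1 hf1) z hz] with y hy
    simp [hy]

/-- The wave map equation at one point, in terms of a function defined near that point. -/
theorem box_congr {u u' : SpaceTime → E3} {z : SpaceTime} (h : u' =ᶠ[𝓝 z] u) :
    box u' z = box u z := by
  simp only [box]
  rw [(timeDeriv_congr (timeDeriv_congr h)).self_of_nhds]
  congr 1
  exact Finset.sum_congr rfl fun i _ =>
    (spaceDeriv_congr i (spaceDeriv_congr i h)).self_of_nhds

theorem inner_timeDeriv_eq_zero {u : SpaceTime → E3} {z : SpaceTime}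
    (hu : DifferentiableAt ℝ u z) (h : ∀ᶠ y in 𝓝 z, ‖u y‖ = 1) :
    inner ℝ (u z) (timeDeriv u z) = 0 := by
  have h1 : (fun y => inner ℝ (u y) (u y)) =ᶠ[𝓝 z] fun _ => (1 : ℝ) := by
    filter_upwards [h] with y hy
    rw [real_inner_self_eq_norm_sq, hy]; norm_num
  have h2 : fderiv ℝ (fun y => inner ℝ (u y) (u y)) z (1, 0) = 0 := by
    rw [h1.fderiv_eq]; simp
  rw [fderiv_inner_apply ℝ hu hu, real_inner_comm (u z) (fderiv ℝ u z (1, 0))] at h2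
  have h3 : inner ℝ (u z) (fderiv ℝ u z (1, 0)) = 0 := by linarith
  exact h3

/-! ### The open cone -/

/-- The interior `{(s, x) : 0 < s < t, |x - p| < τ - s}` of the truncated cone. -/
def openCone (τ : ℝ) (p : E3) (t : ℝ) : Set SpaceTime :=
  {z | z.1 ∈ Ioo 0 t ∧ z.2 ∈ disk τ p z.1}

theorem isOpen_openCone (τ : ℝ) (p : E3) (t : ℝ) : IsOpen (openCone τ p t) := by
  have h1 : IsOpen {z : SpaceTime | z.1 ∈ Ioo 0 t} := isOpen_Ioo.preimage continuous_fst
  have h2 : IsOpen {z : SpaceTime | dist z.2 p < τ - z.1} :=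
    isOpen_lt (by fun_prop) (by fun_prop)
  exact h1.inter h2

theorem measurableSet_openCone (τ : ℝ) (p : E3) (t : ℝ) : MeasurableSet (openCone τ p t) :=
  (isOpen_openCone τ p t).measurableSet

theorem measurableSet_disk (τ : ℝ) (p : E3) (t : ℝ) : MeasurableSet (disk τ p t) :=
  Metric.isOpen_ball.measurableSet

theorem openCone_subset_openCone (τ : ℝ) (p : E3) {s t : ℝ} (hst : s ≤ t) :
    openCone τ p s ⊆ openCone τ p t :=
  fun _ hz => ⟨⟨hz.1.1, hz.1.2.trans_le hst⟩, hz.2⟩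

theorem openCone_subset_truncCone (τ : ℝ) (p : E3) (t : ℝ) :
    openCone τ p t ⊆ truncCone τ p t :=
  fun _ hz => ⟨Ioo_subset_Icc_self hz.1, hz.2⟩

theorem truncCone_subset_closedTruncCone (τ : ℝ) (p : E3) (t : ℝ) :
    truncCone τ p t ⊆ closedTruncCone τ p t :=
  fun _ hz => ⟨hz.1, Metric.ball_subset_closedBall hz.2⟩

theorem volume_openCone_lt_top (τ : ℝ) (p : E3) (t : ℝ) : volume (openCone τ p t) < ⊤ :=
  (measure_mono ((openCone_subset_truncCone τ p t).trans
    (truncCone_subset_closedTruncCone τ p t))).trans_lt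
    (isCompact_closedTruncCone τ p t).measure_lt_top

instance (τ : ℝ) (p : E3) (t : ℝ) : IsFiniteMeasure (volume.restrict (openCone τ p t)) :=
  ⟨by rw [Measure.restrict_apply_univ]; exact volume_openCone_lt_top τ p t⟩

instance (τ : ℝ) (p : E3) (t : ℝ) : IsFiniteMeasure (volume.restrict (disk τ p t)) :=
  ⟨by rw [Measure.restrict_apply_univ]; exact measure_ball_lt_top⟩

theorem disk_anti (τ : ℝ) (p : E3) {s t : ℝ} (hst : s ≤ t) : disk τ p t ⊆ disk τ p s :=
  Metric.ball_subset_ball (by linarith)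

theorem slice_truncCone (τ : ℝ) (p : E3) {T t : ℝ} (ht : t ∈ Icc 0 T) :
    slice (truncCone τ p T) t = disk τ p t := by
  ext x
  exact ⟨fun h => h.2, fun h => ⟨ht, h⟩⟩

/-- As the disks shrink, the cylinder over a disk lies in the cone up to the time of that disk. This
is where the weak continuity on fixed sets applies. -/
theorem mem_timesOf_truncCone (τ : ℝ) (p : E3) {T s t : ℝ} (hs : s ∈ Icc 0 T) (hst : s ≤ t) :
    s ∈ timesOf (truncCone τ p T) (disk τ p t) := by
  change disk τ p t ⊆ slice (truncCone τ p T) s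
  rw [slice_truncCone τ p hs]
  exact disk_anti τ p hst

/-! ### Fubini on the cone -/

theorem indicator_openCone {F : Type*} [Zero F] (τ : ℝ) (p : E3) (T : ℝ) (f : SpaceTime → F)
    (t : ℝ) (x : E3) : (openCone τ p T).indicator f (t, x) =
      (Ioo 0 T).indicator (fun t => (disk τ p t).indicator (fun x => f (t, x)) x) t := by
  classical
  simp only [indicator_apply]
  by_cases h1 : t ∈ Ioo 0 T <;> by_cases h2 : x ∈ disk τ p t <;> simp only [h1, h2, if_true, if_false]
  · exact if_pos ⟨h1, h2⟩
  · exact if_neg fun h => h2 h.2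
  · exact if_neg fun h => h1 h.1
  · exact if_neg fun h => h1 h.1

theorem lintegral_openCone (τ : ℝ) (p : E3) (T : ℝ) {f : SpaceTime → ENNReal}
    (hf : AEMeasurable f (volume.restrict (openCone τ p T))) :
    ∫⁻ z in openCone τ p T, f z = ∫⁻ t in Ioo 0 T, ∫⁻ x in disk τ p t, f (t, x) := by
  have hO := measurableSet_openCone τ p T
  rw [← lintegral_indicator hO, Measure.volume_eq_prod, lintegral_prod _
    (by rw [← Measure.volume_eq_prod]; exact (aemeasurable_indicator_iff hO).2 hf),
    ← lintegral_indicator measurableSet_Ioo]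
  refine lintegral_congr fun t => ?_
  simp only [indicator_openCone]
  by_cases ht : t ∈ Ioo 0 T
  · simp only [indicator_of_mem ht]
    rw [lintegral_indicator (measurableSet_disk τ p t)]
  · simp only [indicator_of_notMem ht, lintegral_zero]

theorem integral_openCone {F : Type*} [NormedAddCommGroup F] [NormedSpace ℝ F]
    (τ : ℝ) (p : E3) (T : ℝ) {f : SpaceTime → F}
    (hf : IntegrableOn f (openCone τ p T)) :
    ∫ z in openCone τ p T, f z = ∫ t in Ioo 0 T, ∫ x in disk τ p t, f (t, x) := by
  have hO := measurableSet_openCone τ p T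
  rw [← integral_indicator hO, Measure.volume_eq_prod, integral_prod _
    (by rw [← Measure.volume_eq_prod]; exact (integrable_indicator_iff hO).2 hf),
    ← integral_indicator measurableSet_Ioo]
  refine integral_congr_ae (Eventually.of_forall fun t => ?_)
  simp only [indicator_openCone]
  by_cases ht : t ∈ Ioo 0 T
  · simp only [indicator_of_mem ht]
    rw [integral_indicator (measurableSet_disk τ p t)]
  · simp only [indicator_of_notMem ht, integral_zero]

theorem integrableOn_integral_disk {F : Type*} [NormedAddCommGroup F] [NormedSpace ℝ F]
    {τ : ℝ} {p : E3} {T : ℝ} {f : SpaceTime → F}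
    (hf : IntegrableOn f (openCone τ p T)) :
    IntegrableOn (fun t => ∫ x in disk τ p t, f (t, x)) (Ioo 0 T) := by
  have hO := measurableSet_openCone τ p T
  have h := ((integrable_indicator_iff hO).2 hf)
  rw [Measure.volume_eq_prod] at h
  refine (integrable_indicator_iff measurableSet_Ioo).1 (h.integral_prod_left.congr
    (Eventually.of_forall fun t => ?_))
  simp only [indicator_openCone]
  by_cases ht : t ∈ Ioo 0 T
  · simp only [indicator_of_mem ht]
    rw [integral_indicator (measurableSet_disk τ p t)]
  · simp only [indicator_of_notMem ht, integral_zero]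

theorem ae_openCone_eq_of_ae_disk {F : Type*} [NormedAddCommGroup F] {τ : ℝ} {p : E3} {T : ℝ}
    {f g : SpaceTime → F}
    (hf : AEStronglyMeasurable f (volume.restrict (openCone τ p T)))
    (hg : AEStronglyMeasurable g (volume.restrict (openCone τ p T)))
    (h : ∀ᵐ t ∂volume.restrict (Ioo 0 T), ∀ᵐ x ∂volume.restrict (disk τ p t),
      f (t, x) = g (t, x)) :
    f =ᵐ[volume.restrict (openCone τ p T)] g := by
  have hm : AEMeasurable (fun z => ‖f z - g z‖ₑ) (volume.restrict (openCone τ p T)) :=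
    (hf.sub hg).enorm
  have h0 : ∫⁻ z in openCone τ p T, ‖f z - g z‖ₑ = 0 := by
    rw [lintegral_openCone τ p T hm]
    rw [lintegral_congr_ae (g := fun _ => 0), lintegral_zero]
    filter_upwards [h] with t ht
    rw [lintegral_congr_ae (g := fun _ => 0), lintegral_zero]
    filter_upwards [ht] with x hx
    simp [hx]
  rw [lintegral_eq_zero_iff' hm] at h0
  filter_upwards [h0] with z hz
  simpa [sub_eq_zero] using hz

/-! ### Integrability of weak wave maps -/

theorem memLp_two_iff_lintegral {X F : Type*} [MeasurableSpace X] [NormedAddCommGroup F]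
    {μ : Measure X} {f : X → F} :
    MemLp f 2 μ ↔ AEStronglyMeasurable f μ ∧ ∫⁻ x, ‖f x‖ₑ ^ 2 ∂μ < ⊤ := by
  rw [MemLp, eLpNorm_lt_top_iff_lintegral_rpow_enorm_lt_top (by norm_num) (by norm_num)]
  simp

theorem integrable_of_memLp_two {X F : Type*} [MeasurableSpace X] [NormedAddCommGroup F]
    {μ : Measure X} [IsFiniteMeasure μ] {f : X → F} (hf : MemLp f 2 μ) : Integrable f μ :=
  hf.integrable (by norm_num)

theorem integrable_inner_of_memLp {X : Type*} [MeasurableSpace X] {μ : Measure X}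
    {f g : X → E3} (hf : MemLp f 2 μ) (hg : MemLp g 2 μ) :
    Integrable (fun x => inner ℝ (f x) (g x)) μ := by
  refine Integrable.mono' (hf.norm.integrable_mul hg.norm)
    (hf.1.inner hg.1) (Eventually.of_forall fun x => norm_inner_le_norm _ _)

/-- The inner product of an integrable field with a bounded continuous one is integrable. -/
theorem integrable_inner_of_bounded {X : Type*} [MeasurableSpace X] [TopologicalSpace X]
    [OpensMeasurableSpace X] [SecondCountableTopology X]
    {μ : Measure X} {f g : X → E3} (hf : Integrable f μ) (hg : Continuous g) {C : ℝ}
    (hC : ∀ x, ‖g x‖ ≤ C) : Integrable (fun x => inner ℝ (f x) (g x)) μ := by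
  refine Integrable.mono' (hf.norm.mul_const C) (hf.1.inner hg.aestronglyMeasurable)
    (Eventually.of_forall fun x => (norm_inner_le_norm _ _).trans ?_)
  exact mul_le_mul_of_nonneg_left (hC x) (norm_nonneg _)

theorem integral_inner_eq_sum {X : Type*} [MeasurableSpace X] {μ : Measure X} {f g : X → E3}
    (h : ∀ j, Integrable (fun x => g x j • f x) μ) :
    ∫ x, inner ℝ (f x) (g x) ∂μ = ∑ j, (∫ x, g x j • f x ∂μ) j := by
  have h1 : ∀ j, (∫ x, g x j • f x ∂μ) j = ∫ x, g x j * f x j ∂μ := by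
    intro j
    have := (EuclideanSpace.proj j : E3 →L[ℝ] ℝ).integral_comp_comm (h j)
    simpa using this.symm
  simp only [h1]
  rw [← integral_finsetSum]
  · refine integral_congr_ae (Eventually.of_forall fun x => ?_)
    simp [PiLp.inner_apply]
  · intro j _
    simpa using (EuclideanSpace.proj j : E3 →L[ℝ] ℝ).integrable_comp (h j)

theorem exists_norm_le_of_hasCompactSupport {X F : Type*} [TopologicalSpace X]
    [NormedAddCommGroup F] {f : X → F} (hf : Continuous f) (hc : HasCompactSupport f) :
    ∃ C, 0 ≤ C ∧ ∀ x, ‖f x‖ ≤ C := by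
  obtain ⟨C, hC⟩ := hf.bounded_above_of_compact_support hc
  exact ⟨max C 0, le_max_right _ _, fun x => (hC x).trans (le_max_left _ _)⟩

section WeakWaveMap

variable {τ T : ℝ} {p : E3} {v vt : SpaceTime → E3} {dv : Fin 3 → SpaceTime → E3}

theorem IsWeakWaveMapOn.memLp_vt_slice (hv : IsWeakWaveMapOn (truncCone τ p T) v vt dv) {s t : ℝ}
    (hs : s ∈ Icc 0 T) (hst : s ≤ t) :
    MemLp (fun x => vt (s, x)) 2 (volume.restrict (disk τ p t)) :=
  (hv.continuous_vt _ (measurableSet_disk τ p t)).1 s (mem_timesOf_truncCone τ p hs hst)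

theorem IsWeakWaveMapOn.memLp_dv_slice (hv : IsWeakWaveMapOn (truncCone τ p T) v vt dv)
    (i : Fin 3) {s t : ℝ} (hs : s ∈ Icc 0 T) (hst : s ≤ t) :
    MemLp (fun x => dv i (s, x)) 2 (volume.restrict (disk τ p t)) :=
  (hv.continuous_dv _ (measurableSet_disk τ p t) i).1 s (mem_timesOf_truncCone τ p hs hst)

theorem IsWeakWaveMapOn.memLp_v_slice (hv : IsWeakWaveMapOn (truncCone τ p T) v vt dv) {s t : ℝ}
    (hs : s ∈ Icc 0 T) (hst : s ≤ t) :
    MemLp (fun x => v (s, x)) 2 (volume.restrict (disk τ p t)) :=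
  (hv.continuous_v _ (measurableSet_disk τ p t) Metric.isBounded_ball).1 s
    (mem_timesOf_truncCone τ p hs hst)

theorem IsWeakWaveMapOn.energy_ne_top (hv : IsWeakWaveMapOn (truncCone τ p T) v vt dv) {t : ℝ}
    (ht : t ∈ Icc 0 T) : energy τ p t vt dv ≠ ⊤ := by
  have h1 := memLp_two_iff_lintegral.1 (hv.memLp_vt_slice ht le_rfl)
  have h2 := fun i => memLp_two_iff_lintegral.1 (hv.memLp_dv_slice i ht le_rfl)
  refine ENNReal.mul_ne_top ENNReal.ofReal_ne_top ?_
  rw [lintegral_add_left' (h1.1.enorm.pow_const 2),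
    lintegral_finsetSum' _ (fun i _ => (h2 i).1.enorm.pow_const 2)]
  exact ENNReal.add_ne_top.2 ⟨h1.2.ne, (ENNReal.sum_lt_top.2 fun i _ => (h2 i).2).ne⟩

theorem lintegral_eq_two_mul_energy (τ : ℝ) (p : E3) (t : ℝ) (vt : SpaceTime → E3)
    (dv : Fin 3 → SpaceTime → E3) :
    ∫⁻ x in disk τ p t, (‖vt (t, x)‖ₑ ^ 2 + ∑ i, ‖dv i (t, x)‖ₑ ^ 2) =
      2 * energy τ p t vt dv := by
  have h : (2 : ENNReal) * ENNReal.ofReal (1 / 2) = 1 := by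
    rw [← ENNReal.ofReal_ofNat, ← ENNReal.ofReal_mul (by norm_num)]
    norm_num
  rw [energy, ← mul_assoc, h, one_mul]

/-- A field which is dominated by the energy density is square integrable on the cone. -/
theorem memLp_openCone_of_energy_le {f : SpaceTime → E3} {E0 : ENNReal} (hE0 : E0 ≠ ⊤)
    (hf : AEStronglyMeasurable f (volume.restrict (openCone τ p T)))
    (hle : ∀ t ∈ Ioo 0 T, energy τ p t vt dv ≤ E0)
    (hfe : ∀ z, ‖f z‖ₑ ^ 2 ≤ ‖vt z‖ₑ ^ 2 + ∑ i, ‖dv i z‖ₑ ^ 2) :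
    MemLp f 2 (volume.restrict (openCone τ p T)) := by
  refine memLp_two_iff_lintegral.2 ⟨hf, ?_⟩
  rw [lintegral_openCone τ p T (hf.enorm.pow_const 2)]
  refine (setLIntegral_mono' (g := fun _ => 2 * E0) measurableSet_Ioo fun t ht => ?_).trans_lt ?_
  · refine (lintegral_mono fun x => hfe (t, x)).trans ?_
    rw [lintegral_eq_two_mul_energy]
    exact mul_le_mul_right (hle t ht) 2
  · rw [setLIntegral_const]
    exact ENNReal.mul_lt_top (ENNReal.mul_lt_top (by simp) hE0.lt_top) (by simp)

theorem IsWeakWaveMapOn.memLp_vt (hv : IsWeakWaveMapOn (truncCone τ p T) v vt dv)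
    {E0 : ENNReal} (hE0 : E0 ≠ ⊤) (hle : ∀ t ∈ Ioo 0 T, energy τ p t vt dv ≤ E0) :
    MemLp vt 2 (volume.restrict (openCone τ p T)) :=
  memLp_openCone_of_energy_le hE0
    (hv.measurable_vt.mono_measure (Measure.restrict_mono (openCone_subset_truncCone τ p T) le_rfl))
    hle fun _ => le_self_add

theorem IsWeakWaveMapOn.memLp_dv (hv : IsWeakWaveMapOn (truncCone τ p T) v vt dv)
    {E0 : ENNReal} (hE0 : E0 ≠ ⊤) (hle : ∀ t ∈ Ioo 0 T, energy τ p t vt dv ≤ E0) (i : Fin 3) :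
    MemLp (dv i) 2 (volume.restrict (openCone τ p T)) :=
  memLp_openCone_of_energy_le hE0
    ((hv.measurable_dv i).mono_measure
      (Measure.restrict_mono (openCone_subset_truncCone τ p T) le_rfl))
    hle fun z => (Finset.single_le_sum (f := fun i => ‖dv i z‖ₑ ^ 2) (fun _ _ => zero_le)
      (Finset.mem_univ i)).trans le_add_self

theorem IsWeakWaveMapOn.aestronglyMeasurable_v
    (hv : IsWeakWaveMapOn (truncCone τ p T) v vt dv) :
    AEStronglyMeasurable v (volume.restrict (openCone τ p T)) :=
  hv.measurable_v.mono_measure (Measure.restrict_mono (openCone_subset_truncCone τ p T) le_rfl)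

theorem IsWeakWaveMapOn.norm_eq_one_slice (hv : IsWeakWaveMapOn (truncCone τ p T) v vt dv)
    {t : ℝ} (ht : t ∈ Icc 0 T) : ∀ᵐ x ∂volume.restrict (disk τ p t), ‖v (t, x)‖ = 1 := by
  rw [ae_restrict_iff' (measurableSet_disk τ p t)]
  filter_upwards [hv.norm_eq_one t] with x hx hxd
  exact hx ⟨ht, hxd⟩

theorem IsWeakWaveMapOn.norm_eq_one_ae (hv : IsWeakWaveMapOn (truncCone τ p T) v vt dv) :
    ∀ᵐ z ∂volume.restrict (openCone τ p T), ‖v z‖ = 1 := by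
  refine ae_openCone_eq_of_ae_disk (f := fun z => ‖v z‖) (g := fun _ => 1)
    hv.aestronglyMeasurable_v.norm aestronglyMeasurable_const ?_
  rw [ae_restrict_iff' measurableSet_Ioo]
  exact Eventually.of_forall fun t ht => hv.norm_eq_one_slice (Ioo_subset_Icc_self ht)

theorem IsWeakWaveMapOn.integrable_v (hv : IsWeakWaveMapOn (truncCone τ p T) v vt dv) :
    Integrable v (volume.restrict (openCone τ p T)) :=
  Integrable.of_bound hv.aestronglyMeasurable_v 1 (hv.norm_eq_one_ae.mono fun _ h => h.le)

end WeakWaveMap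

/-! ### Test fields and weak derivatives -/

section WeakIdentities

variable {τ T : ℝ} {p : E3} {v vt : SpaceTime → E3} {dv : Fin 3 → SpaceTime → E3}

theorem IsTestOn.eq_zero {X F : Type*} [NormedAddCommGroup X] [NormedSpace ℝ X]
    [NormedAddCommGroup F] [NormedSpace ℝ F] {Ω : Set X} {φ : X → F} (h : IsTestOn Ω φ) {x : X}
    (hx : x ∉ Ω) : φ x = 0 :=
  image_eq_zero_of_notMem_tsupport fun h' => hx (interior_subset (h.2.2 h'))

theorem IsTestOn.mono {X F : Type*} [NormedAddCommGroup X] [NormedSpace ℝ X]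
    [NormedAddCommGroup F] [NormedSpace ℝ F] {Ω Ω' : Set X} {φ : X → F} (h : IsTestOn Ω φ)
    (hΩ : Ω ⊆ Ω') : IsTestOn Ω' φ :=
  ⟨h.1, h.2.1, h.2.2.trans (interior_mono hΩ)⟩

theorem IsTestOn.timeDeriv {F : Type*} [NormedAddCommGroup F] [NormedSpace ℝ F]
    {Ω : Set SpaceTime} {φ : SpaceTime → F} (h : IsTestOn Ω φ) : IsTestOn Ω (timeDeriv φ) :=
  ⟨contDiff_timeDeriv h.1, h.2.1.of_isClosed_subset (isClosed_tsupport _)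
    (tsupport_timeDeriv_subset φ), (tsupport_timeDeriv_subset φ).trans h.2.2⟩

theorem IsTestOn.spaceDeriv {F : Type*} [NormedAddCommGroup F] [NormedSpace ℝ F]
    {Ω : Set SpaceTime} {φ : SpaceTime → F} (h : IsTestOn Ω φ) (i : Fin 3) :
    IsTestOn Ω (spaceDeriv i φ) :=
  ⟨contDiff_spaceDeriv h.1 i, h.2.1.of_isClosed_subset (isClosed_tsupport _)
    (tsupport_spaceDeriv_subset i φ), (tsupport_spaceDeriv_subset i φ).trans h.2.2⟩

theorem IsTestOn.smul_right {F : Type*} [NormedAddCommGroup F] [NormedSpace ℝ F]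
    {Ω : Set SpaceTime} {φ : SpaceTime → ℝ} (h : IsTestOn Ω φ) {a : SpaceTime → F}
    (ha : ContDiff ℝ ∞ a) : IsTestOn Ω (fun z => φ z • a z) :=
  ⟨h.1.smul ha, h.2.1.smul_right, (tsupport_smul_subset_left φ a).trans h.2.2⟩

theorem IsTestOn.exists_norm_le {X F : Type*} [NormedAddCommGroup X] [NormedSpace ℝ X]
    [NormedAddCommGroup F] [NormedSpace ℝ F] {Ω : Set X} {φ : X → F} (h : IsTestOn Ω φ) :
    ∃ C, 0 ≤ C ∧ ∀ x, ‖φ x‖ ≤ C :=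
  exists_norm_le_of_hasCompactSupport h.1.continuous h.2.1

theorem IsTestOn.integrable_inner {Ω : Set SpaceTime} {Ψ : SpaceTime → E3} (h : IsTestOn Ω Ψ)
    {μ : Measure SpaceTime} {f : SpaceTime → E3} (hf : Integrable f μ) :
    Integrable (fun z => inner ℝ (f z) (Ψ z)) μ := by
  obtain ⟨C, -, hC⟩ := h.exists_norm_le
  exact integrable_inner_of_bounded hf h.1.continuous hC

theorem IsTestOn.component {X : Type*} [NormedAddCommGroup X] [NormedSpace ℝ X]
    {Ω : Set X} {Ψ : X → E3} (h : IsTestOn Ω Ψ) (j : Fin 3) : IsTestOn Ω (fun z => Ψ z j) := by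
  refine ⟨(EuclideanSpace.proj j : E3 →L[ℝ] ℝ).contDiff.comp h.1,
    h.2.1.comp_left (g := fun y : E3 => y j) rfl,
    (tsupport_comp_subset (g := fun y : E3 => y j) rfl Ψ).trans h.2.2⟩

theorem fderiv_component {X : Type*} [NormedAddCommGroup X] [NormedSpace ℝ X] {Ψ : X → E3} {x : X}
    (h : DifferentiableAt ℝ Ψ x) (j : Fin 3) (e : X) :
    fderiv ℝ (fun z => Ψ z j) x e = (fderiv ℝ Ψ x e) j := by
  have := (EuclideanSpace.proj j : E3 →L[ℝ] ℝ).hasFDerivAt.comp x h.hasFDerivAt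
  have h2 : fderiv ℝ (fun z => Ψ z j) x = _ := this.fderiv
  rw [h2]; rfl

/-- A field which is integrable on a set can be paired there with a bounded scalar function. -/
theorem integrable_smul_of_bounded {X F : Type*} [MeasurableSpace X] [TopologicalSpace X]
    [OpensMeasurableSpace X] [NormedAddCommGroup F] [NormedSpace ℝ F]
    {μ : Measure X} {f : X → F} {φ : X → ℝ} (hf : Integrable f μ) (hφ : Continuous φ) {C : ℝ}
    (hC : ∀ x, ‖φ x‖ ≤ C) : Integrable (fun x => φ x • f x) μ :=
  hf.bdd_smul C hφ.aestronglyMeasurable (Eventually.of_forall hC)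

/-- The weak time derivative, tested with a vector field. -/
theorem IsWeakWaveMapOn.integral_inner_timeDeriv
    (hv : IsWeakWaveMapOn (truncCone τ p T) v vt dv)
    (hvt : Integrable vt (volume.restrict (openCone τ p T)))
    {Ψ : SpaceTime → E3} (hΨ : IsTestOn (openCone τ p T) Ψ) :
    ∫ z in openCone τ p T, inner ℝ (v z) (timeDeriv Ψ z) =
      - ∫ z in openCone τ p T, inner ℝ (vt z) (Ψ z) := by
  have hc := fun j => (hΨ.component j)
  have hI1 : ∀ j, Integrable (fun z => timeDeriv Ψ z j • v z)
      (volume.restrict (openCone τ p T)) := fun j =>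
    have ⟨C, _, hC⟩ := (hΨ.timeDeriv.component j).exists_norm_le
    integrable_smul_of_bounded hv.integrable_v (hΨ.timeDeriv.component j).1.continuous hC
  have hI2 : ∀ j, Integrable (fun z => Ψ z j • vt z)
      (volume.restrict (openCone τ p T)) := fun j =>
    have ⟨C, _, hC⟩ := (hΨ.component j).exists_norm_le
    integrable_smul_of_bounded hvt (hΨ.component j).1.continuous hC
  rw [integral_inner_eq_sum hI1, integral_inner_eq_sum hI2, ← Finset.sum_neg_distrib]
  refine Finset.sum_congr rfl fun j _ => ?_
  have h := hv.weak_timeDeriv _ ((hc j).mono (openCone_subset_truncCone τ p T))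
  have e1 : ∀ z, WaveMap.timeDeriv (fun z => Ψ z j) z = timeDeriv Ψ z j := fun z =>
    fderiv_component (hΨ.1.differentiable (by simp) z) j _
  simp only [e1] at h
  rw [setIntegral_eq_integral_of_forall_compl_eq_zero fun z hz => by
      rw [hΨ.timeDeriv.eq_zero hz]; simp, h,
    setIntegral_eq_integral_of_forall_compl_eq_zero fun z hz => by rw [hΨ.eq_zero hz]; simp]
  rfl

theorem IsTestOn.slice {F : Type*} [NormedAddCommGroup F] [NormedSpace ℝ F]
    {Ψ : SpaceTime → F} (hΨ : IsTestOn (openCone τ p T) Ψ) (t : ℝ) :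
    IsTestOn (disk τ p t) (fun x => Ψ (t, x)) := by
  have hcont : Continuous fun x : E3 => ((t, x) : SpaceTime) := by fun_prop
  have hsub : tsupport (fun x => Ψ (t, x)) ⊆ (fun x : E3 => ((t, x) : SpaceTime)) ⁻¹' tsupport Ψ :=
    tsupport_comp_subset_preimage Ψ hcont
  refine ⟨hΨ.1.comp (contDiff_const.prodMk contDiff_id), ?_, ?_⟩
  · refine HasCompactSupport.of_support_subset_isCompact (hΨ.2.1.isCompact.image continuous_snd)
      fun x hx => ⟨(t, x), hsub (subset_tsupport _ hx), rfl⟩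
  · refine subset_interior_iff.2 ⟨_, Metric.isOpen_ball, fun x hx => ?_, subset_rfl⟩
    exact (interior_subset (hΨ.2.2 (hsub hx))).2

theorem fderiv_slice {F : Type*} [NormedAddCommGroup F] [NormedSpace ℝ F] {Ψ : SpaceTime → F}
    (hΨ : ContDiff ℝ ∞ Ψ) (t : ℝ) (x : E3) (i : Fin 3) :
    fderiv ℝ (fun x => Ψ (t, x)) x (EuclideanSpace.single i 1) = spaceDeriv i Ψ (t, x) := by
  have h1 : HasFDerivAt (fun x : E3 => ((t, x) : SpaceTime))
      ((0 : E3 →L[ℝ] ℝ).prod (ContinuousLinearMap.id ℝ E3)) x :=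
    (hasFDerivAt_const t x).prodMk (hasFDerivAt_id x)
  have h2 := (hΨ.differentiable (by simp) (t, x)).hasFDerivAt.comp x h1
  have h3 : fderiv ℝ (fun x => Ψ (t, x)) x = _ := h2.fderiv
  rw [h3]; rfl

theorem IsWeakWaveMapOn.integral_inner_spaceDeriv_slice
    (hv : IsWeakWaveMapOn (truncCone τ p T) v vt dv) (i : Fin 3) {t : ℝ} (ht : t ∈ Icc 0 T)
    {Ψ : E3 → E3} (hΨ : IsTestOn (disk τ p t) Ψ) :
    ∫ x in disk τ p t, inner ℝ (v (t, x)) (fderiv ℝ Ψ x (EuclideanSpace.single i 1)) =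
      - ∫ x in disk τ p t, inner ℝ (dv i (t, x)) (Ψ x) := by
  have hΨ' : IsTestOn (disk τ p t) fun x => fderiv ℝ Ψ x (EuclideanSpace.single i 1) :=
    ⟨(hΨ.1.fderiv_right (m := ∞) le_rfl).clm_apply contDiff_const, hΨ.2.1.fderiv_apply ℝ _,
      (tsupport_fderiv_apply_subset ℝ _).trans hΨ.2.2⟩
  have hI1 : ∀ j, Integrable (fun x => (fderiv ℝ Ψ x (EuclideanSpace.single i 1)) j • v (t, x))
      (volume.restrict (disk τ p t)) := fun j =>
    have ⟨C, _, hC⟩ := (hΨ'.component j).exists_norm_le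
    integrable_smul_of_bounded (integrable_of_memLp_two (hv.memLp_v_slice ht le_rfl))
      (hΨ'.component j).1.continuous hC
  have hI2 : ∀ j, Integrable (fun x => Ψ x j • dv i (t, x))
      (volume.restrict (disk τ p t)) := fun j =>
    have ⟨C, _, hC⟩ := (hΨ.component j).exists_norm_le
    integrable_smul_of_bounded (integrable_of_memLp_two (hv.memLp_dv_slice i ht le_rfl))
      (hΨ.component j).1.continuous hC
  rw [integral_inner_eq_sum hI1, integral_inner_eq_sum hI2, ← Finset.sum_neg_distrib]
  refine Finset.sum_congr rfl fun j _ => ?_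
  have h := hv.weak_spaceDeriv t i _ (by rw [slice_truncCone τ p ht]; exact hΨ.component j)
  have e1 : ∀ x, fderiv ℝ (fun z => Ψ z j) x (EuclideanSpace.single i 1) =
      (fderiv ℝ Ψ x (EuclideanSpace.single i 1)) j := fun x =>
    fderiv_component (hΨ.1.differentiable (by simp) x) j _
  simp only [e1] at h
  rw [setIntegral_eq_integral_of_forall_compl_eq_zero fun z hz => by
      rw [hΨ'.eq_zero hz]; simp, h,
    setIntegral_eq_integral_of_forall_compl_eq_zero fun z hz => by rw [hΨ.eq_zero hz]; simp]
  rfl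

/-- The weak space derivatives of the time slices are weak space derivatives on space-time. -/
theorem IsWeakWaveMapOn.integral_inner_spaceDeriv
    (hv : IsWeakWaveMapOn (truncCone τ p T) v vt dv) (i : Fin 3)
    (hdv : Integrable (dv i) (volume.restrict (openCone τ p T)))
    {Ψ : SpaceTime → E3} (hΨ : IsTestOn (openCone τ p T) Ψ) :
    ∫ z in openCone τ p T, inner ℝ (v z) (spaceDeriv i Ψ z) =
      - ∫ z in openCone τ p T, inner ℝ (dv i z) (Ψ z) := by
  rw [integral_openCone τ p T ((hΨ.spaceDeriv i).integrable_inner hv.integrable_v),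
    integral_openCone τ p T (hΨ.integrable_inner hdv), ← integral_neg]
  refine setIntegral_congr_fun measurableSet_Ioo fun t ht => ?_
  have ht' := Ioo_subset_Icc_self ht
  have h := hv.integral_inner_spaceDeriv_slice i ht' (hΨ.slice t)
  simp only [fderiv_slice hΨ.1] at h
  exact h

/-- The mixed weak derivatives `∂ₜ∂ᵢv` and `∂ᵢ∂ₜv` agree as distributions. -/
theorem IsWeakWaveMapOn.integral_inner_vt_spaceDeriv
    (hv : IsWeakWaveMapOn (truncCone τ p T) v vt dv) (i : Fin 3)
    (hvt : Integrable vt (volume.restrict (openCone τ p T)))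
    (hdv : Integrable (dv i) (volume.restrict (openCone τ p T)))
    {Ψ : SpaceTime → E3} (hΨ : IsTestOn (openCone τ p T) Ψ) :
    ∫ z in openCone τ p T, inner ℝ (vt z) (spaceDeriv i Ψ z) =
      ∫ z in openCone τ p T, inner ℝ (dv i z) (timeDeriv Ψ z) := by
  have h1 := hv.integral_inner_timeDeriv hvt (hΨ.spaceDeriv i)
  have h2 := hv.integral_inner_spaceDeriv i hdv hΨ.timeDeriv
  simp only [timeDeriv_spaceDeriv_comm hΨ.1] at h1
  linarith

end WeakIdentities

/-! ### The polarised energy law -/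

/-- The density `|∂ₜv|² - |∇v|²`. -/
noncomputable def lagrangian (vt : SpaceTime → E3) (dv : Fin 3 → SpaceTime → E3)
    (z : SpaceTime) : ℝ :=
  ‖vt z‖ ^ 2 - ∑ i, ‖dv i z‖ ^ 2

/-- The polarised energy density `∂ₜv · ∂ₜu + ∇v · ∇u`. -/
noncomputable def crossEnergy (vt : SpaceTime → E3) (dv : Fin 3 → SpaceTime → E3)
    (u : SpaceTime → E3) (z : SpaceTime) : ℝ :=
  inner ℝ (vt z) (timeDeriv u z) + ∑ i, inner ℝ (dv i z) (spaceDeriv i u z)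

/-- The polarised energy current `∂ᵢv · ∂ₜu + ∂ₜv · ∂ᵢu`. -/
noncomputable def crossCurrent (vt : SpaceTime → E3) (dv : Fin 3 → SpaceTime → E3)
    (u : SpaceTime → E3) (i : Fin 3) (z : SpaceTime) : ℝ :=
  inner ℝ (dv i z) (timeDeriv u z) + inner ℝ (vt z) (spaceDeriv i u z)

/-- The source `-(□v · ∂ₜu + □u · ∂ₜv)` of the polarised energy, expressed through the wave map
equations. -/
noncomputable def crossSource (v vt : SpaceTime → E3) (dv : Fin 3 → SpaceTime → E3)
    (u : SpaceTime → E3) (z : SpaceTime) : ℝ :=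
  lagrangian (timeDeriv u) (fun i => spaceDeriv i u) z * inner ℝ (u z) (vt z) +
    lagrangian vt dv z * inner ℝ (v z) (timeDeriv u z)

/-- The polarised energy law. The weak equation for `v` is tested with `ζ ∂ₜu`; the term
`∇v · ∇∂ₜu` which this produces is rewritten by the commutation of the mixed weak derivatives of
`v`, tested with `ζ ∂ᵢu`. -/
theorem integral_crossEnergy_law {O : Set SpaceTime} (hO : MeasurableSet O)
    {v vt : SpaceTime → E3} {dv : Fin 3 → SpaceTime → E3} {u : SpaceTime → E3}
    (hu : ContDiff ℝ ∞ u)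
    (hbox : ∀ z ∈ O,
      box u z + lagrangian (timeDeriv u) (fun i => spaceDeriv i u) z • u z = 0)
    (hvt : IntegrableOn vt O) (hdv : ∀ i, IntegrableOn (dv i) O)
    (hN : IntegrableOn (fun z => lagrangian vt dv z • v z) O)
    (hmixed : ∀ (i : Fin 3) (Ψ : SpaceTime → E3), IsTestOn O Ψ →
      ∫ z in O, inner ℝ (vt z) (spaceDeriv i Ψ z) = ∫ z in O, inner ℝ (dv i z) (timeDeriv Ψ z))
    (heq : ∀ ψ : SpaceTime → E3, IsTestOn O ψ →
      ∫ z in O, (- inner ℝ (vt z) (timeDeriv ψ z) + ∑ i, inner ℝ (dv i z) (spaceDeriv i ψ z)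
        + lagrangian vt dv z * inner ℝ (v z) (ψ z)) = 0)
    {ζ : SpaceTime → ℝ} (hζ : IsTestOn O ζ) :
    ∫ z in O, (- (timeDeriv ζ z * crossEnergy vt dv u z)
      + ∑ i, spaceDeriv i ζ z * crossCurrent vt dv u i z + ζ z * crossSource v vt dv u z) = 0 := by
  have hut := contDiff_timeDeriv hu
  have hui := contDiff_spaceDeriv hu
  have hψ : IsTestOn O fun z => ζ z • timeDeriv u z := hζ.smul_right hut
  have hΨ : ∀ i, IsTestOn O fun z => ζ z • spaceDeriv i u z := fun i => hζ.smul_right (hui i)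
  set A : SpaceTime → ℝ := fun z =>
    - inner ℝ (vt z) (timeDeriv (fun z => ζ z • timeDeriv u z) z)
      + ∑ i, inner ℝ (dv i z) (spaceDeriv i (fun z => ζ z • timeDeriv u z) z)
      + lagrangian vt dv z * inner ℝ (v z) (ζ z • timeDeriv u z) with hA
  set B : Fin 3 → SpaceTime → ℝ := fun i z =>
    inner ℝ (vt z) (spaceDeriv i (fun z => ζ z • spaceDeriv i u z) z)
      - inner ℝ (dv i z) (timeDeriv (fun z => ζ z • spaceDeriv i u z) z) with hB
  have hAint : IntegrableOn A O := by
    refine ((hψ.timeDeriv.integrable_inner hvt).neg.add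
      (integrable_finsetSum _ fun i _ => (hψ.spaceDeriv i).integrable_inner (hdv i))).add ?_
    simpa only [real_inner_smul_left] using hψ.integrable_inner hN
  have hBint : ∀ i, IntegrableOn (B i) O := fun i =>
    (((hΨ i).spaceDeriv i).integrable_inner hvt).sub ((hΨ i).timeDeriv.integrable_inner (hdv i))
  have hA0 : ∫ z in O, A z = 0 := heq _ hψ
  have hB0 : ∀ i, ∫ z in O, B i z = 0 := fun i => by
    rw [integral_sub (((hΨ i).spaceDeriv i).integrable_inner hvt)
      ((hΨ i).timeDeriv.integrable_inner (hdv i)), hmixed i _ (hΨ i), sub_self]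
  have hsum : ∫ z in O, (A z + ∑ i, B i z) = 0 := by
    rw [integral_add hAint (integrable_finsetSum _ fun i _ => hBint i),
      integral_finsetSum _ fun i _ => hBint i]
    simp [hA0, hB0]
  rw [← hsum]
  refine setIntegral_congr_fun hO fun z hz => ?_
  have hb : timeDeriv (timeDeriv u) z = ∑ i, spaceDeriv i (spaceDeriv i u) z
      - lagrangian (timeDeriv u) (fun i => spaceDeriv i u) z • u z := by
    have := hbox z hz
    rw [box] at this
    rw [eq_sub_iff_add_eq]
    rwa [sub_add_eq_add_sub, sub_eq_zero] at this
  simp only [hA, hB, timeDeriv_smul hζ.1 hut, spaceDeriv_smul _ hζ.1 hut,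
    timeDeriv_smul hζ.1 (hui _), spaceDeriv_smul _ hζ.1 (hui _), timeDeriv_spaceDeriv_comm hu, hb,
    crossEnergy, crossCurrent, crossSource, inner_add_right, inner_sub_right, inner_smul_right,
    Fin.sum_univ_three, real_inner_comm (vt z) (u z)]
  ring

theorem IsWeakWaveMapOn.integrable_lagrangian_smul {τ T : ℝ} {p : E3} {v vt : SpaceTime → E3}
    {dv : Fin 3 → SpaceTime → E3} (hv : IsWeakWaveMapOn (truncCone τ p T) v vt dv)
    (hvt : MemLp vt 2 (volume.restrict (openCone τ p T)))
    (hdv : ∀ i, MemLp (dv i) 2 (volume.restrict (openCone τ p T))) :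
    IntegrableOn (fun z => lagrangian vt dv z • v z) (openCone τ p T) := by
  have h1 : Integrable (lagrangian vt dv) (volume.restrict (openCone τ p T)) :=
    ((memLp_two_iff_integrable_sq_norm hvt.1).1 hvt).sub
      (integrable_finsetSum _ fun i _ => (memLp_two_iff_integrable_sq_norm (hdv i).1).1 (hdv i))
  refine h1.norm.mono' (h1.1.smul hv.aestronglyMeasurable_v) ?_
  filter_upwards [hv.norm_eq_one_ae] with z hz
  rw [norm_smul, hz, mul_one]

/-- The polarised energy law for a weak wave map `v` and a smooth wave map `u`. -/
theorem IsWeakWaveMapOn.integral_crossEnergy_law {τ T : ℝ} {p : E3} {v vt : SpaceTime → E3}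
    {dv : Fin 3 → SpaceTime → E3} (hv : IsWeakWaveMapOn (truncCone τ p T) v vt dv)
    (hvt : MemLp vt 2 (volume.restrict (openCone τ p T)))
    (hdv : ∀ i, MemLp (dv i) 2 (volume.restrict (openCone τ p T)))
    {u : SpaceTime → E3} (hu : ContDiff ℝ ∞ u)
    (hbox : ∀ z ∈ openCone τ p T,
      box u z + lagrangian (timeDeriv u) (fun i => spaceDeriv i u) z • u z = 0)
    {ζ : SpaceTime → ℝ} (hζ : IsTestOn (openCone τ p T) ζ) :
    ∫ z in openCone τ p T, (- (timeDeriv ζ z * crossEnergy vt dv u z)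
      + ∑ i, spaceDeriv i ζ z * crossCurrent vt dv u i z + ζ z * crossSource v vt dv u z) = 0 := by
  have hvt1 := integrable_of_memLp_two hvt
  have hdv1 := fun i => integrable_of_memLp_two (hdv i)
  refine WaveMap.integral_crossEnergy_law (measurableSet_openCone τ p T) hu hbox hvt1 hdv1
    (hv.integrable_lagrangian_smul hvt hdv)
    (fun i Ψ hΨ => hv.integral_inner_vt_spaceDeriv i hvt1 (hdv1 i) hΨ) (fun ψ hψ => ?_) hζ
  rw [← hv.equation ψ (hψ.mono (openCone_subset_truncCone τ p T))]
  refine setIntegral_eq_integral_of_forall_compl_eq_zero fun z hz => ?_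
  rw [hψ.timeDeriv.eq_zero hz, hψ.eq_zero hz]
  simp [(hψ.spaceDeriv _).eq_zero hz]

theorem integral_openCone_inner_fderiv {τ T : ℝ} {p : E3} {a Ψ : SpaceTime → E3}
    (ha : ContDiff ℝ ∞ a) (hΨ : IsTestOn (openCone τ p T) Ψ) (e : SpaceTime) :
    ∫ z in openCone τ p T, inner ℝ (a z) (fderiv ℝ Ψ z e) =
      - ∫ z in openCone τ p T, inner ℝ (fderiv ℝ a z e) (Ψ z) := by
  have h := integral_inner_fderiv_eq_neg ha hΨ.1 hΨ.2.1 e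
  rwa [← setIntegral_eq_integral_of_forall_compl_eq_zero (s := openCone τ p T) fun z hz => by
      rw [image_eq_zero_of_notMem_tsupport (f := fun z => fderiv ℝ Ψ z e)
        fun h' => hz (interior_subset (hΨ.2.2 (tsupport_fderiv_apply_subset ℝ e h')))]; simp,
    ← setIntegral_eq_integral_of_forall_compl_eq_zero (s := openCone τ p T)
      (f := fun z => inner ℝ (fderiv ℝ a z e) (Ψ z)) fun z hz => by
      rw [hΨ.eq_zero hz]; simp] at h

theorem integrableOn_openCone_of_continuous {τ T : ℝ} {p : E3} {F : Type*} [NormedAddCommGroup F]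
    {f : SpaceTime → F} (hf : Continuous f) : IntegrableOn f (openCone τ p T) :=
  (hf.continuousOn.integrableOn_compact (isCompact_closedTruncCone τ p T)).mono_set
    ((openCone_subset_truncCone τ p T).trans (truncCone_subset_closedTruncCone τ p T))

theorem continuous_lagrangian {vt : SpaceTime → E3} {dv : Fin 3 → SpaceTime → E3}
    (hvt : Continuous vt) (hdv : ∀ i, Continuous (dv i)) : Continuous (lagrangian vt dv) := by
  unfold lagrangian
  fun_prop

/-- The polarised energy law for a smooth wave map `u` with itself. -/
theorem integral_crossEnergy_law_self {τ T : ℝ} {p : E3}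
    {u : SpaceTime → E3} (hu : ContDiff ℝ ∞ u)
    (hbox : ∀ z ∈ openCone τ p T,
      box u z + lagrangian (timeDeriv u) (fun i => spaceDeriv i u) z • u z = 0)
    {ζ : SpaceTime → ℝ} (hζ : IsTestOn (openCone τ p T) ζ) :
    ∫ z in openCone τ p T, (- (timeDeriv ζ z * crossEnergy (timeDeriv u) (fun i => spaceDeriv i u) u z)
      + ∑ i, spaceDeriv i ζ z * crossCurrent (timeDeriv u) (fun i => spaceDeriv i u) u i z
      + ζ z * crossSource u (timeDeriv u) (fun i => spaceDeriv i u) u z) = 0 := by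
  have hut := contDiff_timeDeriv hu
  have hui := contDiff_spaceDeriv hu
  refine integral_crossEnergy_law (measurableSet_openCone τ p T) hu hbox
    (integrableOn_openCone_of_continuous hut.continuous)
    (fun i => integrableOn_openCone_of_continuous (hui i).continuous)
    (integrableOn_openCone_of_continuous ((continuous_lagrangian hut.continuous
      fun i => (hui i).continuous).smul hu.continuous)) (fun i Ψ hΨ => ?_) (fun ψ hψ => ?_) hζ
  · have h1 : ∫ z in openCone τ p T, inner ℝ (timeDeriv u z) (spaceDeriv i Ψ z) = _ :=
      integral_openCone_inner_fderiv hut hΨ _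
    have h2 : ∫ z in openCone τ p T, inner ℝ (spaceDeriv i u z) (timeDeriv Ψ z) = _ :=
      integral_openCone_inner_fderiv (hui i) hΨ _
    rw [h1, h2]
    congr 1
    refine integral_congr_ae (Eventually.of_forall fun z => ?_)
    have := timeDeriv_spaceDeriv_comm hu i z
    simp only [timeDeriv, spaceDeriv] at this ⊢
    rw [this]
  · have h1 : ∫ z in openCone τ p T, inner ℝ (timeDeriv u z) (timeDeriv ψ z) =
        - ∫ z in openCone τ p T, inner ℝ (timeDeriv (timeDeriv u) z) (ψ z) :=
      integral_openCone_inner_fderiv hut hψ _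
    have h2 : ∀ i, ∫ z in openCone τ p T, inner ℝ (spaceDeriv i u z) (spaceDeriv i ψ z) =
        - ∫ z in openCone τ p T, inner ℝ (spaceDeriv i (spaceDeriv i u) z) (ψ z) :=
      fun i => integral_openCone_inner_fderiv (hui i) hψ _
    have hI : ∀ {f g : SpaceTime → E3}, Continuous f → Continuous g →
        IntegrableOn (fun z => inner ℝ (f z) (g z)) (openCone τ p T) := fun hf hg =>
      integrableOn_openCone_of_continuous (hf.inner hg)
    have I1 := hI hut.continuous hψ.timeDeriv.1.continuous
    have I2 := fun i => hI (hui i).continuous (hψ.spaceDeriv i).1.continuous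
    have I3 : IntegrableOn (fun z => lagrangian (timeDeriv u) (fun i => spaceDeriv i u) z *
        inner ℝ (u z) (ψ z)) (openCone τ p T) :=
      integrableOn_openCone_of_continuous ((continuous_lagrangian hut.continuous
      fun i => (hui i).continuous).mul (hu.continuous.inner hψ.1.continuous))
    have I4 := hI (contDiff_timeDeriv hut).continuous hψ.1.continuous
    have I5 := fun i => hI (contDiff_spaceDeriv (hui i) i).continuous hψ.1.continuous
    have I6 := integrable_finsetSum Finset.univ fun i _ => I5 i
    have J0 : IntegrableOn (fun z => ∑ i, inner ℝ (spaceDeriv i u z) (spaceDeriv i ψ z))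
        (openCone τ p T) := integrable_finsetSum _ fun i _ => I2 i
    have J1 : IntegrableOn (fun z => - inner ℝ (timeDeriv u z) (timeDeriv ψ z))
        (openCone τ p T) := I1.neg
    have J2 : IntegrableOn (fun z => - inner ℝ (timeDeriv u z) (timeDeriv ψ z) +
        ∑ i, inner ℝ (spaceDeriv i u z) (spaceDeriv i ψ z)) (openCone τ p T) := J1.add J0
    have J3 : IntegrableOn (fun z => inner ℝ (timeDeriv (timeDeriv u) z) (ψ z) -
        ∑ i, inner ℝ (spaceDeriv i (spaceDeriv i u) z) (ψ z)) (openCone τ p T) := I4.sub I6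
    rw [integral_add J2 I3, integral_add J1 J0,
      integral_finsetSum _ fun i _ => I2 i, integral_neg, h1]
    simp only [h2, neg_neg]
    rw [Finset.sum_neg_distrib, ← integral_finsetSum _ fun i _ => I5 i, ← sub_eq_add_neg,
      ← integral_sub I4 I6, ← integral_add J3 I3]
    refine setIntegral_eq_zero_of_forall_eq_zero fun z hz => ?_
    have h := congrArg (fun y => inner ℝ y (ψ z)) (hbox z hz)
    simpa only [box, inner_add_left, inner_sub_left, sum_inner, inner_zero_left,
      real_inner_smul_left] using h

/-! ### Cutoffs along the side of the cone -/

/-- The horizontal distance `τ - s - |x - p|` of `(s, x)` from the side of the cone, positive inside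
the cone. -/
noncomputable def coneDepth (τ : ℝ) (p : E3) (z : SpaceTime) : ℝ := τ - z.1 - ‖z.2 - p‖

/-- The components of the radial unit vector `(x - p) / |x - p|`. -/
noncomputable def radialDir (p : E3) (i : Fin 3) (z : SpaceTime) : ℝ :=
  (z.2 i - p i) / ‖z.2 - p‖

theorem continuous_coneDepth (τ : ℝ) (p : E3) : Continuous (coneDepth τ p) := by
  unfold coneDepth; fun_prop

theorem coneDepth_pos_iff {τ : ℝ} {p : E3} {z : SpaceTime} :
    0 < coneDepth τ p z ↔ z.2 ∈ disk τ p z.1 := by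
  rw [disk, mem_ball_iff_norm, coneDepth, sub_pos]

theorem measurable_radialDir (p : E3) (i : Fin 3) : Measurable (radialDir p i) := by
  unfold radialDir
  have : Measurable fun z : SpaceTime => z.2 i :=
    ((EuclideanSpace.proj i : E3 →L[ℝ] ℝ).continuous.comp continuous_snd).measurable
  exact (this.sub_const _).div (by fun_prop)

theorem abs_radialDir_le_one (p : E3) (i : Fin 3) (z : SpaceTime) : |radialDir p i z| ≤ 1 := by
  rw [radialDir, abs_div, abs_norm]
  refine div_le_one_of_le₀ ?_ (norm_nonneg _)
  simpa using PiLp.norm_apply_le (z.2 - p) i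

theorem hasFDerivAt_coneDepth (τ : ℝ) {p : E3} {z : SpaceTime} (hz : z.2 ≠ p) :
    ∃ L : SpaceTime →L[ℝ] ℝ, HasFDerivAt (coneDepth τ p) L z ∧ L (1, 0) = -1 ∧
      ∀ i, L (0, EuclideanSpace.single i 1) = - radialDir p i z := by
  have hne : z.2 - p ≠ 0 := sub_ne_zero.2 hz
  have h1 : HasFDerivAt (fun z : SpaceTime => z.2 - p) (ContinuousLinearMap.snd ℝ ℝ E3) z :=
    hasFDerivAt_snd.sub_const p
  have h2 := h1.norm_sq.sqrt (by positivity)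
  have h3 := ((hasFDerivAt_fst (𝕜 := ℝ) (p := z)).const_sub τ).sub h2
  refine ⟨_, h3.congr_of_eventuallyEq (Eventually.of_forall fun y => ?_), ?_, fun i => ?_⟩
  · simp [coneDepth, Real.sqrt_sq (norm_nonneg _)]
  · simp
  · simp only [radialDir, Real.sqrt_sq (norm_nonneg _)]
    simp [EuclideanSpace.inner_single_right]
    field_simp

theorem ae_snd_ne (p : E3) : ∀ᵐ z : SpaceTime, z.2 ≠ p := by
  have : {z : SpaceTime | ¬ z.2 ≠ p} = univ ×ˢ {p} := by ext z; simp
  rw [ae_iff, this, Measure.volume_eq_prod, Measure.prod_prod]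
  simp

section Cutoff

variable {τ t : ℝ} {p : E3} {k η : ℝ → ℝ} {a b : ℝ}

theorem hasDerivAt_primitive (hk : Continuous k) (y : ℝ) :
    HasDerivAt (fun y => ∫ q in (0 : ℝ)..y, k q) (k y) y :=
  intervalIntegral.integral_hasDerivAt_right (hk.intervalIntegrable _ _)
    hk.stronglyMeasurable.stronglyMeasurableAtFilter hk.continuousAt

theorem contDiff_primitive (hk : ContDiff ℝ ∞ k) :
    ContDiff ℝ ∞ (fun y => ∫ q in (0 : ℝ)..y, k q) := by
  have h := hasDerivAt_primitive hk.continuous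
  refine contDiff_infty_iff_deriv.2 ⟨fun y => (h y).differentiableAt, ?_⟩
  rwa [funext fun y => (h y).deriv]

theorem primitive_eq_of_le (hk : Continuous k) (hkb : ∀ y, b ≤ y → k y = 0) {y : ℝ} (hy : b ≤ y) :
    ∫ q in (0 : ℝ)..y, k q = ∫ q in (0 : ℝ)..b, k q := by
  rw [← intervalIntegral.integral_add_adjacent_intervals (hk.intervalIntegrable 0 b)
    (hk.intervalIntegrable b y)]
  have : ∫ q in b..y, k q = 0 := by
    rw [intervalIntegral.integral_of_le hy]
    exact setIntegral_eq_zero_of_forall_eq_zero fun q hq => hkb q hq.1.le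
  rw [this, add_zero]

theorem primitive_eq_zero (ha : 0 < a) (hka : ∀ y, y ≤ a → k y = 0) {y : ℝ} (hy : y ≤ a) :
    ∫ q in (0 : ℝ)..y, k q = 0 := by
  refine intervalIntegral.integral_zero_ae (Eventually.of_forall fun q hq => hka q ?_)
  rcases le_total 0 y with h | h
  · rw [uIoc_of_le h] at hq; exact hq.2.trans hy
  · rw [uIoc_of_ge h] at hq; exact hq.2.trans ha.le

/-- The cutoff `η(s) g(τ - s - |x - p|)` with `g' = k`. Its level sets in space-time are light cones
parallel to the side. -/
noncomputable def coneCutoff (τ : ℝ) (p : E3) (η k : ℝ → ℝ) (z : SpaceTime) : ℝ :=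
  η z.1 * ∫ q in (0 : ℝ)..coneDepth τ p z, k q

/-- The cutoff is smooth at the axis `x = p`, where the norm is not, since `g` is constant there. -/
theorem isTestOn_coneCutoff (hη : ContDiff ℝ ∞ η)
    (hηt : tsupport η ⊆ Ioo 0 t) (hk : ContDiff ℝ ∞ k) (ha : 0 < a) (hb : b < τ - t)
    (hka : ∀ y, y ≤ a → k y = 0) (hkb : ∀ y, b ≤ y → k y = 0) :
    IsTestOn (openCone τ p t) (coneCutoff τ p η k) := by
  have hg := contDiff_primitive hk
  have hη1 : ContDiff ℝ ∞ fun z : SpaceTime => η z.1 := hη.comp contDiff_fst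
  set C : Set SpaceTime := {z | z.1 ∈ tsupport η ∧ a ≤ coneDepth τ p z} with hC
  have hCc : IsClosed C := ((isClosed_tsupport η).preimage continuous_fst).inter
    (isClosed_le continuous_const (continuous_coneDepth τ p))
  have hCO : C ⊆ openCone τ p t := fun z hz =>
    ⟨hηt hz.1, coneDepth_pos_iff.1 (ha.trans_le hz.2)⟩
  have hCcomp : IsCompact C := (isCompact_closedTruncCone τ p t).of_isClosed_subset hCc
    (hCO.trans ((openCone_subset_truncCone τ p t).trans (truncCone_subset_closedTruncCone τ p t)))
  have hsupp : Function.support (coneCutoff τ p η k) ⊆ C := by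
    intro z hz
    by_contra hzC
    refine hz ?_
    rw [coneCutoff]
    by_cases h1 : z.1 ∈ tsupport η
    · have h2 : coneDepth τ p z ≤ a := le_of_not_ge fun h => hzC ⟨h1, h⟩
      rw [primitive_eq_zero ha hka h2, mul_zero]
    · rw [image_eq_zero_of_notMem_tsupport h1, zero_mul]
  refine ⟨contDiff_iff_contDiffAt.2 fun z => ?_,
    HasCompactSupport.of_support_subset_isCompact hCcomp hsupp, ?_⟩
  · by_cases h1 : z.2 = p
    · -- Near the axis the cutoff does not depend on `x`.
      by_cases h2 : z.1 < t
      · have h3 : ∀ᶠ y in 𝓝 z, b < coneDepth τ p y := by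
          refine (continuous_coneDepth τ p).continuousAt.eventually_const_lt ?_
          simp only [coneDepth, h1, sub_self, norm_zero]
          linarith
        refine (hη1.contDiffAt.mul (contDiffAt_const
          (c := ∫ q in (0 : ℝ)..b, k q))).congr_of_eventuallyEq ?_
        filter_upwards [h3] with y hy
        rw [coneCutoff, primitive_eq_of_le hk.continuous hkb hy.le]
      · have h3 : ∀ᶠ y : SpaceTime in 𝓝 z, y.1 ∉ tsupport η :=
          ((isClosed_tsupport η).preimage continuous_fst).isOpen_compl.mem_nhds
            fun h => h2 (hηt h).2
        refine (contDiffAt_const (c := (0 : ℝ))).congr_of_eventuallyEq ?_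
        filter_upwards [h3] with y hy
        rw [coneCutoff, image_eq_zero_of_notMem_tsupport hy, zero_mul]
    · have h2 : ContDiffAt ℝ ∞ (coneDepth τ p) z :=
        (contDiffAt_const.sub contDiffAt_fst).sub
          ((contDiffAt_snd.sub contDiffAt_const).norm ℝ (sub_ne_zero.2 h1))
      exact hη1.contDiffAt.mul (hg.contDiffAt.comp z h2)
  · exact (closure_minimal hsupp hCc).trans (hCO.trans
      (isOpen_openCone τ p t).interior_eq.symm.subset)

theorem fderiv_coneCutoff (hη : ContDiff ℝ ∞ η) (hk : ContDiff ℝ ∞ k) {z : SpaceTime}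
    (hz : z.2 ≠ p) :
    timeDeriv (coneCutoff τ p η k) z =
        deriv η z.1 * (∫ q in (0 : ℝ)..coneDepth τ p z, k q) - η z.1 * k (coneDepth τ p z) ∧
      ∀ i, spaceDeriv i (coneCutoff τ p η k) z =
        - (η z.1 * k (coneDepth τ p z) * radialDir p i z) := by
  obtain ⟨L, hL, hL1, hL2⟩ := hasFDerivAt_coneDepth τ hz
  have h1 : HasFDerivAt (fun z : SpaceTime => η z.1)
      (deriv η z.1 • ContinuousLinearMap.fst ℝ ℝ E3) z :=
    (hη.differentiable (by simp) z.1).hasDerivAt.comp_hasFDerivAt z hasFDerivAt_fst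
  have h2 := (hasDerivAt_primitive hk.continuous (coneDepth τ p z)).comp_hasFDerivAt z hL
  have h3 : fderiv ℝ (coneCutoff τ p η k) z = _ := (h1.mul h2).fderiv
  refine ⟨?_, fun i => ?_⟩
  · simp only [timeDeriv, h3]
    simp [hL1]
    ring
  · simp only [spaceDeriv, h3]
    simp [hL2]
    ring

/-- An energy law `∂ₜe - ∑ᵢ ∂ᵢmᵢ + r = 0` in the cone, tested with the cutoff. -/
theorem integral_law_coneCutoff {e r : SpaceTime → ℝ} {m : Fin 3 → SpaceTime → ℝ}
    (hlaw : ∀ ζ : SpaceTime → ℝ, IsTestOn (openCone τ p t) ζ →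
      ∫ z in openCone τ p t,
        (- (timeDeriv ζ z * e z) + ∑ i, spaceDeriv i ζ z * m i z + ζ z * r z) = 0)
    (hη : ContDiff ℝ ∞ η)
    (hηt : tsupport η ⊆ Ioo 0 t) (hk : ContDiff ℝ ∞ k) (ha : 0 < a) (hb : b < τ - t)
    (hka : ∀ y, y ≤ a → k y = 0) (hkb : ∀ y, b ≤ y → k y = 0) :
    ∫ z in openCone τ p t,
      ((∫ q in (0 : ℝ)..coneDepth τ p z, k q) * (η z.1 * r z - deriv η z.1 * e z)
        + k (coneDepth τ p z) * (η z.1 * (e z - ∑ i, radialDir p i z * m i z))) = 0 := by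
  refine Eq.trans ?_ (hlaw _ (isTestOn_coneCutoff hη hηt hk ha hb hka hkb))
  refine integral_congr_ae (ae_restrict_of_ae ?_)
  filter_upwards [ae_snd_ne p] with z hz
  obtain ⟨h1, h2⟩ := fderiv_coneCutoff (τ := τ) hη hk hz
  simp only [h1, h2, coneCutoff, Fin.sum_univ_three]
  ring

end Cutoff

/-! ### Averages over thin shells -/

section ShellProfile

/-- The density of the uniform distribution on `(0, h)`. -/
noncomputable def uniformProfile (h : ℝ) : ℝ → ℝ := (Ioo 0 h).indicator fun _ => h⁻¹

/-- Smooth functions which increase to the density of the uniform distribution on `(0, h)`. -/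
noncomputable def smoothProfile (h : ℝ) (n : ℕ) (y : ℝ) : ℝ :=
  h⁻¹ * (Real.smoothTransition (n * y - 1) * Real.smoothTransition (n * (h - y) - 1))

theorem contDiff_smoothProfile (h : ℝ) (n : ℕ) : ContDiff ℝ ∞ (smoothProfile h n) := by
  unfold smoothProfile
  have h1 : ContDiff ℝ ∞ fun y : ℝ => Real.smoothTransition (n * y - 1) :=
    Real.smoothTransition.contDiff.comp (by fun_prop)
  have h2 : ContDiff ℝ ∞ fun y : ℝ => Real.smoothTransition (n * (h - y) - 1) :=
    Real.smoothTransition.contDiff.comp (by fun_prop)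
  exact contDiff_const.mul (h1.mul h2)

theorem smoothProfile_eq_zero_of_le {h : ℝ} {n : ℕ} (hn : 0 < n) {y : ℝ} (hy : y ≤ (n : ℝ)⁻¹) :
    smoothProfile h n y = 0 := by
  have hn' : (0 : ℝ) < n := by exact_mod_cast hn
  have : (n : ℝ) * y ≤ 1 := by
    calc (n : ℝ) * y ≤ n * (n : ℝ)⁻¹ := by gcongr
      _ = 1 := mul_inv_cancel₀ hn'.ne'
  rw [smoothProfile, Real.smoothTransition.zero_of_nonpos (by linarith), zero_mul, mul_zero]

theorem smoothProfile_eq_zero_of_ge {h : ℝ} {n : ℕ} (hn : 0 < n) {y : ℝ}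
    (hy : h - (n : ℝ)⁻¹ ≤ y) : smoothProfile h n y = 0 := by
  have hn' : (0 : ℝ) < n := by exact_mod_cast hn
  have : (n : ℝ) * (h - y) ≤ 1 := by
    calc (n : ℝ) * (h - y) ≤ n * (n : ℝ)⁻¹ := by gcongr; linarith
      _ = 1 := mul_inv_cancel₀ hn'.ne'
  rw [smoothProfile, Real.smoothTransition.zero_of_nonpos (x := n * (h - y) - 1) (by linarith),
    mul_zero, mul_zero]

theorem abs_smoothProfile_le {h : ℝ} (hh : 0 < h) (n : ℕ) (y : ℝ) :
    |smoothProfile h n y| ≤ h⁻¹ := by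
  have h1 := Real.smoothTransition.nonneg (n * y - 1)
  have h2 := Real.smoothTransition.nonneg (n * (h - y) - 1)
  rw [smoothProfile, abs_of_nonneg (by positivity)]
  exact mul_le_of_le_one_right (by positivity)
    (mul_le_one₀ (Real.smoothTransition.le_one _) h2 (Real.smoothTransition.le_one _))

theorem tendsto_smoothTransition_natCast_mul {y : ℝ} (hy : 0 < y) :
    ∀ᶠ n : ℕ in atTop, Real.smoothTransition (n * y - 1) = 1 := by
  have h1 : Tendsto (fun n : ℕ => (n : ℝ) * y) atTop atTop :=
    tendsto_natCast_atTop_atTop.atTop_mul_const hy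
  filter_upwards [h1.eventually_ge_atTop 2] with n hn
  exact Real.smoothTransition.one_of_one_le (by linarith)

theorem tendsto_smoothProfile (h y : ℝ) :
    Tendsto (fun n => smoothProfile h n y) atTop (𝓝 (uniformProfile h y)) := by
  refine tendsto_const_nhds.congr' ?_
  by_cases hy : y ∈ Ioo 0 h
  · filter_upwards [tendsto_smoothTransition_natCast_mul hy.1,
      tendsto_smoothTransition_natCast_mul (sub_pos.2 hy.2)] with n h1 h2
    rw [smoothProfile, h1, h2, uniformProfile, indicator_of_mem hy, mul_one, mul_one]
  · filter_upwards [eventually_gt_atTop 0] with n hn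
    rw [uniformProfile, indicator_of_notMem hy]
    have hn' : (0 : ℝ) < (n : ℝ)⁻¹ := by positivity
    by_cases h0 : 0 < y
    · have : h ≤ y := le_of_not_gt fun h' => hy ⟨h0, h'⟩
      exact (smoothProfile_eq_zero_of_ge hn (by linarith)).symm
    · exact (smoothProfile_eq_zero_of_le hn (by linarith)).symm

theorem uniformProfile_nonneg {h : ℝ} (hh : 0 < h) (y : ℝ) : 0 ≤ uniformProfile h y :=
  indicator_nonneg (fun _ _ => by positivity) y

theorem integrable_uniformProfile (h : ℝ) : Integrable (uniformProfile h) :=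
  (integrable_indicator_iff measurableSet_Ioo).2 (by simp)

theorem measurable_uniformProfile (h : ℝ) : Measurable (uniformProfile h) :=
  measurable_const.indicator measurableSet_Ioo

theorem integral_uniformProfile {h : ℝ} (hh : 0 < h) : ∫ q, uniformProfile h q = 1 := by
  rw [uniformProfile, integral_indicator measurableSet_Ioo]
  simp [hh.le, hh.ne']

theorem primitive_uniformProfile_mem {h : ℝ} (hh : 0 < h) {y : ℝ} (hy : 0 ≤ y) :
    ∫ q in (0 : ℝ)..y, uniformProfile h q ∈ Icc (0 : ℝ) 1 := by
  rw [intervalIntegral.integral_of_le hy]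
  refine ⟨integral_nonneg fun q => uniformProfile_nonneg hh q, ?_⟩
  rw [← integral_uniformProfile hh]
  exact setIntegral_le_integral (integrable_uniformProfile h)
    (Eventually.of_forall fun q => uniformProfile_nonneg hh q)

theorem primitive_uniformProfile_eq_one {h : ℝ} (hh : 0 < h) {y : ℝ} (hy : h ≤ y) :
    ∫ q in (0 : ℝ)..y, uniformProfile h q = 1 := by
  rw [intervalIntegral.integral_of_le (hh.le.trans hy), ← integral_uniformProfile hh]
  refine setIntegral_eq_integral_of_forall_compl_eq_zero fun q hq => ?_
  exact indicator_of_notMem (fun h' => hq ⟨h'.1, h'.2.le.trans hy⟩) _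

theorem continuous_primitive_uniformProfile (h : ℝ) :
    Continuous fun y => ∫ q in (0 : ℝ)..y, uniformProfile h q :=
  intervalIntegral.continuous_primitive
    (fun _ _ => (integrable_uniformProfile h).intervalIntegrable) 0

theorem tendsto_primitive_smoothProfile {h : ℝ} (hh : 0 < h) (y : ℝ) :
    Tendsto (fun n => ∫ q in (0 : ℝ)..y, smoothProfile h n q) atTop
      (𝓝 (∫ q in (0 : ℝ)..y, uniformProfile h q)) := by
  refine intervalIntegral.tendsto_integral_filter_of_dominated_convergence (fun _ => h⁻¹)
    (Eventually.of_forall fun n => (contDiff_smoothProfile h n).continuous.aestronglyMeasurable)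
    (Eventually.of_forall fun n => Eventually.of_forall fun q _ => abs_smoothProfile_le hh n q)
    (by simp) (Eventually.of_forall fun q _ => tendsto_smoothProfile h q)

end ShellProfile

section ShellLimit

variable {τ t : ℝ} {p : E3}

theorem shell_eq (τ : ℝ) (p : E3) (t h : ℝ) :
    shell τ p t h = openCone τ p t ∩ coneDepth τ p ⁻¹' Iio h := by
  ext z
  simp only [shell, openCone, disk, coneDepth, mem_ofPred_eq, mem_inter_iff, mem_preimage, mem_Iio,
    Metric.mem_ball, dist_eq_norm]
  constructor
  · rintro ⟨h1, h2, h3⟩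
    exact ⟨⟨h1, h3⟩, by linarith⟩
  · rintro ⟨⟨h1, h3⟩, h2⟩
    exact ⟨h1, by linarith, h3⟩

theorem measurableSet_shell (τ : ℝ) (p : E3) (t h : ℝ) : MeasurableSet (shell τ p t h) := by
  rw [shell_eq]
  exact (measurableSet_openCone τ p t).inter
    (measurableSet_Iio.preimage (continuous_coneDepth τ p).measurable)

theorem setIntegral_shell_eq {h : ℝ} (X : SpaceTime → ℝ) :
    ∫ z in openCone τ p t, uniformProfile h (coneDepth τ p z) * X z =
      h⁻¹ * ∫ z in shell τ p t h, X z := by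
  have h1 : MeasurableSet (coneDepth τ p ⁻¹' Iio h) :=
    measurableSet_Iio.preimage (continuous_coneDepth τ p).measurable
  rw [shell_eq, inter_comm, ← Measure.restrict_restrict h1, ← integral_indicator h1,
    ← integral_const_mul]
  refine setIntegral_congr_fun (measurableSet_openCone τ p t) fun z hz => ?_
  have h2 := coneDepth_pos_iff.2 hz.2
  by_cases h3 : coneDepth τ p z < h
  · rw [indicator_of_mem (show z ∈ coneDepth τ p ⁻¹' Iio h from h3), uniformProfile,
      indicator_of_mem (show coneDepth τ p z ∈ Ioo 0 h from ⟨h2, h3⟩)]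
  · rw [indicator_of_notMem (show z ∉ coneDepth τ p ⁻¹' Iio h from h3), uniformProfile,
      indicator_of_notMem (show coneDepth τ p z ∉ Ioo 0 h from fun h' => h3 h'.2), zero_mul, mul_zero]

/-- The energy law tested with a function of time alone: the boundary term is the limit of the
averages of `e - n · m` over thin shells. -/
theorem tendsto_shell_average {e r : SpaceTime → ℝ} {m : Fin 3 → SpaceTime → ℝ}
    (he : IntegrableOn e (openCone τ p t)) (hr : IntegrableOn r (openCone τ p t))
    (hm : ∀ i, IntegrableOn (m i) (openCone τ p t)) (ht : t < τ)
    (hlaw : ∀ ζ : SpaceTime → ℝ, IsTestOn (openCone τ p t) ζ →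
      ∫ z in openCone τ p t,
        (- (timeDeriv ζ z * e z) + ∑ i, spaceDeriv i ζ z * m i z + ζ z * r z) = 0)
    {η : ℝ → ℝ} (hη : ContDiff ℝ ∞ η) (hηc : HasCompactSupport η) (hηt : tsupport η ⊆ Ioo 0 t) :
    Tendsto (fun h : ℝ => h⁻¹ * ∫ z in shell τ p t h,
        η z.1 * (e z - ∑ i, radialDir p i z * m i z)) (𝓝[>] 0)
      (𝓝 (∫ z in openCone τ p t, (deriv η z.1 * e z - η z.1 * r z))) := by
  set A : SpaceTime → ℝ := fun z => η z.1 * r z - deriv η z.1 * e z with hA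
  set X : SpaceTime → ℝ := fun z => η z.1 * (e z - ∑ i, radialDir p i z * m i z) with hX
  obtain ⟨C, -, hC⟩ := exists_norm_le_of_hasCompactSupport hη.continuous hηc
  have hη' : Continuous (deriv η) := hη.continuous_deriv (by simp)
  obtain ⟨C', -, hC'⟩ := exists_norm_le_of_hasCompactSupport hη' hηc.deriv
  have hη1 : Continuous fun z : SpaceTime => η z.1 := hη.continuous.comp continuous_fst
  have hη1' : Continuous fun z : SpaceTime => deriv η z.1 := hη'.comp continuous_fst
  have hAint : IntegrableOn A (openCone τ p t) :=
    (integrable_smul_of_bounded hr hη1 fun z => hC z.1).sub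
      (integrable_smul_of_bounded he hη1' fun z => hC' z.1)
  have hXint : IntegrableOn X (openCone τ p t) := by
    refine integrable_smul_of_bounded (he.sub (integrable_finsetSum _ fun i _ => ?_)) hη1
      fun z => hC z.1
    exact (hm i).bdd_mul (c := 1) (measurable_radialDir p i).aestronglyMeasurable
      (Eventually.of_forall fun z => abs_radialDir_le_one p i z)
  have hdepth : ∀ z ∈ openCone τ p t, 0 < coneDepth τ p z ∧ coneDepth τ p z ≤ τ := fun z hz => by
    refine ⟨coneDepth_pos_iff.2 hz.2, ?_⟩
    have := hz.1.1
    have := norm_nonneg (z.2 - p)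
    simp only [coneDepth]; linarith
  have hmeas : ∀ {g : ℝ → ℝ}, Measurable g → ∀ {μ : Measure SpaceTime},
      AEStronglyMeasurable (fun z => g (coneDepth τ p z)) μ := fun hg =>
    (hg.comp (continuous_coneDepth τ p).measurable).aestronglyMeasurable
  -- The law for the piecewise linear profile of width `h`, by approximation with smooth profiles.
  have key : ∀ h : ℝ, 0 < h → h < τ - t →
      h⁻¹ * ∫ z in shell τ p t h, X z =
        - ∫ z in openCone τ p t, (∫ q in (0 : ℝ)..coneDepth τ p z, uniformProfile h q) * A z := by
    intro h hh hht
    have hlim : Tendsto (fun n => ∫ z in openCone τ p t,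
        ((∫ q in (0 : ℝ)..coneDepth τ p z, smoothProfile h n q) * A z
          + smoothProfile h n (coneDepth τ p z) * X z)) atTop
        (𝓝 (∫ z in openCone τ p t, ((∫ q in (0 : ℝ)..coneDepth τ p z, uniformProfile h q) * A z
          + uniformProfile h (coneDepth τ p z) * X z))) := by
      refine tendsto_integral_of_dominated_convergence
        (fun z => h⁻¹ * τ * ‖A z‖ + h⁻¹ * ‖X z‖) (fun n => ?_)
        ((hAint.norm.const_mul _).add (hXint.norm.const_mul _)) (fun n => ?_) ?_
      · exact ((hmeas (contDiff_primitive
          (contDiff_smoothProfile h n)).continuous.measurable).mul hAint.1).add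
          ((hmeas (contDiff_smoothProfile h n).continuous.measurable).mul hXint.1)
      · rw [ae_restrict_iff' (measurableSet_openCone τ p t)]
        refine Eventually.of_forall fun z hz => (norm_add_le _ _).trans ?_
        obtain ⟨h1, h2⟩ := hdepth z hz
        rw [norm_mul, norm_mul]
        refine add_le_add (mul_le_mul_of_nonneg_right ?_ (norm_nonneg _))
          (mul_le_mul_of_nonneg_right (abs_smoothProfile_le hh n _) (norm_nonneg _))
        refine (intervalIntegral.norm_integral_le_of_norm_le_const (C := h⁻¹)
          fun q _ => abs_smoothProfile_le hh n q).trans ?_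
        rw [sub_zero, abs_of_pos h1]
        gcongr
      · refine Eventually.of_forall fun z => ?_
        exact ((tendsto_primitive_smoothProfile hh _).mul_const _).add
          ((tendsto_smoothProfile h _).mul_const _)
    have hzero : ∀ᶠ n : ℕ in atTop, ∫ z in openCone τ p t,
        ((∫ q in (0 : ℝ)..coneDepth τ p z, smoothProfile h n q) * A z
          + smoothProfile h n (coneDepth τ p z) * X z) = 0 := by
      filter_upwards [eventually_gt_atTop 0] with n hn
      have hn' : (0 : ℝ) < (n : ℝ)⁻¹ := by positivity
      exact integral_law_coneCutoff hlaw hη hηt (contDiff_smoothProfile h n) hn'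
        (b := h - (n : ℝ)⁻¹) (by linarith) (fun y hy => smoothProfile_eq_zero_of_le hn hy)
        (fun y hy => smoothProfile_eq_zero_of_ge hn hy)
    have h0 := tendsto_nhds_unique hlim ((tendsto_congr' hzero).2 tendsto_const_nhds)
    have I1 : IntegrableOn (fun z =>
        (∫ q in (0 : ℝ)..coneDepth τ p z, uniformProfile h q) * A z) (openCone τ p t) := by
      refine hAint.bdd_mul (c := 1)
        (hmeas (continuous_primitive_uniformProfile h).measurable) ?_
      rw [ae_restrict_iff' (measurableSet_openCone τ p t)]
      refine Eventually.of_forall fun z hz => ?_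
      have := primitive_uniformProfile_mem hh (hdepth z hz).1.le
      rw [Real.norm_eq_abs, abs_of_nonneg this.1]; exact this.2
    have I2 : IntegrableOn (fun z => uniformProfile h (coneDepth τ p z) * X z)
        (openCone τ p t) := by
      refine hXint.bdd_mul (c := h⁻¹) (hmeas (measurable_uniformProfile h)) ?_
      refine Eventually.of_forall fun z => ?_
      rw [Real.norm_eq_abs, abs_of_nonneg (uniformProfile_nonneg hh _)]
      exact indicator_le_self' (fun _ _ => by positivity) _
    rw [integral_add I1 I2, setIntegral_shell_eq] at h0
    linarith
  have hlim : Tendsto (fun h : ℝ => - ∫ z in openCone τ p t,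
      (∫ q in (0 : ℝ)..coneDepth τ p z, uniformProfile h q) * A z) (𝓝[>] 0)
      (𝓝 (- ∫ z in openCone τ p t, A z)) := by
    refine Tendsto.neg ?_
    refine tendsto_integral_filter_of_dominated_convergence (fun z => ‖A z‖)
      (Eventually.of_forall fun h =>
        (hmeas (continuous_primitive_uniformProfile h).measurable).mul hAint.1) ?_ hAint.norm ?_
    · filter_upwards [self_mem_nhdsWithin] with h hh
      rw [ae_restrict_iff' (measurableSet_openCone τ p t)]
      refine Eventually.of_forall fun z hz => ?_
      have := primitive_uniformProfile_mem hh (hdepth z hz).1.le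
      rw [norm_mul, Real.norm_eq_abs, abs_of_nonneg this.1]
      exact mul_le_of_le_one_left (norm_nonneg _) this.2
    · rw [ae_restrict_iff' (measurableSet_openCone τ p t)]
      refine Eventually.of_forall fun z hz => ?_
      refine tendsto_const_nhds.congr' ?_
      have h1 := (hdepth z hz).1
      filter_upwards [Ioo_mem_nhdsGT h1] with h hh
      rw [primitive_uniformProfile_eq_one hh.1 hh.2.le, one_mul]
  have hfin : ∫ z in openCone τ p t, (deriv η z.1 * e z - η z.1 * r z) =
      - ∫ z in openCone τ p t, A z := by
    rw [← integral_neg]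
    exact integral_congr_ae (Eventually.of_forall fun z => by simp [hA])
  rw [hfin]
  refine hlim.congr' ?_
  filter_upwards [Ioo_mem_nhdsGT (sub_pos.2 ht)] with h hh
  exact (key h hh.1 hh.2).symm

end ShellLimit

/-! ### Polar coordinates and shell averages of continuous functions -/

/-- Integration in polar coordinates. -/
theorem integral_eq_integral_toSphere {F : E3 → ℝ} (hF : Integrable F) :
    ∫ x, F x = ∫ w, (∫ r in Ioi (0 : ℝ), r ^ 2 * F (r • (w : E3)))
      ∂(volume : Measure E3).toSphere := by
  have hmp := (volume : Measure E3).measurePreserving_homeomorphUnitSphereProd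
  rw [finrank_euclideanSpace_fin, show 3 - 1 = 2 from rfl] at hmp
  set Q : Metric.sphere (0 : E3) 1 × Ioi (0 : ℝ) → ℝ := fun q => F ((q.2 : ℝ) • (q.1 : E3)) with hQ
  have hQF : ∀ x : ({0}ᶜ : Set E3), Q (homeomorphUnitSphereProd E3 x) = F x := fun x => by
    have hx : ‖(x : E3)‖ ≠ 0 := norm_ne_zero_iff.2 x.2
    simp [hQ, smul_smul, hx]
  have hemb : MeasurableEmbedding (homeomorphUnitSphereProd E3) :=
    Homeomorph.measurableEmbedding _
  have h1 : ∫ x, F x = ∫ q, Q q ∂((volume : Measure E3).toSphere.prod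
      (Measure.volumeIoiPow 2)) := by
    rw [← hmp.integral_comp hemb]
    simp only [hQF]
    rw [integral_subtype_comap (measurableSet_singleton _).compl F, restrict_compl_singleton]
  have h2 : Integrable Q ((volume : Measure E3).toSphere.prod (Measure.volumeIoiPow 2)) := by
    rw [← hmp.integrable_comp_emb hemb]
    have : Q ∘ homeomorphUnitSphereProd E3 = F ∘ Subtype.val := funext hQF
    rw [this, ← (MeasurableEmbedding.subtype_coe
      (measurableSet_singleton (0 : E3)).compl).integrable_map_iff,
      map_comap_subtype_coe (measurableSet_singleton _).compl]
    exact hF.integrableOn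
  rw [h1, integral_prod _ h2]
  refine integral_congr_ae (Eventually.of_forall fun w => ?_)
  simp only [Measure.volumeIoiPow, ENNReal.ofReal, hQ]
  rw [integral_withDensity_eq_integral_smul (measurable_subtype_coe.pow_const _).real_toNNReal,
    integral_subtype_comap measurableSet_Ioi
      fun a => Real.toNNReal (a ^ 2) • F (a • (w : E3))]
  refine setIntegral_congr_fun measurableSet_Ioi fun x hx => ?_
  simp only [NNReal.smul_def, Real.coe_toNNReal _ (pow_nonneg (le_of_lt hx) 2), smul_eq_mul]

/-- The average of a function over a spherical shell of thickness `h`, as an integral over the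
sphere and the relative depth. -/
theorem average_annulus_eq {g : E3 → ℝ} (hg : Continuous g) (p : E3) {c h : ℝ} (hh : 0 < h)
    (hhc : h ≤ c) :
    h⁻¹ * ∫ x in {x | c - h < ‖x - p‖ ∧ ‖x - p‖ < c}, g x =
      ∫ w, (∫ θ in (0 : ℝ)..1, (c - h * θ) ^ 2 * g (p + (c - h * θ) • (w : E3)))
        ∂(volume : Measure E3).toSphere := by
  set A : Set E3 := {x | c - h < ‖x - p‖ ∧ ‖x - p‖ < c} with hA
  have hAm : MeasurableSet A :=
    ((isOpen_lt (f := fun _ : E3 => c - h) (g := fun x => ‖x - p‖) (by fun_prop)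
      (by fun_prop)).inter (isOpen_lt (f := fun x : E3 => ‖x - p‖) (g := fun _ => c)
      (by fun_prop) (by fun_prop))).measurableSet
  have hint : IntegrableOn g A := by
    refine (hg.continuousOn.integrableOn_compact (isCompact_closedBall p c)).mono_set fun x hx => ?_
    rw [Metric.mem_closedBall, dist_eq_norm]; exact hx.2.le
  have h1 : ∫ x in A, g x = ∫ y, A.indicator g (p + y) := by
    rw [integral_add_left_eq_self (fun y => A.indicator g y) p, integral_indicator hAm]
  have h2 : Integrable fun y => A.indicator g (p + y) :=
    ((integrable_indicator_iff hAm).2 hint).comp_add_left p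
  rw [h1, integral_eq_integral_toSphere h2, ← integral_const_mul]
  refine integral_congr_ae (Eventually.of_forall fun w => ?_)
  have hw : ‖(w : E3)‖ = 1 := by simp
  have hmem : ∀ r : ℝ, 0 < r → (p + r • (w : E3) ∈ A ↔ r ∈ Ioo (c - h) c) := fun r hr => by
    simp [hA, norm_smul, hw, abs_of_pos hr]
  have h3 : ∫ r in Ioi (0 : ℝ), r ^ 2 * A.indicator g (p + r • (w : E3)) =
      ∫ r in Ioi (0 : ℝ), (Ioo (c - h) c).indicator (fun r => r ^ 2 * g (p + r • (w : E3))) r := by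
    refine setIntegral_congr_fun measurableSet_Ioi fun r hr => ?_
    by_cases hr' : r ∈ Ioo (c - h) c
    · simp only [indicator_of_mem hr', indicator_of_mem ((hmem r hr).2 hr')]
    · simp only [indicator_of_notMem hr', indicator_of_notMem (mt (hmem r hr).1 hr'), mul_zero]
  have hsub : Ioo (c - h) c ∩ Ioi 0 = Ioo (c - h) c :=
    inter_eq_left.2 fun r hr => lt_of_le_of_lt (by linarith) hr.1
  have h4 := intervalIntegral.integral_comp_sub_mul (a := 0) (b := 1)
    (fun r => r ^ 2 * g (p + r • (w : E3))) hh.ne' c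
  simp only [mul_one, mul_zero, sub_zero, smul_eq_mul] at h4
  simp only [h3]
  rw [integral_indicator measurableSet_Ioo, Measure.restrict_restrict measurableSet_Ioo, hsub, h4,
    intervalIntegral.integral_of_le (by linarith), integral_Ioc_eq_integral_Ioo]

theorem tendsto_average_annulus {g : E3 → ℝ} (hg : Continuous g) (p : E3) {c M : ℝ} (hc : 0 < c)
    (hM : ∀ x, ‖g x‖ ≤ M) :
    Tendsto (fun h : ℝ => h⁻¹ * ∫ x in {x | c - h < ‖x - p‖ ∧ ‖x - p‖ < c}, g x) (𝓝[>] 0)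
      (𝓝 (∫ w, c ^ 2 * g (p + c • (w : E3)) ∂(volume : Measure E3).toSphere)) := by
  have hM0 : 0 ≤ M := (norm_nonneg _).trans (hM p)
  have hcont : Continuous fun q : (ℝ × Metric.sphere (0 : E3) 1) × ℝ =>
      (c - q.1.1 * q.2) ^ 2 * g (p + (c - q.1.1 * q.2) • (q.1.2 : E3)) := by
    have : Continuous fun q : (ℝ × Metric.sphere (0 : E3) 1) × ℝ =>
        p + (c - q.1.1 * q.2) • (q.1.2 : E3) := by fun_prop
    exact (by fun_prop : Continuous fun q : (ℝ × Metric.sphere (0 : E3) 1) × ℝ =>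
      (c - q.1.1 * q.2) ^ 2).mul (hg.comp this)
  have hcont2 : Continuous fun q : ℝ × Metric.sphere (0 : E3) 1 =>
      ∫ θ in (0 : ℝ)..1, (c - q.1 * θ) ^ 2 * g (p + (c - q.1 * θ) • (q.2 : E3)) :=
    intervalIntegral.continuous_parametric_intervalIntegral_of_continuous' hcont 0 1
  have key : Tendsto (fun h : ℝ => ∫ w, (∫ θ in (0 : ℝ)..1,
      (c - h * θ) ^ 2 * g (p + (c - h * θ) • (w : E3))) ∂(volume : Measure E3).toSphere) (𝓝[>] 0)
      (𝓝 (∫ w, (∫ θ in (0 : ℝ)..1, (c - 0 * θ) ^ 2 * g (p + (c - 0 * θ) • (w : E3)))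
        ∂(volume : Measure E3).toSphere)) := by
    refine tendsto_integral_filter_of_dominated_convergence (fun _ => c ^ 2 * M)
      (Eventually.of_forall fun h => ?_) ?_ (integrable_const _)
      (Eventually.of_forall fun w => ?_)
    · exact (hcont2.comp (Continuous.prodMk_right h)).aestronglyMeasurable
    · filter_upwards [Ioo_mem_nhdsGT hc] with h hh
      refine Eventually.of_forall fun w => ?_
      refine (intervalIntegral.norm_integral_le_of_norm_le_const (C := c ^ 2 * M)
        fun θ hθ => ?_).trans (by simp)
      rw [uIoc_of_le zero_le_one] at hθ
      have h1 : 0 ≤ h * θ := mul_nonneg hh.1.le hθ.1.le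
      have h2 : h * θ ≤ c := (mul_le_of_le_one_right hh.1.le hθ.2).trans hh.2.le
      rw [norm_mul, norm_pow, Real.norm_eq_abs, abs_of_nonneg (by linarith)]
      gcongr
      · linarith
      · exact hM _
    · have : Continuous fun h : ℝ => ∫ θ in (0 : ℝ)..1,
          (c - h * θ) ^ 2 * g (p + (c - h * θ) • (w : E3)) :=
        hcont2.comp (Continuous.prodMk_left w)
      exact (this.tendsto 0).mono_left nhdsWithin_le_nhds
  simp only [zero_mul, sub_zero, intervalIntegral.integral_const, one_smul] at key
  refine key.congr' ?_
  filter_upwards [Ioo_mem_nhdsGT hc] with h hh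
  exact (average_annulus_eq hg p hh.1 hh.2.le).symm

theorem norm_average_annulus_le {g : E3 → ℝ} (hg : Continuous g) (p : E3) {c M h : ℝ}
    (hM : ∀ x, ‖g x‖ ≤ M) (hh : 0 < h) (hhc : h ≤ c) :
    ‖h⁻¹ * ∫ x in {x | c - h < ‖x - p‖ ∧ ‖x - p‖ < c}, g x‖ ≤
      c ^ 2 * M * (volume : Measure E3).toSphere.real univ := by
  have hM0 : 0 ≤ M := (norm_nonneg _).trans (hM p)
  have hfin : IsFiniteMeasure (volume : Measure E3).toSphere := inferInstance
  rw [average_annulus_eq hg p hh hhc]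
  refine (norm_integral_le_of_norm_le_const (μ := (volume : Measure E3).toSphere) (C := c ^ 2 * M)
    (Eventually.of_forall fun w => ?_))
  refine (intervalIntegral.norm_integral_le_of_norm_le_const (C := c ^ 2 * M)
    fun θ hθ => ?_).trans (by simp)
  rw [uIoc_of_le zero_le_one] at hθ
  have h1 : 0 ≤ h * θ := mul_nonneg hh.le hθ.1.le
  have h2 : h * θ ≤ c := (mul_le_of_le_one_right hh.le hθ.2).trans hhc
  rw [norm_mul, norm_pow, Real.norm_eq_abs, abs_of_nonneg (by linarith)]
  gcongr
  · linarith
  · exact hM _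

theorem setIntegral_annulus_eq (f : SpaceTime → ℝ) (τ : ℝ) (p : E3) (s h : ℝ) :
    ∫ x in {x | τ - s - h < ‖x - p‖ ∧ ‖x - p‖ < τ - s}, f (s, x) =
      ∫ x in disk τ p s, (coneDepth τ p ⁻¹' Iio h).indicator f (s, x) := by
  have h2 : MeasurableSet {x : E3 | coneDepth τ p (s, x) < h} :=
    measurableSet_lt ((continuous_coneDepth τ p).comp (Continuous.prodMk_right s)).measurable
      measurable_const
  have h3 : {x : E3 | τ - s - h < ‖x - p‖ ∧ ‖x - p‖ < τ - s} =
      {x : E3 | coneDepth τ p (s, x) < h} ∩ disk τ p s := by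
    ext x
    simp only [disk, coneDepth, mem_ofPred_eq, mem_inter_iff, mem_ball_iff_norm]
    constructor
    · rintro ⟨h1, h2⟩; exact ⟨by linarith, h2⟩
    · rintro ⟨h1, h2⟩; exact ⟨by linarith, h2⟩
  rw [h3, ← Measure.restrict_restrict h2, ← integral_indicator h2]
  rfl

/-- Fubini for the shell along the side of the cone. -/
theorem average_shell_eq {f : SpaceTime → ℝ} (hf : Continuous f) (τ : ℝ) (p : E3) (t h : ℝ) :
    h⁻¹ * ∫ z in shell τ p t h, f z =
      ∫ s in Ioo 0 t, h⁻¹ * ∫ x in {x | τ - s - h < ‖x - p‖ ∧ ‖x - p‖ < τ - s}, f (s, x) := by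
  have h1 : MeasurableSet (coneDepth τ p ⁻¹' Iio h) :=
    measurableSet_Iio.preimage (continuous_coneDepth τ p).measurable
  have hint : IntegrableOn f (openCone τ p t) := integrableOn_openCone_of_continuous hf
  rw [integral_const_mul, shell_eq, inter_comm, ← Measure.restrict_restrict h1,
    ← integral_indicator h1, integral_openCone τ p t (hint.indicator h1)]
  congr 1
  simp only [setIntegral_annulus_eq]

theorem integral_sideMeasure {f : SpaceTime → ℝ} (hf : Continuous f) {M : ℝ} (hM : ∀ z, ‖f z‖ ≤ M)
    (τ : ℝ) (p : E3) (t : ℝ) :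
    ∫ z, f z ∂(sideMeasure τ p t) = √2 * ∫ s in Ioo 0 t,
      ∫ w, (τ - s) ^ 2 * f (s, p + (τ - s) • (w : E3)) ∂(volume : Measure E3).toSphere := by
  have hΦ : Continuous fun q : ℝ × Metric.sphere (0 : E3) 1 =>
      ((q.1, p + (τ - q.1) • (q.2 : E3)) : SpaceTime) := by fun_prop
  have hw : Continuous fun q : ℝ × Metric.sphere (0 : E3) 1 => √2 * (τ - q.1) ^ 2 := by fun_prop
  have hbd : Integrable (fun q : ℝ × Metric.sphere (0 : E3) 1 =>
      (τ - q.1) ^ 2 * f (q.1, p + (τ - q.1) • (q.2 : E3)))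
      ((volume.restrict (Ioo 0 t)).prod (volume : Measure E3).toSphere) := by
    refine Integrable.mono' (g := fun q => (|τ| + |t|) ^ 2 * M) (integrable_const _)
      ((by fun_prop : Continuous fun q : ℝ × Metric.sphere (0 : E3) 1 =>
        (τ - q.1) ^ 2).mul (hf.comp hΦ)).aestronglyMeasurable ?_
    have h1 : ∀ᵐ s ∂volume.restrict (Ioo 0 t), s ∈ Ioo 0 t :=
      ae_restrict_mem measurableSet_Ioo
    filter_upwards [Measure.quasiMeasurePreserving_fst.ae h1] with q hq
    rw [norm_mul, norm_pow, Real.norm_eq_abs]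
    have h2 : |τ - q.1| ≤ |τ| + |t| := (abs_sub _ _).trans (by
      rw [abs_of_pos hq.1]; linarith [hq.2, le_abs_self t])
    gcongr
    exact hM _
  rw [sideMeasure, integral_map hΦ.measurable.aemeasurable hf.aestronglyMeasurable]
  simp only [ENNReal.ofReal]
  rw [integral_withDensity_eq_integral_smul hw.measurable.real_toNNReal, ← integral_const_mul]
  simp only [← integral_const_mul]
  rw [← integral_prod (fun q : ℝ × Metric.sphere (0 : E3) 1 =>
    √2 * ((τ - q.1) ^ 2 * f (q.1, p + (τ - q.1) • (q.2 : E3)))) (hbd.const_mul _)]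
  refine integral_congr_ae (Eventually.of_forall fun q => ?_)
  simp only [NNReal.smul_def, smul_eq_mul]
  rw [Real.coe_toNNReal _ (by positivity), mul_assoc]

/-- For a bounded continuous function, the averages over thin shells converge to the integral over
the side; the thickness of the shell of horizontal thickness `h` is `h / √2`. -/
theorem tendsto_average_shell {f : SpaceTime → ℝ} (hf : Continuous f) {M : ℝ}
    (hM : ∀ z, ‖f z‖ ≤ M) {τ t : ℝ} (p : E3) (htτ : t < τ) :
    Tendsto (fun h : ℝ => h⁻¹ * ∫ z in shell τ p t h, f z) (𝓝[>] 0)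
      (𝓝 ((√2)⁻¹ * ∫ z, f z ∂(sideMeasure τ p t))) := by
  have hs2 : (√2 : ℝ) ≠ 0 := by positivity
  have hM0 : 0 ≤ M := (norm_nonneg _).trans (hM 0)
  rw [integral_sideMeasure hf hM, inv_mul_cancel_left₀ hs2]
  simp only [average_shell_eq hf]
  refine tendsto_integral_filter_of_dominated_convergence
    (fun _ => τ ^ 2 * M * (volume : Measure E3).toSphere.real univ)
    (Eventually.of_forall fun h => ?_) ?_ (integrable_const _) ?_
  · have h1 : MeasurableSet (coneDepth τ p ⁻¹' Iio h) :=
      measurableSet_Iio.preimage (continuous_coneDepth τ p).measurable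
    have hint : IntegrableOn f (openCone τ p t) := integrableOn_openCone_of_continuous hf
    refine ((integrableOn_integral_disk (hint.indicator h1)).1.const_mul h⁻¹).congr ?_
    exact Eventually.of_forall fun s => by simp only [setIntegral_annulus_eq]
  · filter_upwards [Ioo_mem_nhdsGT (sub_pos.2 htτ)] with h hh
    rw [ae_restrict_iff' measurableSet_Ioo]
    refine Eventually.of_forall fun s hs => ?_
    refine (norm_average_annulus_le (hf.comp (Continuous.prodMk_right s)) p (fun x => hM (s, x))
      hh.1 (by linarith [hh.2, hs.2])).trans ?_
    have : 0 ≤ τ - s := by linarith [hs.2]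
    gcongr
    linarith [hs.1]
  · rw [ae_restrict_iff' measurableSet_Ioo]
    refine Eventually.of_forall fun s hs => ?_
    exact tendsto_average_annulus (hf.comp (Continuous.prodMk_right s)) p
      (by linarith [hs.2]) (fun x => hM (s, x))

/-! ### The relative energy and the flux -/

section RelativeEnergy

/-- The relative energy density `½ (|∂ₜu|² + |∇u|²) - (∂ₜv · ∂ₜu + ∇v · ∇u)`, i.e. the energy density
of `v - u` minus that of `v`. -/
noncomputable def relEnergy (vt : SpaceTime → E3) (dv : Fin 3 → SpaceTime → E3)
    (u : SpaceTime → E3) (z : SpaceTime) : ℝ :=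
  1 / 2 * crossEnergy (timeDeriv u) (fun i => spaceDeriv i u) u z - crossEnergy vt dv u z

/-- The current which belongs to `relEnergy`. -/
noncomputable def relCurrent (vt : SpaceTime → E3) (dv : Fin 3 → SpaceTime → E3)
    (u : SpaceTime → E3) (i : Fin 3) (z : SpaceTime) : ℝ :=
  1 / 2 * crossCurrent (timeDeriv u) (fun i => spaceDeriv i u) u i z - crossCurrent vt dv u i z

/-- The source which belongs to `relEnergy`. -/
noncomputable def relSource (v vt : SpaceTime → E3) (dv : Fin 3 → SpaceTime → E3)
    (u : SpaceTime → E3) (z : SpaceTime) : ℝ :=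
  1 / 2 * crossSource u (timeDeriv u) (fun i => spaceDeriv i u) u z - crossSource v vt dv u z

theorem sum_radialDir_sq {p : E3} {z : SpaceTime} (hz : z.2 ≠ p) :
    ∑ i, radialDir p i z ^ 2 = 1 := by
  have h1 : ‖z.2 - p‖ ≠ 0 := norm_ne_zero_iff.2 (sub_ne_zero.2 hz)
  simp only [radialDir, div_pow]
  rw [← Finset.sum_div, div_eq_one_iff_eq (pow_ne_zero 2 h1), EuclideanSpace.norm_sq_eq]
  simp

/-- The boundary density of the relative energy is a quadratic expression in the flux fields. -/
theorem relEnergy_sub_relCurrent {vt : SpaceTime → E3} {dv : Fin 3 → SpaceTime → E3}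
    {u : SpaceTime → E3} {p : E3} {z : SpaceTime} (hz : z.2 ≠ p) {F : Fin 3 → E3}
    (hF : ∀ i, F i = spaceDeriv i u z - radialDir p i z • timeDeriv u z) :
    relEnergy vt dv u z - ∑ i, radialDir p i z * relCurrent vt dv u i z =
      1 / 2 * ∑ i, ‖F i‖ ^ 2 - ∑ i, inner ℝ (fluxField p vt dv i z) (F i) := by
  have h1 := sum_radialDir_sq hz
  have h2 : ∀ i, fluxField p vt dv i z = dv i z - radialDir p i z • vt z := fun i => rfl
  simp only [Fin.sum_univ_three] at h1
  have h3 : radialDir p 0 z ^ 2 = 1 - radialDir p 1 z ^ 2 - radialDir p 2 z ^ 2 := by linarith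
  simp only [relEnergy, relCurrent, crossEnergy, crossCurrent, hF, h2, ← real_inner_self_eq_norm_sq,
    Fin.sum_univ_three, inner_sub_left, inner_sub_right, real_inner_smul_left,
    real_inner_smul_right, real_inner_comm (spaceDeriv _ u z) (timeDeriv u z)]
  ring_nf
  rw [h3]
  ring

/-- The radial unit vector, cut off near the axis `x = p` in order to be smooth. -/
noncomputable def smoothRadialDir (p : E3) (c : ℝ) (i : Fin 3) (x : E3) : ℝ :=
  Real.smoothTransition (c * ‖x - p‖ ^ 2 - 1) * ((x i - p i) / ‖x - p‖)

theorem contDiff_smoothRadialDir (p : E3) {c : ℝ} (i : Fin 3) :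
    ContDiff ℝ ∞ (smoothRadialDir p c i) := by
  have h0 : ContDiff ℝ ∞ fun x : E3 => c * ‖x - p‖ ^ 2 - 1 :=
    (contDiff_const.mul ((contDiff_id.sub contDiff_const).norm_sq ℝ)).sub contDiff_const
  refine contDiff_iff_contDiffAt.2 fun x => ?_
  by_cases hx : x = p
  · have h1 : ∀ᶠ y in 𝓝 x, c * ‖y - p‖ ^ 2 - 1 < 0 := by
      refine h0.continuous.continuousAt.eventually_lt_const ?_
      simp [hx]
    refine (contDiffAt_const (c := (0 : ℝ))).congr_of_eventuallyEq ?_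
    filter_upwards [h1] with y hy
    rw [smoothRadialDir, Real.smoothTransition.zero_of_nonpos hy.le, zero_mul]
  · have h1 : ContDiffAt ℝ ∞ (fun x : E3 => ‖x - p‖) x :=
      (contDiffAt_id.sub contDiffAt_const).norm ℝ (sub_ne_zero.2 hx)
    have h2 : ContDiffAt ℝ ∞ (fun x : E3 => x i - p i) x :=
      ((EuclideanSpace.proj i : E3 →L[ℝ] ℝ).contDiff.contDiffAt).sub contDiffAt_const
    exact (Real.smoothTransition.contDiff.comp h0).contDiffAt.mul
      (h2.div h1 (norm_ne_zero_iff.2 (sub_ne_zero.2 hx)))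

theorem smoothRadialDir_eq {p : E3} {c : ℝ} (i : Fin 3) {z : SpaceTime}
    (h : 2 ≤ c * ‖z.2 - p‖ ^ 2) : smoothRadialDir p c i z.2 = radialDir p i z := by
  rw [smoothRadialDir, Real.smoothTransition.one_of_one_le (by linarith), one_mul, radialDir]

instance (τ : ℝ) (p : E3) (t : ℝ) : IsFiniteMeasure (sideMeasure τ p t) := by
  have h : Integrable (fun q : ℝ × Metric.sphere (0 : E3) 1 => √2 * (τ - q.1) ^ 2)
      ((volume.restrict (Ioo 0 t)).prod (volume : Measure E3).toSphere) := by
    refine Integrable.mono' (g := fun _ => √2 * (|τ| + |t|) ^ 2) (integrable_const _)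
      (by fun_prop : Continuous fun q : ℝ × Metric.sphere (0 : E3) 1 =>
        √2 * (τ - q.1) ^ 2).aestronglyMeasurable ?_
    have h1 : ∀ᵐ s ∂volume.restrict (Ioo 0 t), s ∈ Ioo 0 t :=
      ae_restrict_mem measurableSet_Ioo
    filter_upwards [Measure.quasiMeasurePreserving_fst.ae h1] with q hq
    rw [norm_mul, norm_pow, Real.norm_eq_abs, Real.norm_eq_abs, abs_of_nonneg (by positivity)]
    have h2 : |τ - q.1| ≤ |τ| + |t| := (abs_sub _ _).trans (by
      rw [abs_of_pos hq.1]; linarith [hq.2, le_abs_self t])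
    gcongr
  have := isFiniteMeasure_withDensity_ofReal h.2
  unfold sideMeasure
  infer_instance

theorem integrable_of_continuous_of_bounded {X : Type*} [TopologicalSpace X]
    [MeasurableSpace X] [OpensMeasurableSpace X] {μ : Measure X} [IsFiniteMeasure μ] {f : X → ℝ}
    (hf : Continuous f) {C : ℝ} (hC : ∀ x, ‖f x‖ ≤ C) : Integrable f μ :=
  Integrable.of_bound hf.aestronglyMeasurable C (Eventually.of_forall hC)

variable {τ t : ℝ} {p : E3} {v vt u : SpaceTime → E3} {dv : Fin 3 → SpaceTime → E3}

theorem integrable_fluxField (hvt : Integrable vt (volume.restrict (openCone τ p t)))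
    (hdv : ∀ i, Integrable (dv i) (volume.restrict (openCone τ p t))) (i : Fin 3) :
    Integrable (fluxField p vt dv i) (volume.restrict (openCone τ p t)) := by
  refine (hdv i).sub (hvt.bdd_smul 1 (measurable_radialDir p i).aestronglyMeasurable ?_)
  exact Eventually.of_forall fun z => abs_radialDir_le_one p i z

theorem integrable_crossEnergy {Ω : Set SpaceTime} (hu : ContDiff ℝ ∞ u)
    (huc : HasCompactSupport u) (hvt : IntegrableOn vt Ω) (hdv : ∀ i, IntegrableOn (dv i) Ω) :
    IntegrableOn (crossEnergy vt dv u) Ω ∧ ∀ i, IntegrableOn (crossCurrent vt dv u i) Ω := by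
  have hT : IsTestOn univ u := ⟨hu, huc, by simp⟩
  refine ⟨(hT.timeDeriv.integrable_inner hvt).add
    (integrable_finsetSum _ fun i _ => (hT.spaceDeriv i).integrable_inner (hdv i)), fun i => ?_⟩
  exact (hT.timeDeriv.integrable_inner (hdv i)).add ((hT.spaceDeriv i).integrable_inner hvt)

/-- The flux field of a smooth map extends smoothly from the neighbourhood of the side. -/
theorem exists_smooth_fluxField (p : E3) (hu : ContDiff ℝ ∞ u) (huc : HasCompactSupport u)
    (htτ : t < τ) :
    ∃ F : Fin 3 → SpaceTime → E3, (∀ i, ContDiff ℝ ∞ (F i)) ∧ (∀ i, HasCompactSupport (F i)) ∧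
      ∀ h ∈ Ioo 0 ((τ - t) / 2), ∀ z ∈ shell τ p t h, z.2 ≠ p ∧
        ∀ i, F i z = spaceDeriv i u z - radialDir p i z • timeDeriv u z := by
  have hut := contDiff_timeDeriv hu
  have hui := contDiff_spaceDeriv hu
  have hTu : IsTestOn univ u := ⟨hu, huc, by simp⟩
  refine ⟨fun i z => spaceDeriv i u z - smoothRadialDir p (8 / (τ - t) ^ 2) i z.2 • timeDeriv u z,
    fun i => (hui i).sub (((contDiff_smoothRadialDir p i).comp contDiff_snd).smul hut),
    fun i => (hTu.spaceDeriv i).2.1.sub (hTu.timeDeriv.2.1.smul_left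
      (f := fun z : SpaceTime => smoothRadialDir p (8 / (τ - t) ^ 2) i z.2)), fun h hh z hz => ?_⟩
  have hz1 : (τ - t) / 2 ≤ ‖z.2 - p‖ := by
    have h2 := hz.2.1
    rw [dist_eq_norm] at h2
    linarith [hz.1.2, hh.2]
  have hz0 : 0 < τ - t := by linarith
  refine ⟨fun h2 => by rw [h2, sub_self, norm_zero] at hz1; linarith, fun i => ?_⟩
  -- On the shell `|x - p| ≥ (τ - t) / 2`, so that the cutoff of the radial vector equals `1` there.
  have hz3 : 2 ≤ 8 / (τ - t) ^ 2 * ‖z.2 - p‖ ^ 2 := by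
    calc (2 : ℝ) = 8 / (τ - t) ^ 2 * ((τ - t) / 2) ^ 2 := by field_simp; norm_num
      _ ≤ _ := by gcongr
  simp only [smoothRadialDir_eq i hz3]

theorem isTestOn_time_smul {F : SpaceTime → E3} (hF : ContDiff ℝ ∞ F) (hFc : HasCompactSupport F)
    {η : ℝ → ℝ} (hη : ContDiff ℝ ∞ η) (hηt : tsupport η ⊆ Ioo 0 t) :
    IsTestOn (Ioo 0 t ×ˢ univ) fun z : SpaceTime => η z.1 • F z := by
  have hη1 : ContDiff ℝ ∞ fun z : SpaceTime => η z.1 := hη.comp contDiff_fst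
  refine ⟨hη1.smul hF, hFc.smul_left (f := fun z : SpaceTime => η z.1), ?_⟩
  rw [(isOpen_Ioo.prod isOpen_univ).interior_eq]
  intro z hz
  have h1 := tsupport_smul_subset_left (fun z : SpaceTime => η z.1) F hz
  exact ⟨hηt (tsupport_comp_subset_preimage η continuous_fst h1), mem_univ _⟩

theorem hasCompactSupport_sum_norm_sq {F : Fin 3 → SpaceTime → E3}
    (hF : ∀ i, HasCompactSupport (F i)) : HasCompactSupport fun z => ∑ i, ‖F i z‖ ^ 2 := by
  refine HasCompactSupport.of_support_subset_isCompact
    (isCompact_iUnion fun i => (hF i).isCompact) fun z hz => ?_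
  by_contra h
  refine hz (Finset.sum_eq_zero fun i _ => ?_)
  rw [image_eq_zero_of_notMem_tsupport fun h' => h (mem_iUnion.2 ⟨i, h'⟩)]
  simp

/-- The boundary term of the relative energy law, as an integral over the side. -/
theorem integral_relEnergy_eq_side
    (hvt : Integrable vt (volume.restrict (openCone τ p t)))
    (hdv : ∀ i, Integrable (dv i) (volume.restrict (openCone τ p t)))
    (hr : Integrable (relSource v vt dv u) (volume.restrict (openCone τ p t)))
    (hu : ContDiff ℝ ∞ u) (huc : HasCompactSupport u) (htτ : t < τ)
    (hlaw : ∀ ζ : SpaceTime → ℝ, IsTestOn (openCone τ p t) ζ →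
      ∫ z in openCone τ p t, (- (timeDeriv ζ z * relEnergy vt dv u z)
        + ∑ i, spaceDeriv i ζ z * relCurrent vt dv u i z + ζ z * relSource v vt dv u z) = 0)
    {G : Fin 3 → SpaceTime → E3} (hG : IsSideTrace τ p t vt dv G)
    {η : ℝ → ℝ} (hη : ContDiff ℝ ∞ η) (hηc : HasCompactSupport η) (hηt : tsupport η ⊆ Ioo 0 t)
    {F : Fin 3 → SpaceTime → E3} (hFs : ∀ i, ContDiff ℝ ∞ (F i))
    (hFc : ∀ i, HasCompactSupport (F i))
    (hF : ∀ h ∈ Ioo 0 ((τ - t) / 2), ∀ z ∈ shell τ p t h, z.2 ≠ p ∧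
        ∀ i, F i z = spaceDeriv i u z - radialDir p i z • timeDeriv u z)
    {q : SpaceTime → ℝ} (hq : ∀ z, q z = η z.1 * (1 / 2 * ∑ i, ‖F i z‖ ^ 2)) {M : ℝ}
    (hqcont : Continuous q) (hM : ∀ z, ‖q z‖ ≤ M) :
    (√2)⁻¹ * (∫ z, q z ∂(sideMeasure τ p t)) -
      (√2)⁻¹ * (∫ z, ∑ i, inner ℝ (G i z) (η z.1 • F i z) ∂(sideMeasure τ p t)) =
      ∫ z in openCone τ p t,
        (deriv η z.1 * relEnergy vt dv u z - η z.1 * relSource v vt dv u z) := by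
  have htest := fun i => isTestOn_time_smul (t := t) (hFs i) (hFc i) hη hηt
  have hlim1 := tendsto_average_shell hqcont hM p htτ
  have hlim2 := (hG.2 _ htest).const_mul (√2)⁻¹
  have heint := (integrable_crossEnergy (Ω := openCone τ p t) hu huc
    (integrableOn_openCone_of_continuous (contDiff_timeDeriv hu).continuous)
    (fun i => integrableOn_openCone_of_continuous (contDiff_spaceDeriv hu i).continuous))
  have heint' := (integrable_crossEnergy hu huc hvt hdv)
  have E1 : IntegrableOn (relEnergy vt dv u) (openCone τ p t) :=
    (heint.1.const_mul (1 / 2)).sub heint'.1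
  have E2 : ∀ i, IntegrableOn (relCurrent vt dv u i) (openCone τ p t) := fun i =>
    ((heint.2 i).const_mul (1 / 2)).sub (heint'.2 i)
  have hlim3 := tendsto_shell_average E1 hr E2 htτ hlaw hη hηc hηt
  refine tendsto_nhds_unique ((hlim1.sub hlim2).congr' ?_) hlim3
  filter_upwards [Ioo_mem_nhdsGT (show (0 : ℝ) < (τ - t) / 2 by linarith)] with h hh
  have hsub : shell τ p t h ⊆ openCone τ p t := by rw [shell_eq]; exact inter_subset_left
  have I1 : IntegrableOn q (shell τ p t h) :=
    (integrableOn_openCone_of_continuous hqcont).mono_set hsub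
  have I2 : IntegrableOn (fun z => ∑ i, inner ℝ (fluxField p vt dv i z) (η z.1 • F i z))
      (shell τ p t h) :=
    IntegrableOn.mono_set (integrable_finsetSum _ fun i _ =>
      (htest i).integrable_inner (integrable_fluxField hvt hdv i)) hsub
  have hs : (√2)⁻¹ * (√2 / h) = h⁻¹ := by
    have : (√2 : ℝ) ≠ 0 := by positivity
    field_simp
  rw [← mul_assoc, hs, ← mul_sub, ← integral_sub I1 I2]
  congr 1
  refine setIntegral_congr_fun (measurableSet_shell τ p t h) fun z hz => ?_
  obtain ⟨hz1, hz2⟩ := hF h hh z hz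
  simp only [hq]
  rw [relEnergy_sub_relCurrent hz1 hz2, mul_sub, Finset.mul_sum (s := Finset.univ)
    (f := fun i => inner ℝ (fluxField p vt dv i z) (F i z))]
  simp only [inner_smul_right]

/-- Completing the square on the side of the cone: whatever `u` is, the loss of relative energy
through the side is at least minus the flux of `v`. -/
theorem neg_flux_le_integral_relEnergy
    (hvt : Integrable vt (volume.restrict (openCone τ p t)))
    (hdv : ∀ i, Integrable (dv i) (volume.restrict (openCone τ p t)))
    (hr : Integrable (relSource v vt dv u) (volume.restrict (openCone τ p t)))
    (hu : ContDiff ℝ ∞ u) (huc : HasCompactSupport u) (htτ : t < τ)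
    (hlaw : ∀ ζ : SpaceTime → ℝ, IsTestOn (openCone τ p t) ζ →
      ∫ z in openCone τ p t, (- (timeDeriv ζ z * relEnergy vt dv u z)
        + ∑ i, spaceDeriv i ζ z * relCurrent vt dv u i z + ζ z * relSource v vt dv u z) = 0)
    {G : Fin 3 → SpaceTime → E3} (hG : IsSideTrace τ p t vt dv G)
    {η : ℝ → ℝ} (hη : ContDiff ℝ ∞ η) (hηc : HasCompactSupport η) (hηt : tsupport η ⊆ Ioo 0 t)
    (hη01 : ∀ s, η s ∈ Icc (0 : ℝ) 1) :
    - (1 / (2 * √2) * ∫ z, ∑ i, ‖G i z‖ ^ 2 ∂(sideMeasure τ p t)) ≤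
      ∫ z in openCone τ p t,
        (deriv η z.1 * relEnergy vt dv u z - η z.1 * relSource v vt dv u z) := by
  obtain ⟨F, hFs, hFc, hF⟩ := exists_smooth_fluxField p hu huc htτ
  have hη1 : Continuous fun z : SpaceTime => η z.1 := hη.continuous.comp continuous_fst
  obtain ⟨q, hq⟩ : ∃ q : SpaceTime → ℝ, ∀ z, q z = η z.1 * (1 / 2 * ∑ i, ‖F i z‖ ^ 2) :=
    ⟨_, fun _ => rfl⟩
  have hqcont : Continuous q := by
    rw [funext hq]
    exact hη1.mul (continuous_const.mul
      (continuous_finsetSum _ fun i _ => (hFs i).continuous.norm.pow 2))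
  have hqc : HasCompactSupport q := by
    rw [funext hq]
    exact ((hasCompactSupport_sum_norm_sq hFc).mul_left (f := fun _ => (1 / 2 : ℝ))).mul_left
  obtain ⟨M, -, hM⟩ := exists_norm_le_of_hasCompactSupport hqcont hqc
  rw [← integral_relEnergy_eq_side hvt hdv hr hu huc htτ hlaw hG hη hηc hηt hFs hFc hF hq hqcont hM]
  have J1 : Integrable q (sideMeasure τ p t) := integrable_of_continuous_of_bounded hqcont hM
  have J2 : Integrable (fun z => ∑ i, inner ℝ (G i z) (η z.1 • F i z)) (sideMeasure τ p t) :=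
    integrable_finsetSum _ fun i _ =>
      (isTestOn_time_smul (t := t) (hFs i) (hFc i) hη hηt).integrable_inner
        (integrable_of_memLp_two (hG.1 i))
  have J3 : Integrable (fun z => ∑ i, ‖G i z‖ ^ 2) (sideMeasure τ p t) :=
    integrable_finsetSum _ fun i _ => (memLp_two_iff_integrable_sq_norm (hG.1 i).1).1 (hG.1 i)
  have J4 : Integrable (fun z => q z - ∑ i, inner ℝ (G i z) (η z.1 • F i z))
    (sideMeasure τ p t) := J1.sub J2
  have hmain : 0 ≤ (∫ z, q z ∂(sideMeasure τ p t)) -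
      (∫ z, ∑ i, inner ℝ (G i z) (η z.1 • F i z) ∂(sideMeasure τ p t)) +
      1 / 2 * ∫ z, ∑ i, ‖G i z‖ ^ 2 ∂(sideMeasure τ p t) := by
    rw [← integral_sub J1 J2, ← integral_const_mul, ← integral_add J4 (J3.const_mul _)]
    refine integral_nonneg fun z => ?_
    have h1 : ∀ i, 0 ≤ η z.1 * (1 / 2 * ‖F i z‖ ^ 2) - inner ℝ (G i z) (η z.1 • F i z) +
        1 / 2 * ‖G i z‖ ^ 2 := fun i => by
      have h2 := norm_sub_sq_real (G i z) (F i z)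
      have h3 := sq_nonneg ‖G i z - F i z‖
      rw [inner_smul_right]
      obtain ⟨h4, h5⟩ := hη01 z.1
      have h6 := mul_nonneg h4 h3
      rw [h2] at h6
      have h7 := mul_nonneg (sub_nonneg.2 h5) (sq_nonneg ‖G i z‖)
      linarith
    have h2 := Finset.sum_nonneg fun i (_ : i ∈ Finset.univ) => h1 i
    simp only [Finset.sum_add_distrib, Finset.sum_sub_distrib, ← Finset.mul_sum] at h2
    simpa only [hq, Pi.zero_apply] using h2
  have hs2 : (0 : ℝ) < √2 := by positivity
  have h1 : 1 / (2 * √2) = (√2)⁻¹ * (1 / 2) := by rw [one_div, mul_inv]; ring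
  have h2 := mul_nonneg (inv_pos.2 hs2).le hmain
  rw [h1]
  linarith

end RelativeEnergy

/-! ### Cutoffs in time -/

section TimeCutoff

/-- A smooth step from `0` to `1` in the interval `[1/c, 2/c]`. -/
noncomputable def timeStep (c s : ℝ) : ℝ := Real.smoothTransition (c * s - 1)

theorem contDiff_timeStep (c : ℝ) : ContDiff ℝ ∞ (timeStep c) :=
  Real.smoothTransition.contDiff.comp (by fun_prop)

theorem monotone_timeStep {c : ℝ} (hc : 0 < c) : Monotone (timeStep c) := fun a b hab =>
  Real.smoothTransition.monotone (by gcongr)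

theorem timeStep_of_le {c s : ℝ} (h : c * s ≤ 1) : timeStep c s = 0 :=
  Real.smoothTransition.zero_of_nonpos (by linarith)

theorem timeStep_of_ge {c s : ℝ} (h : 2 ≤ c * s) : timeStep c s = 1 :=
  Real.smoothTransition.one_of_one_le (by linarith)

theorem timeStep_mem (c s : ℝ) : timeStep c s ∈ Icc (0 : ℝ) 1 :=
  ⟨Real.smoothTransition.nonneg _, Real.smoothTransition.le_one _⟩

variable {F : Type*} [NormedAddCommGroup F] [NormedSpace ℝ F]

theorem norm_integral_deriv_timeStep_sub_le [CompleteSpace F] {P : ℝ → F} {t c ε : ℝ} {a : F}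
    (ht : 0 < t) (hc : 0 < c) (hct : 2 ≤ c * t) (hP : IntervalIntegrable P volume 0 t)
    (hPa : ∀ s ∈ Ioo 0 t, c * s < 2 → ‖P s - a‖ ≤ ε) :
    ‖(∫ s in (0 : ℝ)..t, deriv (timeStep c) s • P s) - a‖ ≤ ε := by
  have hd : Continuous (deriv (timeStep c)) := (contDiff_timeStep c).continuous_deriv (by simp)
  have h1 : ∫ s in (0 : ℝ)..t, deriv (timeStep c) s = 1 := by
    rw [intervalIntegral.integral_deriv_eq_sub
      (fun s _ => (contDiff_timeStep c).differentiable (by simp) s) (hd.intervalIntegrable _ _),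
      timeStep_of_ge hct, timeStep_of_le (by simp), sub_zero]
  have h2 : (∫ s in (0 : ℝ)..t, deriv (timeStep c) s • P s) - a =
      ∫ s in (0 : ℝ)..t, deriv (timeStep c) s • (P s - a) := by
    have hca : IntervalIntegrable (fun s => deriv (timeStep c) s • a) volume 0 t :=
      (hd.smul continuous_const).intervalIntegrable _ _
    simp only [smul_sub]
    rw [intervalIntegral.integral_sub (hP.continuousOn_smul hd.continuousOn) hca,
      intervalIntegral.integral_smul_const,
      h1, one_smul]
  have h3 : ∀ s, 0 ≤ deriv (timeStep c) s := fun s => (monotone_timeStep hc).deriv_nonneg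
  have h4 : ∀ s, 2 < c * s → deriv (timeStep c) s = 0 := fun s hs => by
    have : timeStep c =ᶠ[𝓝 s] fun _ => 1 := by
      have h5 : ∀ᶠ y in 𝓝 s, 2 < c * y :=
        (by fun_prop : Continuous fun y => c * y).continuousAt.eventually_const_lt hs
      filter_upwards [h5] with y hy using timeStep_of_ge hy.le
    rw [this.deriv_eq, deriv_const]
  have h5 : ∀ᵐ s : ℝ, s ≠ t ∧ s ≠ 2 / c := by
    filter_upwards [Measure.ae_ne volume t, Measure.ae_ne volume (2 / c)] with s hs hs'
    exact ⟨hs, hs'⟩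
  rw [h2]
  refine (intervalIntegral.norm_integral_le_of_norm_le ht.le
    (g := fun s => deriv (timeStep c) s * ε) ?_
    ((hd.mul continuous_const).intervalIntegrable _ _)).trans ?_
  · filter_upwards [h5] with s hs hs'
    rw [norm_smul, Real.norm_eq_abs, abs_of_nonneg (h3 s)]
    rcases lt_trichotomy (c * s) 2 with h | h | h
    · exact mul_le_mul_of_nonneg_left (hPa s ⟨hs'.1, lt_of_le_of_ne hs'.2 hs.1⟩ h) (h3 s)
    · exact absurd (by rw [eq_div_iff hc.ne', mul_comm, h]) hs.2
    · simp [h4 s h]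
  · rw [intervalIntegral.integral_mul_const, h1, one_mul]

/-- Smooth compactly supported functions on `(0, t)` which increase to `1`. -/
noncomputable def timeCutoff (t : ℝ) (n : ℕ) (s : ℝ) : ℝ :=
  timeStep ((n + 4) / t) s + timeStep ((n + 4) / t) (t - s) - 1

variable {t : ℝ}

theorem contDiff_timeCutoff (t : ℝ) (n : ℕ) : ContDiff ℝ ∞ (timeCutoff t n) :=
  ((contDiff_timeStep _).add ((contDiff_timeStep _).comp (contDiff_const.sub contDiff_id))).sub
    contDiff_const

theorem tsupport_timeCutoff_subset (ht : 0 < t) (n : ℕ) : tsupport (timeCutoff t n) ⊆ Ioo 0 t := by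
  set c : ℝ := (n + 4) / t with hc
  have hc0 : 0 < c := by positivity
  have hct : c * t = n + 4 := by rw [hc]; field_simp
  have hn : (0 : ℝ) ≤ n := Nat.cast_nonneg n
  have h1 : Function.support (timeCutoff t n) ⊆ Icc (1 / c) (t - 1 / c) := by
    intro s hs
    have hc1 : c * (1 / c) = 1 := by field_simp
    refine ⟨le_of_not_gt fun h => hs ?_, le_of_not_gt fun h => hs ?_⟩
    · have h2 : c * s ≤ 1 := by rw [← hc1]; gcongr
      rw [timeCutoff, ← hc, timeStep_of_le h2, timeStep_of_ge (by rw [mul_sub, hct]; linarith)]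
      norm_num
    · have h2 : c * (t - s) ≤ 1 := by rw [← hc1]; gcongr; linarith
      rw [timeCutoff, ← hc, timeStep_of_le h2, timeStep_of_ge (by rw [mul_sub, hct] at h2; linarith)]
      norm_num
  refine (closure_minimal h1 isClosed_Icc).trans fun s hs => ?_
  have : 0 < 1 / c := by positivity
  exact ⟨this.trans_le hs.1, by linarith [hs.2]⟩

theorem hasCompactSupport_timeCutoff (ht : 0 < t) (n : ℕ) : HasCompactSupport (timeCutoff t n) :=
  isCompact_Icc.of_isClosed_subset (isClosed_tsupport _)
    ((tsupport_timeCutoff_subset ht n).trans Ioo_subset_Icc_self)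

theorem timeCutoff_mem (ht : 0 < t) (n : ℕ) (s : ℝ) : timeCutoff t n s ∈ Icc (0 : ℝ) 1 := by
  set c : ℝ := (n + 4) / t with hc
  have hct : c * t = n + 4 := by rw [hc]; field_simp
  have hn : (0 : ℝ) ≤ n := Nat.cast_nonneg n
  have h1 := timeStep_mem c s
  have h2 := timeStep_mem c (t - s)
  rw [timeCutoff, ← hc]
  refine ⟨?_, by linarith [h1.2, h2.2]⟩
  by_cases h : 2 ≤ c * s
  · rw [timeStep_of_ge h]; linarith [h2.1]
  · rw [timeStep_of_ge (s := t - s) (by rw [mul_sub, hct]; linarith)]; linarith [h1.1]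

theorem tendsto_cutoff_rate (ht : 0 < t) :
    Tendsto (fun n : ℕ => ((n : ℝ) + 4) / t) atTop atTop :=
  (tendsto_atTop_add_const_right _ _ tendsto_natCast_atTop_atTop).atTop_div_const ht

theorem eventually_timeCutoff_eq_one {s : ℝ} (hs : s ∈ Ioo 0 t) :
    ∀ᶠ n in atTop, timeCutoff t n s = 1 := by
  have ht : 0 < t := hs.1.trans hs.2
  have h1 := ((tendsto_cutoff_rate ht).atTop_mul_const hs.1).eventually_ge_atTop 2
  have h2 := ((tendsto_cutoff_rate ht).atTop_mul_const (sub_pos.2 hs.2)).eventually_ge_atTop 2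
  filter_upwards [h1, h2] with n h1 h2
  rw [timeCutoff, timeStep_of_ge h1, timeStep_of_ge h2]
  norm_num

theorem tendsto_integral_deriv_timeStep [CompleteSpace F] {P : ℝ → F} {a : F} (ht : 0 < t)
    (hP : IntervalIntegrable P volume 0 t) (ha : Tendsto P (𝓝[>] 0) (𝓝 a)) :
    Tendsto (fun n : ℕ => ∫ s in (0 : ℝ)..t, deriv (timeStep ((n + 4) / t)) s • P s) atTop
      (𝓝 a) := by
  rw [Metric.tendsto_nhds]
  intro ε hε
  have h1 : ∀ᶠ s in 𝓝[>] (0 : ℝ), ‖P s - a‖ ≤ ε / 2 := by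
    filter_upwards [Metric.tendsto_nhds.1 ha (ε / 2) (by positivity)] with s hs
    rw [dist_eq_norm] at hs; exact hs.le
  obtain ⟨δ, hδ, hδ'⟩ := mem_nhdsGT_iff_exists_Ioo_subset.1 h1
  have hδ0 : (0 : ℝ) < δ := hδ
  filter_upwards [((tendsto_cutoff_rate ht).atTop_mul_const hδ0).eventually_ge_atTop 2] with n hn
  set c : ℝ := (n + 4) / t with hc
  have hc0 : 0 < c := by positivity
  have hct : c * t = n + 4 := by rw [hc]; field_simp
  have hn : (0 : ℝ) ≤ n := Nat.cast_nonneg n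
  rw [dist_eq_norm]
  refine (norm_integral_deriv_timeStep_sub_le ht hc0 (by linarith) hP fun s hs hs2 => ?_).trans_lt
    (half_lt_self hε)
  exact hδ' ⟨hs.1, lt_of_mul_lt_mul_left (hs2.trans_le (by assumption)) hc0.le⟩

/-- Integration against the derivative of the cutoffs picks out the difference of the one-sided
limits at the ends of the interval. -/
theorem tendsto_integral_deriv_timeCutoff [CompleteSpace F] {P : ℝ → F} {a b : F} (ht : 0 < t)
    (hP : IntegrableOn P (Ioo 0 t)) (ha : Tendsto P (𝓝[>] 0) (𝓝 a))
    (hb : Tendsto P (𝓝[<] t) (𝓝 b)) :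
    Tendsto (fun n : ℕ => ∫ s in Ioo 0 t, deriv (timeCutoff t n) s • P s) atTop (𝓝 (a - b)) := by
  have hP' : IntervalIntegrable P volume 0 t :=
    (intervalIntegrable_iff_integrableOn_Ioo_of_le ht.le).2 hP
  have hP2 : IntervalIntegrable (fun s => P (t - s)) volume 0 t := by
    simpa using (hP'.comp_sub_left t).symm
  have hb' : Tendsto (fun s => P (t - s)) (𝓝[>] 0) (𝓝 b) := by
    refine hb.comp (tendsto_nhdsWithin_iff.2 ⟨?_, ?_⟩)
    · have : Tendsto (fun s : ℝ => t - s) (𝓝 0) (𝓝 (t - 0)) := by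
        exact (continuous_const.sub continuous_id).tendsto 0
      rw [sub_zero] at this
      exact this.mono_left nhdsWithin_le_nhds
    · filter_upwards [self_mem_nhdsWithin] with s hs
      have : (0 : ℝ) < s := hs
      simp [this]
  have h1 := tendsto_integral_deriv_timeStep ht hP' ha
  have h2 := tendsto_integral_deriv_timeStep ht hP2 hb'
  refine (h1.sub h2).congr fun n => ?_
  set c : ℝ := (n + 4) / t with hc
  have hd : Continuous (deriv (timeStep c)) := (contDiff_timeStep c).continuous_deriv (by simp)
  have h3 : ∫ s in (0 : ℝ)..t, deriv (timeStep c) s • P (t - s) =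
      ∫ s in (0 : ℝ)..t, deriv (timeStep c) (t - s) • P s := by
    have := intervalIntegral.integral_comp_sub_left (a := 0) (b := t)
      (fun s => deriv (timeStep c) (t - s) • P s) t
    simpa using this
  have h4 : ∀ s, deriv (timeCutoff t n) s = deriv (timeStep c) s - deriv (timeStep c) (t - s) := by
    intro s
    have hD := fun s => ((contDiff_timeStep c).differentiable (by simp) s).hasDerivAt
    have h5 : HasDerivAt (fun s => timeStep c (t - s)) (deriv (timeStep c) (t - s) * (-1)) s :=
      (hD (t - s)).comp s ((hasDerivAt_id s).const_sub t)
    have h6 : HasDerivAt (timeCutoff t n) _ s := ((hD s).add h5).sub_const 1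
    rw [h6.deriv]; ring
  have hd' : Continuous fun s => deriv (timeStep c) (t - s) :=
    hd.comp (continuous_const.sub continuous_id)
  rw [h3, ← intervalIntegral.integral_sub (hP'.continuousOn_smul hd.continuousOn)
    (hP'.continuousOn_smul hd'.continuousOn), intervalIntegral.integral_of_le ht.le,
    integral_Ioc_eq_integral_Ioo]
  refine integral_congr_ae (Eventually.of_forall fun s => ?_)
  simp only [h4, sub_smul]

/-- The cutoffs tend to `1` under the integral over `(0, t)`. -/
theorem tendsto_integral_timeCutoff {P : ℝ → F} (ht : 0 < t)
    (hP : IntegrableOn P (Ioo 0 t)) :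
    Tendsto (fun n : ℕ => ∫ s in Ioo 0 t, timeCutoff t n s • P s) atTop
      (𝓝 (∫ s in Ioo 0 t, P s)) := by
  refine tendsto_integral_of_dominated_convergence (fun s => ‖P s‖)
    (fun n => (contDiff_timeCutoff t n).continuous.aestronglyMeasurable.smul hP.1) hP.norm
    (fun n => Eventually.of_forall fun s => ?_) ?_
  · have h := timeCutoff_mem ht n s
    rw [norm_smul, Real.norm_eq_abs, abs_of_nonneg h.1]
    exact mul_le_of_le_one_left (norm_nonneg _) h.2
  · rw [ae_restrict_iff' measurableSet_Ioo]
    refine Eventually.of_forall fun s hs => tendsto_const_nhds.congr' ?_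
    filter_upwards [eventually_timeCutoff_eq_one hs] with n hn
    rw [hn, one_smul]

end TimeCutoff

/-! ### Weak wave maps as integrals of their time derivative -/

section TimeRepresentation

/-- A field which is orthogonal to all test fields on an open set vanishes almost everywhere
there. -/
theorem ae_eq_zero_of_forall_integral_inner {D : Set E3} (hD : IsOpen D) {W : E3 → E3}
    (hW : IntegrableOn W D)
    (h : ∀ Ψ : E3 → E3, IsTestOn D Ψ → ∫ x in D, inner ℝ (W x) (Ψ x) = 0) :
    ∀ᵐ x ∂volume.restrict D, W x = 0 := by
  rw [ae_restrict_iff' hD.measurableSet]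
  have hj : ∀ j : Fin 3, ∀ᵐ x, x ∈ D → W x j = 0 := by
    intro j
    have hWj : IntegrableOn (fun x => W x j) D :=
      (EuclideanSpace.proj j : E3 →L[ℝ] ℝ).integrable_comp hW
    refine hD.ae_eq_zero_of_integral_contDiff_smul_eq_zero hWj.locallyIntegrableOn
      fun g hg hgc hgD => ?_
    have hΨ : IsTestOn D fun x => g x • (EuclideanSpace.single j 1 : E3) :=
      ⟨hg.smul contDiff_const, hgc.smul_right,
        (tsupport_smul_subset_left g _).trans (hgD.trans hD.interior_eq.symm.subset)⟩
    rw [← h _ hΨ, ← setIntegral_eq_integral_of_forall_compl_eq_zero (s := D)]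
    · refine integral_congr_ae (Eventually.of_forall fun x => ?_)
      simp [inner_smul_right, EuclideanSpace.inner_single_right]
    · intro x hx
      rw [image_eq_zero_of_notMem_tsupport fun h' => hx (hgD h'), zero_smul]
  filter_upwards [ae_all_iff.2 hj] with x hx hxD
  ext j
  exact hx j hxD

variable {τ T : ℝ} {p : E3} {v vt : SpaceTime → E3} {dv : Fin 3 → SpaceTime → E3}

theorem isTestOn_time_mul_space {t : ℝ} {η : ℝ → ℝ} (hη : ContDiff ℝ ∞ η)
    (hηc : HasCompactSupport η) (hηt : tsupport η ⊆ Ioo 0 t) {Ψ : E3 → E3}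
    (hΨ : IsTestOn (disk τ p t) Ψ) :
    IsTestOn (openCone τ p t) fun z : SpaceTime => η z.1 • Ψ z.2 := by
  have hsupp : Function.support (fun z : SpaceTime => η z.1 • Ψ z.2) ⊆
      tsupport η ×ˢ tsupport Ψ := fun z hz =>
    ⟨subset_tsupport _ fun h => hz (by simp [h]), subset_tsupport _ fun h => hz (by simp [h])⟩
  refine ⟨(hη.comp contDiff_fst).smul (hΨ.1.comp contDiff_snd),
    HasCompactSupport.of_support_subset_isCompact (hηc.isCompact.prod hΨ.2.1.isCompact) hsupp, ?_⟩
  rw [(isOpen_openCone τ p t).interior_eq]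
  refine (closure_minimal hsupp ((isClosed_tsupport _).prod (isClosed_tsupport _))).trans ?_
  rintro ⟨s, x⟩ ⟨hs, hx⟩
  have hs' := hηt hs
  exact ⟨hs', disk_anti τ p hs'.2.le (interior_subset (hΨ.2.2 hx))⟩

theorem timeDeriv_time_mul_space {η : ℝ → ℝ} (hη : ContDiff ℝ ∞ η) {Ψ : E3 → E3}
    (hΨ : ContDiff ℝ ∞ Ψ) (z : SpaceTime) :
    timeDeriv (fun z : SpaceTime => η z.1 • Ψ z.2) z = deriv η z.1 • Ψ z.2 := by
  have h1 : HasFDerivAt (fun z : SpaceTime => η z.1)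
      (deriv η z.1 • ContinuousLinearMap.fst ℝ ℝ E3) z :=
    (hη.differentiable (by simp) z.1).hasDerivAt.comp_hasFDerivAt z hasFDerivAt_fst
  have h2 : HasFDerivAt (fun z : SpaceTime => Ψ z.2)
      ((fderiv ℝ Ψ z.2).comp (ContinuousLinearMap.snd ℝ ℝ E3)) z :=
    (hΨ.differentiable (by simp) z.2).hasFDerivAt.comp z hasFDerivAt_snd
  have h3 : fderiv ℝ (fun z : SpaceTime => η z.1 • Ψ z.2) z = _ := (h1.smul h2).fderiv
  rw [timeDeriv, h3]
  simp

theorem setIntegral_disk_inner_eq {s t : ℝ} (hst : s ≤ t) {Ψ : E3 → E3}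
    (hΨ : IsTestOn (disk τ p t) Ψ) (f : E3 → E3) :
    ∫ x in disk τ p s, inner ℝ (f x) (Ψ x) = ∫ x in disk τ p t, inner ℝ (f x) (Ψ x) :=
  setIntegral_eq_of_subset_of_forall_sdiff_eq_zero (measurableSet_disk τ p s) (disk_anti τ p hst)
    fun x hx => by rw [hΨ.eq_zero hx.2, inner_zero_right]

/-- The weak time derivative in integrated form, tested on a fixed disk. -/
theorem IsWeakWaveMapOn.integral_inner_sub_eq (hv : IsWeakWaveMapOn (truncCone τ p T) v vt dv)
    (hvt : Integrable vt (volume.restrict (openCone τ p T))) {t : ℝ} (ht : t ∈ Ioc 0 T)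
    {Ψ : E3 → E3} (hΨ : IsTestOn (disk τ p t) Ψ) :
    (∫ x in disk τ p t, inner ℝ (v (t, x)) (Ψ x)) - ∫ x in disk τ p t, inner ℝ (v (0, x)) (Ψ x) =
      ∫ s in Ioo 0 t, ∫ x in disk τ p t, inner ℝ (vt (s, x)) (Ψ x) := by
  obtain ⟨ht0, htT⟩ := ht
  have hsub := openCone_subset_openCone τ p htT
  obtain ⟨C, -, hC⟩ := hΨ.exists_norm_le
  have hΨc : Continuous fun z : SpaceTime => Ψ z.2 := hΨ.1.continuous.comp continuous_snd
  have hvint : IntegrableOn (fun z : SpaceTime => inner ℝ (v z) (Ψ z.2)) (openCone τ p t) :=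
    integrable_inner_of_bounded (IntegrableOn.mono_set hv.integrable_v hsub) hΨc fun z => hC z.2
  have hvtint : IntegrableOn (fun z : SpaceTime => inner ℝ (vt z) (Ψ z.2)) (openCone τ p t) :=
    integrable_inner_of_bounded (IntegrableOn.mono_set hvt hsub) hΨc fun z => hC z.2
  set f : ℝ → ℝ := fun s => ∫ x in disk τ p t, inner ℝ (v (s, x)) (Ψ x) with hf
  set q : ℝ → ℝ := fun s => ∫ x in disk τ p t, inner ℝ (vt (s, x)) (Ψ x) with hq
  have hfint : IntegrableOn f (Ioo 0 t) :=
    (integrableOn_integral_disk hvint).congr_fun (fun s hs =>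
      setIntegral_disk_inner_eq hs.2.le hΨ _) measurableSet_Ioo
  have hqint : IntegrableOn q (Ioo 0 t) :=
    (integrableOn_integral_disk hvtint).congr_fun (fun s hs =>
      setIntegral_disk_inner_eq hs.2.le hΨ _) measurableSet_Ioo
  have hmem : Icc 0 t ⊆ timesOf (truncCone τ p T) (disk τ p t) := fun s hs =>
    mem_timesOf_truncCone τ p ⟨hs.1, hs.2.trans htT⟩ hs.2
  have hcont : ContinuousOn f (Icc 0 t) :=
    ((hv.continuous_v _ (measurableSet_disk τ p t) Metric.isBounded_ball).2 Ψ
      (MemLp.of_bound hΨ.1.continuous.aestronglyMeasurable C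
        (Eventually.of_forall hC))).mono hmem
  have h0 : Tendsto f (𝓝[>] 0) (𝓝 (f 0)) := by
    have := (hcont 0 ⟨le_rfl, ht0.le⟩).mono Ioo_subset_Icc_self
    rwa [ContinuousWithinAt, nhdsWithin_Ioo_eq_nhdsGT ht0] at this
  have h1 : Tendsto f (𝓝[<] t) (𝓝 (f t)) := by
    have := (hcont t ⟨ht0.le, le_rfl⟩).mono Ioo_subset_Icc_self
    rwa [ContinuousWithinAt, nhdsWithin_Ioo_eq_nhdsLT ht0] at this
  have hlim1 := tendsto_integral_deriv_timeCutoff ht0 hfint h0 h1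
  have hlim2 := (tendsto_integral_timeCutoff ht0 hqint).neg
  have key : ∀ n, ∫ s in Ioo 0 t, deriv (timeCutoff t n) s • f s =
      - ∫ s in Ioo 0 t, timeCutoff t n s • q s := by
    intro n
    have hη := contDiff_timeCutoff t n
    have hηc := hasCompactSupport_timeCutoff ht0 n
    have hηt := tsupport_timeCutoff_subset ht0 n
    have hΦ := isTestOn_time_mul_space hη hηc hηt hΨ
    have hw := hv.integral_inner_timeDeriv hvt (hΦ.mono hsub)
    rw [setIntegral_eq_of_subset_of_forall_sdiff_eq_zero (measurableSet_openCone τ p T) hsub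
        (fun z hz => by rw [hΦ.timeDeriv.eq_zero hz.2, inner_zero_right]),
      setIntegral_eq_of_subset_of_forall_sdiff_eq_zero (measurableSet_openCone τ p T) hsub
        (fun z hz => by rw [hΦ.eq_zero hz.2, inner_zero_right]),
      integral_openCone τ p t (hΦ.timeDeriv.integrable_inner
        (IntegrableOn.mono_set hv.integrable_v hsub)),
      integral_openCone τ p t (hΦ.integrable_inner (IntegrableOn.mono_set hvt hsub))] at hw
    simp only [timeDeriv_time_mul_space hη hΨ.1, inner_smul_right, integral_const_mul] at hw
    have hd : ∀ (θ : ℝ → ℝ) (g : SpaceTime → E3),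
        ∫ s in Ioo 0 t, θ s * ∫ x in disk τ p s, inner ℝ (g (s, x)) (Ψ x) =
          ∫ s in Ioo 0 t, θ s * ∫ x in disk τ p t, inner ℝ (g (s, x)) (Ψ x) := fun θ g =>
      setIntegral_congr_fun measurableSet_Ioo fun s hs => by
        simp only [setIntegral_disk_inner_eq hs.2.le hΨ]
    rw [hd, hd] at hw
    exact hw
  have := tendsto_nhds_unique (hlim1.congr key) hlim2
  have h2 : f t - f 0 = ∫ s in Ioo 0 t, q s := by linarith
  exact h2

/-- For every time `t`, `v(t, x) = v(0, x) + ∫₀ᵗ ∂ₜv(s, x) ds` for almost every `x`. -/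
theorem IsWeakWaveMapOn.eq_add_integral (hv : IsWeakWaveMapOn (truncCone τ p T) v vt dv)
    (hvt : Integrable vt (volume.restrict (openCone τ p T))) {t : ℝ} (ht : t ∈ Ioc 0 T) :
    ∀ᵐ x ∂volume.restrict (disk τ p t), v (t, x) = v (0, x) + ∫ s in Ioo 0 t, vt (s, x) := by
  have hprod : Integrable vt ((volume.restrict (Ioo 0 t)).prod (volume.restrict (disk τ p t))) := by
    rw [Measure.prod_restrict, ← Measure.volume_eq_prod]
    refine IntegrableOn.mono_set hvt ?_
    rintro ⟨s, x⟩ ⟨hs, hx⟩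
    exact ⟨⟨hs.1, hs.2.trans_le ht.2⟩, disk_anti τ p hs.2.le hx⟩
  have ht' : t ∈ Icc 0 T := ⟨ht.1.le, ht.2⟩
  have h0' : (0 : ℝ) ∈ Icc 0 T := ⟨le_rfl, ht.1.le.trans ht.2⟩
  have I1 : IntegrableOn (fun x => v (t, x)) (disk τ p t) :=
    integrable_of_memLp_two (hv.memLp_v_slice ht' le_rfl)
  have I2 : IntegrableOn (fun x => v (0, x)) (disk τ p t) :=
    integrable_of_memLp_two (hv.memLp_v_slice h0' ht.1.le)
  have I3 : IntegrableOn (fun x => ∫ s in Ioo 0 t, vt (s, x)) (disk τ p t) :=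
    hprod.integral_prod_right
  have I4 : IntegrableOn (fun x => v (t, x) - v (0, x)) (disk τ p t) := I1.sub I2
  have key := ae_eq_zero_of_forall_integral_inner (D := disk τ p t) Metric.isOpen_ball
    (I4.sub I3) fun Ψ hΨ => ?_
  · filter_upwards [key] with x hx
    simp only [Pi.sub_apply] at hx
    rw [sub_sub, sub_eq_zero] at hx
    exact hx
  · obtain ⟨C, -, hC⟩ := hΨ.exists_norm_le
    have hb : ∀ {f : E3 → E3}, IntegrableOn f (disk τ p t) →
        IntegrableOn (fun x => inner ℝ (f x) (Ψ x)) (disk τ p t) := fun hf =>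
      integrable_inner_of_bounded hf hΨ.1.continuous hC
    have hswap : ∫ s in Ioo 0 t, ∫ x in disk τ p t, inner ℝ (vt (s, x)) (Ψ x) =
        ∫ x in disk τ p t, inner ℝ (∫ s in Ioo 0 t, vt (s, x)) (Ψ x) := by
      rw [integral_integral_swap (f := fun s x => inner ℝ (vt (s, x)) (Ψ x))
        (integrable_inner_of_bounded hprod (hΨ.1.continuous.comp continuous_snd) fun z => hC z.2)]
      refine integral_congr_ae ?_
      filter_upwards [hprod.prod_left_ae] with x hx
      simp only [real_inner_comm (Ψ x)]
      exact integral_inner hx (Ψ x)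
    have h1 := hv.integral_inner_sub_eq hvt ht hΨ
    rw [hswap] at h1
    simp only [Pi.sub_apply, inner_sub_left]
    rw [integral_sub (by have := hb I4; simp only [inner_sub_left] at this; exact this) (hb I3),
      integral_sub (hb I1) (hb I2)]
    linarith

end TimeRepresentation

/-! ### Orthogonality and distance -/

section Orthogonality

variable {τ T : ℝ} {p : E3} {v vt : SpaceTime → E3} {dv : Fin 3 → SpaceTime → E3}

theorem Ioo_prod_disk_subset (τ : ℝ) (p : E3) {t T : ℝ} (htT : t ≤ T) :
    Ioo 0 t ×ˢ disk τ p t ⊆ openCone τ p T := by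
  rintro ⟨s, x⟩ ⟨hs, hx⟩
  exact ⟨⟨hs.1, hs.2.trans_le htT⟩, disk_anti τ p hs.2.le hx⟩

theorem integrable_prod_of_openCone {F : Type*} [NormedAddCommGroup F] {f : SpaceTime → F}
    {t : ℝ} (htT : t ≤ T) (hf : IntegrableOn f (openCone τ p T)) :
    Integrable f ((volume.restrict (Ioo 0 t)).prod (volume.restrict (disk τ p t))) := by
  rw [Measure.prod_restrict, ← Measure.volume_eq_prod]
  exact IntegrableOn.mono_set hf (Ioo_prod_disk_subset τ p htT)

/-- On a fixed disk, Fubini in the other order: for almost every point, at almost every time. -/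
theorem ae_ae_of_ae_openCone {t : ℝ} (htT : t ≤ T) {P : SpaceTime → Prop}
    (h : ∀ᵐ z ∂volume.restrict (openCone τ p T), P z) :
    ∀ᵐ x ∂volume.restrict (disk τ p t), ∀ᵐ s ∂volume.restrict (Ioo 0 t), P (s, x) := by
  have h1 : ∀ᵐ z ∂((volume.restrict (Ioo 0 t)).prod (volume.restrict (disk τ p t))), P z := by
    rw [Measure.prod_restrict, ← Measure.volume_eq_prod]
    exact ae_restrict_of_ae_restrict_of_subset (Ioo_prod_disk_subset τ p htT) h
  exact Measure.ae_ae_of_ae_prod (Measure.measurePreserving_swap.quasiMeasurePreserving.ae h1)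

/-- The primitive in time of a strongly measurable field is strongly measurable. -/
theorem stronglyMeasurable_time_primitive {f : SpaceTime → E3} (hf : StronglyMeasurable f) :
    StronglyMeasurable fun z : SpaceTime => ∫ s in Ioo 0 z.1, f (s, z.2) := by
  have hS : MeasurableSet {q : SpaceTime × ℝ | q.2 ∈ Ioo 0 q.1.1} :=
    (measurableSet_lt measurable_const measurable_snd).inter
      (measurableSet_lt measurable_snd (measurable_fst.comp measurable_fst))
  have h1 : StronglyMeasurable ({q : SpaceTime × ℝ | q.2 ∈ Ioo 0 q.1.1}.indicator
      fun q => f (q.2, q.1.2)) :=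
    (hf.comp_measurable (by fun_prop : Measurable fun q : SpaceTime × ℝ =>
      ((q.2, q.1.2) : SpaceTime))).indicator hS
  have h2 := h1.integral_prod_right' (ν := volume)
  have h3 : (fun z : SpaceTime => ∫ s in Ioo 0 z.1, f (s, z.2)) = fun z => ∫ s,
      ({q : SpaceTime × ℝ | q.2 ∈ Ioo 0 q.1.1}.indicator fun q => f (q.2, q.1.2)) (z, s) :=
    funext fun z => by rw [← integral_indicator measurableSet_Ioo]; rfl
  rw [h3]
  exact h2

/-- If `t ↦ a + ∫₀ᵗ f` has unit length at all rational times of an interval, then it is orthogonal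
to its derivative `f`. -/
theorem inner_primitive_eq_zero {f : ℝ → E3} {a : E3} {q : ℝ} (hq : 0 < q)
    (hf : IntegrableOn f (Ioo 0 q))
    (hnorm : ∀ r : ℚ, (r : ℝ) ∈ Ioo 0 q → ‖a + ∫ s in Ioo 0 (r : ℝ), f s‖ = 1) :
    ∀ᵐ s ∂volume.restrict (Ioo 0 q), inner ℝ (a + ∫ y in Ioo 0 s, f y) (f s) = 0 := by
  have hfi : IntervalIntegrable f volume 0 q :=
    (intervalIntegrable_iff_integrableOn_Ioo_of_le hq.le).2 hf
  set V : ℝ → E3 := fun s => a + ∫ y in (0 : ℝ)..s, f y with hV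
  have hVeq : ∀ s, 0 ≤ s → a + ∫ y in Ioo 0 s, f y = V s := fun s hs => by
    rw [hV, ← integral_Ioc_eq_integral_Ioo, ← intervalIntegral.integral_of_le hs]
  have hcont : ContinuousOn V (Icc 0 q) := by
    have := intervalIntegral.continuousOn_primitive_interval (μ := volume) (f := f) (a := 0) (b := q)
      (by rw [uIcc_of_le hq.le]; exact (integrableOn_Icc_iff_integrableOn_Ioo).2 hf)
    rw [uIcc_of_le hq.le] at this
    exact continuousOn_const.add this
  have hone : ∀ s ∈ Ioo 0 q, ‖V s‖ = 1 := by
    have hc : ContinuousOn (fun s => ‖V s‖) (Ioo 0 q) := (hcont.mono Ioo_subset_Icc_self).norm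
    have hd : Ioo 0 q ⊆ closure (Ioo 0 q ∩ range ((↑) : ℚ → ℝ)) :=
      Rat.denseRange_cast.open_subset_closure_inter isOpen_Ioo
    intro s hs
    refine Set.EqOn.of_subset_closure (f := fun s => ‖V s‖) (g := fun _ => 1) ?_ hc
      continuousOn_const inter_subset_left hd hs
    rintro _ ⟨hr, r, rfl⟩
    have := hnorm r hr
    rwa [hVeq _ hr.1.le] at this
  rw [ae_restrict_iff' measurableSet_Ioo]
  filter_upwards [hfi.ae_hasDerivAt_integral] with s hs hsq
  have h1 : HasDerivAt V (f s) s :=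
    (hs (by rw [uIcc_of_le hq.le]; exact Ioo_subset_Icc_self hsq) 0
      (by rw [uIcc_of_le hq.le]; exact ⟨le_rfl, hq.le⟩)).const_add a
  have h2 := h1.norm_sq
  have h3 : (fun s => ‖V s‖ ^ 2) =ᶠ[𝓝 s] fun _ => 1 := by
    filter_upwards [Ioo_mem_nhds hsq.1 hsq.2] with y hy
    rw [hone y hy]; norm_num
  have h4 := (h2.congr_of_eventuallyEq h3.symm).unique (hasDerivAt_const s (1 : ℝ))
  rw [hVeq s hsq.1.le]
  linarith

/-- Since `|v| = 1`, the weak time derivative is orthogonal to `v`. -/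
theorem IsWeakWaveMapOn.inner_v_vt_eq_zero (hv : IsWeakWaveMapOn (truncCone τ p T) v vt dv)
    (hT : 0 < T) (hvt : Integrable vt (volume.restrict (openCone τ p T))) :
    ∀ᵐ z ∂volume.restrict (openCone τ p T), inner ℝ (v z) (vt z) = 0 := by
  set O := openCone τ p T with hO
  obtain ⟨f, hf, hfe⟩ := hvt.1
  have hfint : IntegrableOn f O := hvt.congr hfe
  obtain ⟨a, ha, hae⟩ := (hv.memLp_v_slice (s := 0) (t := 0) ⟨le_rfl, hT.le⟩ le_rfl).1
  set V : SpaceTime → E3 := fun z => a z.2 + ∫ s in Ioo 0 z.1, f (s, z.2) with hVdef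
  have hVm : StronglyMeasurable V :=
    (ha.comp_measurable measurable_snd).add (stronglyMeasurable_time_primitive hf)
  have hA : ∀ t ∈ Ioo 0 T, ∀ᵐ x ∂volume.restrict (disk τ p t), v (t, x) = V (t, x) := by
    intro t ht
    filter_upwards [hv.eq_add_integral hvt ⟨ht.1, ht.2.le⟩, ae_ae_of_ae_openCone ht.2.le hfe,
      ae_restrict_of_ae_restrict_of_subset (disk_anti τ p ht.1.le) hae] with x h1 h2 h3
    simp only [hVdef]
    rw [h1, h3, integral_congr_ae h2]
  have hvV : v =ᵐ[volume.restrict O] V := by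
    refine ae_openCone_eq_of_ae_disk hv.aestronglyMeasurable_v hVm.aestronglyMeasurable ?_
    rw [ae_restrict_iff' measurableSet_Ioo]
    exact Eventually.of_forall hA
  have hC : ∀ᵐ x : E3, ∀ᵐ s : ℝ, (s, x) ∈ O → inner ℝ (V (s, x)) (f (s, x)) = 0 := by
    have h1 : ∀ q : ℚ, ∀ᵐ x : E3, (q : ℝ) ∈ Ioo 0 T → x ∈ disk τ p q →
        ‖V (q, x)‖ = 1 ∧ IntegrableOn (fun s => f (s, x)) (Ioo 0 (q : ℝ)) := by
      intro q
      by_cases hq : (q : ℝ) ∈ Ioo 0 T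
      · have h2 := (integrable_prod_of_openCone hq.2.le hfint).prod_left_ae
        have h3 := hA q hq
        have h4 := hv.norm_eq_one_slice (Ioo_subset_Icc_self hq)
        rw [ae_restrict_iff' (measurableSet_disk τ p q)] at h2 h3 h4
        filter_upwards [h2, h3, h4] with x h2 h3 h4 _ hx
        exact ⟨by rw [← h3 hx]; exact h4 hx, h2 hx⟩
      · exact Eventually.of_forall fun x h => absurd h hq
    filter_upwards [ae_all_iff.2 h1] with x hx
    have h2 : ∀ q : ℚ, ∀ᵐ s : ℝ, (q : ℝ) ∈ Ioo 0 T → x ∈ disk τ p q → s ∈ Ioo 0 (q : ℝ) →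
        inner ℝ (V (s, x)) (f (s, x)) = 0 := by
      intro q
      by_cases hq : (q : ℝ) ∈ Ioo 0 T ∧ x ∈ disk τ p q
      · have h3 := inner_primitive_eq_zero (f := fun s => f (s, x)) (a := a x) hq.1.1
          (hx q hq.1 hq.2).2 fun r hr => (hx r ⟨hr.1, hr.2.trans hq.1.2⟩
            (disk_anti τ p hr.2.le hq.2)).1
        rw [ae_restrict_iff' measurableSet_Ioo] at h3
        filter_upwards [h3] with s h3 _ _ hs using h3 hs
      · exact Eventually.of_forall fun s h h' => absurd ⟨h, h'⟩ hq
    filter_upwards [ae_all_iff.2 h2] with s hs hsx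
    have h3 : s < min T (τ - dist x p) := lt_min hsx.1.2 (by
      have : dist x p < τ - s := hsx.2
      linarith)
    obtain ⟨q, hq1, hq2⟩ := exists_rat_btwn h3
    refine hs q ⟨hsx.1.1.trans hq1, hq2.trans_le (min_le_left _ _)⟩ ?_ ⟨hsx.1.1, hq1⟩
    have := hq2.trans_le (min_le_right _ _)
    change dist x p < τ - q
    linarith
  have hmeas : MeasurableSet {z : ℝ × E3 | (z.1, z.2) ∈ O →
      inner ℝ (V (z.1, z.2)) (f (z.1, z.2)) = 0} := by
    have h1 : Measurable fun z : SpaceTime => inner ℝ (V z) (f z) := (hVm.inner hf).measurable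
    have h2 : MeasurableSet {z : SpaceTime | inner ℝ (V z) (f z) = 0} :=
      h1 (measurableSet_singleton 0)
    have h3 := (measurableSet_openCone τ p T).compl.union h2
    convert h3 using 1
    ext z
    simp only [mem_ofPred_eq, mem_union, mem_compl_iff, imp_iff_not_or, Prod.mk.eta, hO]
  have hD : ∀ᵐ s : ℝ, ∀ᵐ x : E3, (s, x) ∈ O → inner ℝ (V (s, x)) (f (s, x)) = 0 :=
    (Measure.ae_ae_comm hmeas).2 hC
  have hE : (fun z => inner ℝ (V z) (f z)) =ᵐ[volume.restrict O] fun _ => (0 : ℝ) := by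
    refine ae_openCone_eq_of_ae_disk (hVm.inner hf).aestronglyMeasurable
      aestronglyMeasurable_const ?_
    rw [ae_restrict_iff' measurableSet_Ioo]
    filter_upwards [hD] with s hs hsT
    rw [ae_restrict_iff' (measurableSet_disk τ p s)]
    filter_upwards [hs] with x hx hxd using hx ⟨hsT, hxd⟩
  filter_upwards [hvV, hfe, hE] with z h1 h2 h3
  rw [h1, h2, h3]

end Orthogonality

section Distance

variable {τ T : ℝ} {p : E3} {v vt u : SpaceTime → E3} {dv : Fin 3 → SpaceTime → E3}

theorem sq_integral_le {t : ℝ} (ht : 0 < t) {g : ℝ → ℝ} (hg : IntegrableOn g (Ioo 0 t))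
    (hg2 : IntegrableOn (fun s => g s ^ 2) (Ioo 0 t)) :
    (∫ s in Ioo 0 t, g s) ^ 2 ≤ t * ∫ s in Ioo 0 t, g s ^ 2 := by
  set I := ∫ s in Ioo 0 t, g s with hI
  have h0 : 0 ≤ ∫ s in Ioo 0 t, (t * g s - I) ^ 2 := integral_nonneg fun s => sq_nonneg _
  have h1 : ∫ s in Ioo 0 t, (t * g s - I) ^ 2 =
      t ^ 2 * (∫ s in Ioo 0 t, g s ^ 2) - t * I ^ 2 := by
    have e : ∀ s, (t * g s - I) ^ 2 = t ^ 2 * g s ^ 2 - 2 * t * I * g s + I ^ 2 := fun s => by ring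
    have J1 : IntegrableOn (fun s => t ^ 2 * g s ^ 2) (Ioo 0 t) := hg2.const_mul _
    have J2 : IntegrableOn (fun s => 2 * t * I * g s) (Ioo 0 t) := hg.const_mul _
    have J3 : IntegrableOn (fun s => t ^ 2 * g s ^ 2 - 2 * t * I * g s) (Ioo 0 t) := J1.sub J2
    simp only [e]
    rw [integral_add J3 (integrable_const _), integral_sub J1 J2, integral_const_mul,
      integral_const_mul, ← hI]
    simp [ht.le]
    ring
  rw [h1] at h0
  have h2 : 0 ≤ t * (t * (∫ s in Ioo 0 t, g s ^ 2) - I ^ 2) := by linarith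
  have h3 := nonneg_of_mul_nonneg_right h2 ht
  linarith

theorem sub_eq_integral_timeDeriv (hu : ContDiff ℝ ∞ u) {t : ℝ} (ht : 0 ≤ t) (x : E3) :
    u (t, x) - u (0, x) = ∫ s in Ioo 0 t, timeDeriv u (s, x) := by
  have h1 : ∀ s, HasDerivAt (fun s => u (s, x)) (timeDeriv u (s, x)) s := fun s =>
    (hu.differentiable (by simp) (s, x)).hasFDerivAt.comp_hasDerivAt s
      ((hasDerivAt_id s).prodMk (hasDerivAt_const s x))
  have h2 : Continuous fun s : ℝ => timeDeriv u (s, x) :=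
    (contDiff_timeDeriv hu).continuous.comp (Continuous.prodMk_left x)
  rw [← integral_Ioc_eq_integral_Ioo, ← intervalIntegral.integral_of_le ht,
    intervalIntegral.integral_eq_sub_of_hasDerivAt (fun s _ => h1 s) (h2.intervalIntegrable _ _)]

/-- If `v` and `u` agree at time `0`, the `L²` distance of `v` and `u` at time `t` is controlled by
the `L²` norm of `∂ₜ(v - u)` on the cone. -/
theorem IsWeakWaveMapOn.integral_norm_sub_sq_le
    (hv : IsWeakWaveMapOn (truncCone τ p T) v vt dv)
    (hvt : MemLp vt 2 (volume.restrict (openCone τ p T))) (hu : ContDiff ℝ ∞ u)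
    (h0 : ∀ᵐ x ∂volume.restrict (disk τ p 0), v (0, x) = u (0, x)) {t : ℝ} (ht : t ∈ Ioc 0 T) :
    ∫ x in disk τ p t, ‖v (t, x) - u (t, x)‖ ^ 2 ≤
      t * ∫ z in openCone τ p t, ‖vt z - timeDeriv u z‖ ^ 2 := by
  have hut := (contDiff_timeDeriv hu).continuous
  have hutL : MemLp (timeDeriv u) 2 (volume.restrict (openCone τ p T)) :=
    (memLp_two_iff_integrable_sq_norm hut.aestronglyMeasurable).2
      (integrableOn_openCone_of_continuous (hut.norm.pow 2))
  have hw : MemLp (fun z => vt z - timeDeriv u z) 2 (volume.restrict (openCone τ p T)) :=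
    hvt.sub hutL
  have hw2 : IntegrableOn (fun z => ‖vt z - timeDeriv u z‖ ^ 2) (openCone τ p T) :=
    (memLp_two_iff_integrable_sq_norm hw.1).1 hw
  have hw1 : IntegrableOn (fun z => vt z - timeDeriv u z) (openCone τ p T) :=
    integrable_of_memLp_two hw
  have P1 := integrable_prod_of_openCone ht.2 hw1
  have P2 := integrable_prod_of_openCone ht.2 hw2
  have P3 := integrable_prod_of_openCone ht.2 (integrable_of_memLp_two hvt)
  have hpt : ∀ᵐ x ∂volume.restrict (disk τ p t), ‖v (t, x) - u (t, x)‖ ^ 2 ≤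
      t * ∫ s in Ioo 0 t, ‖vt (s, x) - timeDeriv u (s, x)‖ ^ 2 := by
    filter_upwards [hv.eq_add_integral (integrable_of_memLp_two hvt) ht,
      ae_restrict_of_ae_restrict_of_subset (disk_anti τ p ht.1.le) h0, P1.prod_left_ae,
      P2.prod_left_ae, P3.prod_left_ae] with x h1 h2 h3 h4 h5
    have h6 : v (t, x) - u (t, x) = ∫ s in Ioo 0 t, (vt (s, x) - timeDeriv u (s, x)) := by
      have h7 : IntegrableOn (fun s => timeDeriv u (s, x)) (Ioo 0 t) :=
        ((hut.comp (Continuous.prodMk_left x)).continuousOn.integrableOn_compact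
          isCompact_Icc).mono_set Ioo_subset_Icc_self
      rw [integral_sub h5 h7, ← sub_eq_integral_timeDeriv hu ht.1.le, h1, h2]
      abel
    rw [h6]
    refine le_trans ?_ (sq_integral_le ht.1 h3.norm h4)
    gcongr
    exact norm_integral_le_integral_norm _
  have hI : IntegrableOn (fun x => ∫ s in Ioo 0 t, ‖vt (s, x) - timeDeriv u (s, x)‖ ^ 2)
      (disk τ p t) := P2.integral_prod_right
  calc ∫ x in disk τ p t, ‖v (t, x) - u (t, x)‖ ^ 2
      ≤ ∫ x in disk τ p t, t * ∫ s in Ioo 0 t, ‖vt (s, x) - timeDeriv u (s, x)‖ ^ 2 :=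
        integral_mono_of_nonneg (Eventually.of_forall fun x => by positivity) (hI.const_mul t) hpt
    _ = t * ∫ z in Ioo 0 t ×ˢ disk τ p t, ‖vt z - timeDeriv u z‖ ^ 2 := by
        rw [integral_const_mul, Measure.volume_eq_prod, ← Measure.prod_restrict,
          integral_prod_symm _ P2]
    _ ≤ t * ∫ z in openCone τ p t, ‖vt z - timeDeriv u z‖ ^ 2 := by
        refine mul_le_mul_of_nonneg_left (setIntegral_mono_set
          (hw2.mono_set (openCone_subset_openCone τ p ht.2))
          (Eventually.of_forall fun z => by positivity)
          (Ioo_prod_disk_subset τ p le_rfl).eventuallyLE) ht.1.le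

end Distance

/-! ### Continuity of the relative energy -/

section SliceContinuity

/-- Young's inequality for the `L²` inner product. -/
theorem abs_integral_inner_le {X : Type*} [MeasurableSpace X] {μ : Measure X} {w b : X → E3}
    (hw : MemLp w 2 μ) (hb : MemLp b 2 μ) {δ : ℝ} (hδ : 0 < δ) :
    |∫ x, inner ℝ (w x) (b x) ∂μ| ≤
      δ / 2 * (∫ x, ‖w x‖ ^ 2 ∂μ) + 1 / (2 * δ) * ∫ x, ‖b x‖ ^ 2 ∂μ := by
  have hw2 := (memLp_two_iff_integrable_sq_norm hw.1).1 hw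
  have hb2 := (memLp_two_iff_integrable_sq_norm hb.1).1 hb
  rw [← integral_const_mul, ← integral_const_mul,
    ← integral_add (hw2.const_mul _) (hb2.const_mul _), ← Real.norm_eq_abs]
  refine norm_integral_le_of_norm_le ((hw2.const_mul _).add (hb2.const_mul _))
    (Eventually.of_forall fun x => (norm_inner_le_norm _ _).trans ?_)
  have h1 := div_nonneg (sq_nonneg (δ * ‖w x‖ - ‖b x‖)) (by positivity : (0 : ℝ) ≤ 2 * δ)
  have h2 : (δ * ‖w x‖ - ‖b x‖) ^ 2 / (2 * δ) =
      δ / 2 * ‖w x‖ ^ 2 + 1 / (2 * δ) * ‖b x‖ ^ 2 - ‖w x‖ * ‖b x‖ := by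
    field_simp
    ring
  linarith

theorem volume_real_disk {τ s : ℝ} (p : E3) (hs : s ≤ τ) :
    volume.real (disk τ p s) = (τ - s) ^ 3 * volume.real (Metric.ball (0 : E3) 1) := by
  rw [disk, Measure.real, Measure.addHaar_ball _ _ (sub_nonneg.2 hs), ENNReal.toReal_mul,
    ENNReal.toReal_ofReal (by have := sub_nonneg.2 hs; positivity)]
  simp [Measure.real]

variable {τ t : ℝ} {p : E3} {w a : SpaceTime → E3}

theorem memLp_slice_of_continuous (ha : Continuous a) {C : ℝ} (hC : ∀ z, ‖a z‖ ≤ C) (s s' : ℝ) :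
    MemLp (fun x => a (s', x)) 2 (volume.restrict (disk τ p s)) :=
  MemLp.of_bound (ha.comp (by fun_prop : Continuous fun x : E3 => (s', x))).aestronglyMeasurable C
    (Eventually.of_forall fun x => hC _)

/-- If `a` varies little between the times `s` and `s'`, and the disks at the times `s ≤ s₀` differ
by little, then `a(s)` may be replaced by `a(s')`, restricted to the smaller disk. -/
theorem abs_integral_disk_sub_le (ha : Continuous a) {C : ℝ} (hC : ∀ z, ‖a z‖ ≤ C)
    {s s' s₀ M δ r : ℝ} (hss : s ≤ s₀) (h0s : 0 ≤ s)
    (hw : MemLp (fun x => w (s, x)) 2 (volume.restrict (disk τ p s)))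
    (hM : ∫ x in disk τ p s, ‖w (s, x)‖ ^ 2 ≤ M) (hδ : 0 < δ)
    (har : ∀ x, ‖a (s, x) - a (s', x)‖ ≤ r)
    (hvr : volume.real (disk τ p s) - volume.real (disk τ p s₀) ≤ r) :
    |(∫ x in disk τ p s, inner ℝ (w (s, x)) (a (s, x))) -
      ∫ x in disk τ p s₀, inner ℝ (w (s, x)) (a (s', x))| ≤
      δ / 2 * M + 1 / (2 * δ) * (r ^ 2 * volume.real (disk τ p 0) + C ^ 2 * r) := by
  have hsub : disk τ p s₀ ⊆ disk τ p s := disk_anti τ p hss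
  have hm := measurableSet_disk τ p s₀
  have h1 : MemLp (fun x => a (s, x)) 2 (volume.restrict (disk τ p s)) :=
    memLp_slice_of_continuous ha hC s s
  have h2 : MemLp ((disk τ p s₀).indicator fun x => a (s', x)) 2
      (volume.restrict (disk τ p s)) := (memLp_slice_of_continuous ha hC s s').indicator hm
  have h3 : ∫ x in disk τ p s₀, inner ℝ (w (s, x)) (a (s', x)) =
      ∫ x in disk τ p s, inner ℝ (w (s, x)) ((disk τ p s₀).indicator (fun x => a (s', x)) x) := by
    rw [← inter_eq_self_of_subset_right hsub, ← setIntegral_indicator hm,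
      inter_eq_self_of_subset_right hsub]
    refine integral_congr_ae (Eventually.of_forall fun x => ?_)
    by_cases hx : x ∈ disk τ p s₀ <;> simp [hx]
  rw [h3, ← integral_sub (integrable_inner_of_memLp hw h1) (integrable_inner_of_memLp hw h2)]
  simp only [← inner_sub_right]
  refine (abs_integral_inner_le hw (h1.sub h2) hδ).trans ?_
  have h4 : ∫ x in disk τ p s, ‖a (s, x) - (disk τ p s₀).indicator (fun x => a (s', x)) x‖ ^ 2 ≤
      ∫ x in disk τ p s, (r ^ 2 + (disk τ p s₀)ᶜ.indicator (fun _ => C ^ 2) x) := by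
    refine integral_mono ((memLp_two_iff_integrable_sq_norm (h1.sub h2).1).1 (h1.sub h2))
      ((integrable_const _).add ((integrable_const _).indicator hm.compl)) fun x => ?_
    by_cases hx : x ∈ disk τ p s₀
    · simp only [hx, indicator_of_mem, mem_compl_iff, not_true_eq_false, not_false_eq_true,
        indicator_of_notMem, add_zero]
      gcongr
      exact har x
    · have hC' : ‖a (s, x)‖ ^ 2 ≤ C ^ 2 := by gcongr; exact hC _
      simp only [hx, not_false_eq_true, indicator_of_notMem, sub_zero, mem_compl_iff,
        indicator_of_mem]
      linarith [sq_nonneg r]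
  have hfin : ∀ s, volume (disk τ p s) ≠ ⊤ := fun s => measure_ball_lt_top.ne
  have h5 : ∫ x in disk τ p s, (r ^ 2 + (disk τ p s₀)ᶜ.indicator (fun _ => C ^ 2) x) =
      r ^ 2 * volume.real (disk τ p s) +
        C ^ 2 * (volume.real (disk τ p s) - volume.real (disk τ p s₀)) := by
    rw [integral_add (integrable_const _) ((integrable_const _).indicator hm.compl),
      setIntegral_indicator hm.compl, setIntegral_const, setIntegral_const, ← Set.sdiff_eq,
      measureReal_sdiff hsub hm (hfin _), smul_eq_mul, smul_eq_mul, mul_comm (r ^ 2), mul_comm (C ^ 2)]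
  have h6 : volume.real (disk τ p s) ≤ volume.real (disk τ p 0) :=
    measureReal_mono (disk_anti τ p h0s) (hfin _)
  have h7 : (∫ x in disk τ p s, ‖a (s, x) - (disk τ p s₀).indicator (fun x => a (s', x)) x‖ ^ 2) ≤
      r ^ 2 * volume.real (disk τ p 0) + C ^ 2 * r := by
    refine h4.trans (h5.le.trans ?_)
    gcongr
  gcongr
  exact h7

/-- If `w` is weakly continuous on each fixed disk, with bounded `L²` norms, then its pairing with
`a` over the shrinking disks is continuous. -/
theorem continuousOn_integral_disk_inner (ha : Continuous a) (hac : HasCompactSupport a)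
    (htτ : t ≤ τ) {M : ℝ}
    (hw : ∀ s ∈ Icc 0 t, MemLp (fun x => w (s, x)) 2 (volume.restrict (disk τ p s)))
    (hM : ∀ s ∈ Icc 0 t, ∫ x in disk τ p s, ‖w (s, x)‖ ^ 2 ≤ M)
    (hwc : ∀ s₀ ∈ Icc 0 t, ∀ s' : ℝ, ContinuousOn
      (fun s => ∫ x in disk τ p s₀, inner ℝ (w (s, x)) (a (s', x))) (Icc 0 s₀)) :
    ContinuousOn (fun s => ∫ x in disk τ p s, inner ℝ (w (s, x)) (a (s, x))) (Icc 0 t) := by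
  obtain ⟨C, -, hC⟩ := exists_norm_le_of_hasCompactSupport ha hac
  intro t₀ ht₀
  have hM0 : 0 ≤ M := (integral_nonneg fun x => sq_nonneg _).trans (hM t₀ ht₀)
  rw [ContinuousWithinAt, Metric.tendsto_nhds]
  intro ε hε
  set V := volume.real (disk τ p 0) with hV
  have hV0 : 0 ≤ V := measureReal_nonneg
  -- `δ` makes the term with the norm of `w` small, then `r` makes the term with the norm of the
  -- change of `a` small.
  set δ := ε / (4 * (M + 1)) with hδd
  have hδ : 0 < δ := by positivity
  set r := min 1 (δ * ε / (4 * (V + C ^ 2 + 1))) with hr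
  have hr0 : 0 < r := by positivity
  have hsmall : δ / 2 * M + 1 / (2 * δ) * (r ^ 2 * V + C ^ 2 * r) ≤ ε / 4 := by
    have h1 : δ * (M + 1) = ε / 4 := by rw [hδd]; field_simp
    have h2 : r * (V + C ^ 2 + 1) ≤ δ * ε / 4 := by
      calc r * (V + C ^ 2 + 1) ≤ δ * ε / (4 * (V + C ^ 2 + 1)) * (V + C ^ 2 + 1) := by
            gcongr; exact min_le_right _ _
        _ = _ := by field_simp
    have h3 : r ^ 2 * V ≤ r * V := by
      have : r ≤ 1 := min_le_left _ _
      nlinarith [mul_nonneg hr0.le hV0]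
    have h4 : 1 / (2 * δ) * (r ^ 2 * V + C ^ 2 * r) ≤ 1 / (2 * δ) * (δ * ε / 4) := by
      gcongr; nlinarith
    have h5 : 1 / (2 * δ) * (δ * ε / 4) = ε / 8 := by field_simp; norm_num
    nlinarith
  obtain ⟨d₁, hd₁, h₁⟩ := Metric.uniformContinuous_iff.1 
    (hac.uniformContinuous_of_continuous ha) r hr0
  have hvc : ContinuousOn (fun s => volume.real (disk τ p s)) (Icc 0 t) := by
    refine (Continuous.continuousOn (f := fun s => (τ - s) ^ 3 *
      volume.real (Metric.ball (0 : E3) 1)) (by fun_prop)).congr fun s hs => ?_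
    exact volume_real_disk p (hs.2.trans htτ)
  obtain ⟨d₂, hd₂, h₂⟩ := Metric.uniformContinuousOn_iff.1
    (isCompact_Icc.uniformContinuousOn_of_continuous hvc) r hr0
  set d := min d₁ d₂ with hd
  have hd0 : 0 < d := lt_min hd₁ hd₂
  have key : ∀ s₀ ∈ Icc 0 t, ∀ s ∈ Icc 0 s₀, s₀ - s < d → |s - t₀| < d →
      |(∫ x in disk τ p s, inner ℝ (w (s, x)) (a (s, x))) -
        ∫ x in disk τ p s₀, inner ℝ (w (s, x)) (a (t₀, x))| ≤ ε / 4 := by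
    intro s₀ hs₀ s hs h3 h4
    have hst : s ∈ Icc 0 t := ⟨hs.1, hs.2.trans hs₀.2⟩
    refine (abs_integral_disk_sub_le ha hC hs.2 hs.1 (hw s hst) (hM s hst) hδ
      (fun x => ?_) ?_).trans hsmall
    · rw [← dist_eq_norm]
      refine (h₁ ?_).le
      rw [Prod.dist_eq, dist_self, Real.dist_eq, max_eq_left (abs_nonneg _)]
      exact h4.trans_le (min_le_left _ _)
    · have h5 := h₂ s hst s₀ hs₀ (by
        rw [Real.dist_eq, abs_sub_comm, abs_of_nonneg (sub_nonneg.2 hs.2)]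
        exact h3.trans_le (min_le_right _ _))
      exact (le_abs_self _).trans h5.le
  -- The fixed disk belongs to a time `s₀` slightly after `t₀`, such that it is contained in the
  -- disks of all times near `t₀`; only for `t₀ = t` it is `s₀ = t`.
  obtain ⟨s₀, hs₀⟩ : ∃ s₀, s₀ = min t (t₀ + d / 2) := ⟨_, rfl⟩
  have hs₀t : s₀ ∈ Icc 0 t := ⟨by rw [hs₀]; exact le_min (ht₀.1.trans ht₀.2) (by linarith [ht₀.1]),
    by rw [hs₀]; exact min_le_left _ _⟩
  have ht₀s₀ : t₀ ≤ s₀ := by rw [hs₀]; exact le_min ht₀.2 (by linarith)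
  have hs₀d : s₀ ≤ t₀ + d / 2 := by rw [hs₀]; exact min_le_right _ _
  have hlim := Metric.tendsto_nhds.1 (hwc s₀ hs₀t t₀ t₀ ⟨ht₀.1, ht₀s₀⟩) (ε / 4) (by positivity)
  have hle : ∀ᶠ s in 𝓝[Icc 0 t] t₀, s ≤ s₀ := by
    filter_upwards [self_mem_nhdsWithin, mem_nhdsWithin_of_mem_nhds
      (Iic_mem_nhds (show t₀ < t₀ + d / 2 by linarith))] with s h3 h4
    rw [hs₀]
    exact le_min h3.2 h4
  have hnear : ∀ᶠ s in 𝓝[Icc 0 t] t₀, |s - t₀| < d / 2 :=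
    mem_nhdsWithin_of_mem_nhds (Metric.ball_mem_nhds t₀ (by positivity))
  have hlim' : ∀ᶠ s in 𝓝[Icc 0 t] t₀, s ≤ s₀ →
      dist (∫ x in disk τ p s₀, inner ℝ (w (s, x)) (a (t₀, x)))
        (∫ x in disk τ p s₀, inner ℝ (w (t₀, x)) (a (t₀, x))) < ε / 4 := by
    rw [eventually_nhdsWithin_iff] at hlim ⊢
    filter_upwards [hlim] with s h3 h4 h5 using h3 ⟨h4.1, h5⟩
  filter_upwards [self_mem_nhdsWithin, hle, hnear, hlim'] with s h3 h4 h5 h6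
  have h7 := key s₀ hs₀t s ⟨h3.1, h4⟩ (by linarith [abs_lt.1 h5]) (by linarith)
  have h8 := key s₀ hs₀t t₀ ⟨ht₀.1, ht₀s₀⟩ (by linarith) (by simpa using hd0)
  have h9 := h6 h4
  rw [Real.dist_eq] at h9 ⊢
  rw [abs_le] at h7 h8
  rw [abs_lt] at h9 ⊢
  constructor <;> linarith

variable {T : ℝ} {v vt u : SpaceTime → E3} {dv : Fin 3 → SpaceTime → E3}

/-- Twice the energy density, `|∂ₜv|² + |∇v|²`. -/
noncomputable def energyDensity (vt : SpaceTime → E3) (dv : Fin 3 → SpaceTime → E3)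
    (z : SpaceTime) : ℝ :=
  ‖vt z‖ ^ 2 + ∑ i, ‖dv i z‖ ^ 2

theorem energyDensity_nonneg (vt : SpaceTime → E3) (dv : Fin 3 → SpaceTime → E3)
    (z : SpaceTime) : 0 ≤ energyDensity vt dv z := by
  unfold energyDensity
  positivity

theorem integrable_energyDensity {s : ℝ}
    (hvt : MemLp (fun x => vt (s, x)) 2 (volume.restrict (disk τ p s)))
    (hdv : ∀ i, MemLp (fun x => dv i (s, x)) 2 (volume.restrict (disk τ p s))) :
    Integrable (fun x => energyDensity vt dv (s, x)) (volume.restrict (disk τ p s)) :=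
  ((memLp_two_iff_integrable_sq_norm hvt.1).1 hvt).add (integrable_finsetSum _ fun i _ =>
    (memLp_two_iff_integrable_sq_norm (hdv i).1).1 (hdv i))

theorem toReal_energy {s : ℝ}
    (hvt : MemLp (fun x => vt (s, x)) 2 (volume.restrict (disk τ p s)))
    (hdv : ∀ i, MemLp (fun x => dv i (s, x)) 2 (volume.restrict (disk τ p s))) :
    (energy τ p s vt dv).toReal = 1 / 2 * ∫ x in disk τ p s, energyDensity vt dv (s, x) := by
  rw [energy, ENNReal.toReal_mul, ENNReal.toReal_ofReal (by norm_num),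
    integral_eq_lintegral_of_nonneg_ae (Eventually.of_forall fun x => energyDensity_nonneg _ _ _)
      (integrable_energyDensity hvt hdv).1]
  congr 3
  funext x
  rw [energyDensity, ENNReal.ofReal_add (by positivity) (by positivity),
    ENNReal.ofReal_sum_of_nonneg fun i _ => by positivity]
  simp only [ENNReal.ofReal_pow (norm_nonneg _), ofReal_norm]

/-- The relative energy density is the energy density of `v - u` minus that of `v`. -/
theorem relEnergy_eq (vt : SpaceTime → E3) (dv : Fin 3 → SpaceTime → E3) (u : SpaceTime → E3)
    (z : SpaceTime) : relEnergy vt dv u z =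
      1 / 2 * energyDensity (fun z => vt z - timeDeriv u z)
        (fun i z => dv i z - spaceDeriv i u z) z - 1 / 2 * energyDensity vt dv z := by
  simp only [relEnergy, crossEnergy, energyDensity, Fin.sum_univ_three,
    norm_sub_sq_real, real_inner_self_eq_norm_sq]
  ring

theorem integral_norm_sq_le_of_energy_le {s : ℝ} {E0 : ENNReal} (hE0 : E0 ≠ ⊤)
    (hvt : MemLp (fun x => vt (s, x)) 2 (volume.restrict (disk τ p s)))
    (hdv : ∀ i, MemLp (fun x => dv i (s, x)) 2 (volume.restrict (disk τ p s)))
    (hE : energy τ p s vt dv ≤ E0) :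
    (∫ x in disk τ p s, ‖vt (s, x)‖ ^ 2) ≤ 2 * E0.toReal ∧
      ∀ i, (∫ x in disk τ p s, ‖dv i (s, x)‖ ^ 2) ≤ 2 * E0.toReal := by
  have h1 := ENNReal.toReal_mono hE0 hE
  rw [toReal_energy hvt hdv] at h1
  have h2 := integrable_energyDensity hvt hdv
  refine ⟨?_, fun i => ?_⟩
  · refine (integral_mono ((memLp_two_iff_integrable_sq_norm hvt.1).1 hvt) h2 fun x => ?_).trans
      (by linarith)
    exact le_add_of_nonneg_right (by positivity)
  · refine (integral_mono ((memLp_two_iff_integrable_sq_norm (hdv i).1).1 (hdv i)) h2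
      fun x => ?_).trans (by linarith)
    exact (Finset.single_le_sum (f := fun i => ‖dv i (s, x)‖ ^ 2) (fun i _ => by positivity)
      (Finset.mem_univ i)).trans (le_add_of_nonneg_left (by positivity))

theorem continuousOn_integral_disk_inner_self (ha : Continuous a) (hac : HasCompactSupport a)
    (htτ : t ≤ τ) :
    ContinuousOn (fun s => ∫ x in disk τ p s, inner ℝ (a (s, x)) (a (s, x))) (Icc 0 t) := by
  obtain ⟨C, hC0, hC⟩ := exists_norm_le_of_hasCompactSupport ha hac
  refine continuousOn_integral_disk_inner ha hac htτ (M := C ^ 2 * volume.real (disk τ p 0))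
    (fun s _ => memLp_slice_of_continuous ha hC s s) (fun s hs => ?_) fun s₀ _ s' =>
    Continuous.continuousOn ?_
  · have h1 := memLp_slice_of_continuous (τ := τ) (p := p) ha hC s s
    calc ∫ x in disk τ p s, ‖a (s, x)‖ ^ 2 ≤ ∫ x in disk τ p s, C ^ 2 :=
          integral_mono ((memLp_two_iff_integrable_sq_norm h1.1).1 h1) (integrable_const _)
            fun x => by
              have := hC (s, x)
              dsimp only
              gcongr
      _ = C ^ 2 * volume.real (disk τ p s) := by
          rw [setIntegral_const, smul_eq_mul, mul_comm]
      _ ≤ _ := by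
          have hfin : volume (disk τ p 0) ≠ ⊤ := measure_ball_lt_top.ne
          exact mul_le_mul_of_nonneg_left (measureReal_mono (disk_anti τ p hs.1) hfin)
            (sq_nonneg C)
  · refine continuous_of_dominated (bound := fun _ => C * C) (fun s => ?_)
      (fun s => Eventually.of_forall fun x => ?_) (integrable_const _)
      (Eventually.of_forall fun x => ?_)
    · exact (by fun_prop : Continuous fun x => inner ℝ (a (s, x)) (a (s', x))).aestronglyMeasurable
    · exact (norm_inner_le_norm _ _).trans (mul_le_mul (hC _) (hC _) (norm_nonneg _) hC0)
    · fun_prop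

/-- The relative energy of the time slices depends continuously on the time: its smooth part
obviously does, and the mixed part by the weak continuity of the derivatives of `v`. -/
theorem IsWeakWaveMapOn.continuousOn_integral_relEnergy
    (hv : IsWeakWaveMapOn (truncCone τ p T) v vt dv) (hu : ContDiff ℝ ∞ u)
    (huc : HasCompactSupport u) {E0 : ENNReal} (hE0 : E0 ≠ ⊤) (htT : t ≤ T) (hTτ : T ≤ τ)
    (hE : ∀ s ∈ Icc 0 t, energy τ p s vt dv ≤ E0) :
    ContinuousOn (fun s => ∫ x in disk τ p s, relEnergy vt dv u (s, x)) (Icc 0 t) := by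
  have hT : IsTestOn univ u := ⟨hu, huc, by simp⟩
  have hsT : ∀ s ∈ Icc 0 t, s ∈ Icc 0 T := fun s hs => ⟨hs.1, hs.2.trans htT⟩
  have hvt := fun s hs => hv.memLp_vt_slice (hsT s hs) le_rfl
  have hdv := fun i s hs => hv.memLp_dv_slice i (hsT s hs) le_rfl
  have hB := fun s hs => integral_norm_sq_le_of_energy_le hE0 (hvt s hs) (fun i => hdv i s hs)
    (hE s hs)
  have htimes : ∀ s₀ ∈ Icc 0 t, Icc 0 s₀ ⊆ timesOf (truncCone τ p T) (disk τ p s₀) :=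
    fun s₀ hs₀ s hs => mem_timesOf_truncCone τ p ⟨hs.1, hs.2.trans (hs₀.2.trans htT)⟩ hs.2
  have hm := measurableSet_disk τ p
  obtain ⟨C, -, hC⟩ := hT.timeDeriv.exists_norm_le
  choose Ci _ hCi using fun i => (hT.spaceDeriv i).exists_norm_le
  have htτ := htT.trans hTτ
  have a1 := hT.timeDeriv.1.continuous
  have a2 := fun i => (hT.spaceDeriv i).1.continuous
  have c1 := continuousOn_integral_disk_inner a1 hT.timeDeriv.2.1
    htτ hvt (fun s hs => (hB s hs).1) fun s₀ hs₀ s' =>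
      ((hv.continuous_vt _ (hm s₀)).2 _ (memLp_slice_of_continuous a1 hC s₀ s')).mono
        (htimes s₀ hs₀)
  have c2 := fun i => continuousOn_integral_disk_inner (a2 i) (hT.spaceDeriv i).2.1
    htτ (hdv i) (fun s hs => (hB s hs).2 i) fun s₀ hs₀ s' =>
      ((hv.continuous_dv _ (hm s₀) i).2 _ (memLp_slice_of_continuous (a2 i) (hCi i) s₀ s')).mono
        (htimes s₀ hs₀)
  have c3 := continuousOn_integral_disk_inner_self (p := p) a1 hT.timeDeriv.2.1 htτ
  have c4 := fun i =>
    continuousOn_integral_disk_inner_self (p := p) (a2 i) (hT.spaceDeriv i).2.1 htτ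
  refine (((c3.add (continuousOn_finsetSum Finset.univ fun i _ => c4 i)).const_mul (1 / 2)).sub
    (c1.add (continuousOn_finsetSum Finset.univ fun i _ => c2 i))).congr fun s hs => ?_
  have m1 := memLp_slice_of_continuous (τ := τ) (p := p) a1 hC s s
  have m2 := fun i => memLp_slice_of_continuous (τ := τ) (p := p) (a2 i) (hCi i) s s
  have i1 := integrable_inner_of_memLp (hvt s hs) m1
  have i2 := fun i => integrable_inner_of_memLp (hdv i s hs) (m2 i)
  have i3 := integrable_inner_of_memLp m1 m1
  have i4 := fun i => integrable_inner_of_memLp (m2 i) (m2 i)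
  have i5 : Integrable (fun x => ∑ i, inner ℝ (dv i (s, x)) (spaceDeriv i u (s, x)))
    (volume.restrict (disk τ p s)) := integrable_finsetSum _ fun i _ => i2 i
  have i6 : Integrable (fun x => ∑ i, inner ℝ (spaceDeriv i u (s, x)) (spaceDeriv i u (s, x)))
    (volume.restrict (disk τ p s)) := integrable_finsetSum _ fun i _ => i4 i
  have i7 : Integrable (fun x => crossEnergy vt dv u (s, x)) (volume.restrict (disk τ p s)) :=
    i1.add i5
  have i8 : Integrable (fun x => crossEnergy (timeDeriv u) (fun i => spaceDeriv i u) u (s, x))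
    (volume.restrict (disk τ p s)) := i3.add i6
  simp only [relEnergy]
  rw [integral_sub (i8.const_mul _) i7, integral_const_mul]
  simp only [crossEnergy]
  rw [integral_add i1 i5, integral_add i3 i6, integral_finsetSum _ fun i _ => i2 i,
    integral_finsetSum _ fun i _ => i4 i]
  rfl

end SliceContinuity

/-! ### Balance of the relative energy -/

section EnergyInequality

variable {τ T t : ℝ} {p : E3} {v vt u : SpaceTime → E3} {dv : Fin 3 → SpaceTime → E3}

theorem IsWeakWaveMapOn.integrable_crossSource
    (hv : IsWeakWaveMapOn (truncCone τ p T) v vt dv)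
    (hvt : MemLp vt 2 (volume.restrict (openCone τ p T)))
    (hdv : ∀ i, MemLp (dv i) 2 (volume.restrict (openCone τ p T)))
    (hu : ContDiff ℝ ∞ u) (huc : HasCompactSupport u) :
    IntegrableOn (crossSource v vt dv u) (openCone τ p T) := by
  have hTu : IsTestOn univ u := ⟨hu, huc, by simp⟩
  have hN : Continuous (lagrangian (timeDeriv u) (fun i => spaceDeriv i u)) :=
    continuous_lagrangian (contDiff_timeDeriv hu).continuous
      fun i => (contDiff_spaceDeriv hu i).continuous
  have hNu : Continuous
      fun z => lagrangian (timeDeriv u) (fun i => spaceDeriv i u) z • u z := hN.smul hu.continuous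
  obtain ⟨C, -, hC⟩ := exists_norm_le_of_hasCompactSupport hNu
    (huc.smul_left (f := lagrangian (timeDeriv u) (fun i => spaceDeriv i u)))
  have h1 := integrable_inner_of_bounded (integrable_of_memLp_two hvt) hNu hC
  have h2 := hTu.timeDeriv.integrable_inner (hv.integrable_lagrangian_smul hvt hdv)
  refine (h1.add h2).congr (Eventually.of_forall fun z => ?_)
  simp only [Pi.add_apply, crossSource]
  rw [real_inner_smul_left, real_inner_smul_right, real_inner_comm (u z) (vt z)]

/-- All terms of a conservation law with integrable densities, tested with `ζ`, are integrable. -/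
theorem integrable_law {O : Set SpaceTime} {ζ : SpaceTime → ℝ} (hζ : IsTestOn O ζ)
    {e r : SpaceTime → ℝ} {c : Fin 3 → SpaceTime → ℝ} (he : IntegrableOn e O)
    (hr : IntegrableOn r O) (hc : ∀ i, IntegrableOn (c i) O) :
    IntegrableOn (fun z => - (timeDeriv ζ z * e z) + ∑ i, spaceDeriv i ζ z * c i z + ζ z * r z)
      O := by
  have key : ∀ {φ f : SpaceTime → ℝ}, IsTestOn O φ → IntegrableOn f O →
      IntegrableOn (fun z => φ z * f z) O := fun {φ f} hφ hf => by
    obtain ⟨C, -, hC⟩ := hφ.exists_norm_le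
    exact integrable_smul_of_bounded hf hφ.1.continuous hC
  exact ((key hζ.timeDeriv he).neg.add
    (integrable_finsetSum _ fun i _ => key (hζ.spaceDeriv i) (hc i))).add (key hζ hr)

/-- The relative energy law, as the difference of two polarised energy laws. -/
theorem IsWeakWaveMapOn.integral_relEnergy_law
    (hv : IsWeakWaveMapOn (truncCone τ p T) v vt dv)
    (hvt : MemLp vt 2 (volume.restrict (openCone τ p T)))
    (hdv : ∀ i, MemLp (dv i) 2 (volume.restrict (openCone τ p T)))
    (hu : ContDiff ℝ ∞ u) (huc : HasCompactSupport u)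
    (hbox : ∀ z ∈ openCone τ p T,
      box u z + lagrangian (timeDeriv u) (fun i => spaceDeriv i u) z • u z = 0)
    (htT : t ≤ T) {ζ : SpaceTime → ℝ} (hζ : IsTestOn (openCone τ p t) ζ) :
    ∫ z in openCone τ p t, (- (timeDeriv ζ z * relEnergy vt dv u z)
        + ∑ i, spaceDeriv i ζ z * relCurrent vt dv u i z + ζ z * relSource v vt dv u z) = 0 := by
  have hsub := openCone_subset_openCone τ p htT
  have hζT := hζ.mono hsub
  have hcut : ∀ (e r : SpaceTime → ℝ) (c : Fin 3 → SpaceTime → ℝ),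
      ∫ z in openCone τ p t, (- (timeDeriv ζ z * e z) + ∑ i, spaceDeriv i ζ z * c i z + ζ z * r z)
      = ∫ z in openCone τ p T,
        (- (timeDeriv ζ z * e z) + ∑ i, spaceDeriv i ζ z * c i z + ζ z * r z) := fun e r c => by
    refine (setIntegral_eq_of_subset_of_forall_sdiff_eq_zero (measurableSet_openCone τ p T) hsub
      fun z hz => ?_).symm
    simp [hζ.eq_zero hz.2, hζ.timeDeriv.eq_zero hz.2, fun i => (hζ.spaceDeriv i).eq_zero hz.2]
  have hc1 := integrable_crossEnergy hu huc (integrable_of_memLp_two hvt)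
    (fun i => integrable_of_memLp_two (hdv i))
  have hut : Continuous (timeDeriv u) := (contDiff_timeDeriv hu).continuous
  have hui : ∀ i, Continuous (spaceDeriv i u) := fun i => (contDiff_spaceDeriv hu i).continuous
  have hc2 := integrable_crossEnergy (Ω := openCone τ p T) hu huc
    (integrableOn_openCone_of_continuous hut) (fun i => integrableOn_openCone_of_continuous (hui i))
  have hs2 : IntegrableOn (crossSource u (timeDeriv u) (fun i => spaceDeriv i u) u)
      (openCone τ p T) := by
    have hN := continuous_lagrangian hut hui
    have hu0 := hu.continuous
    exact integrableOn_openCone_of_continuous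
      ((hN.mul (hu0.inner hut)).add (hN.mul (hu0.inner hut)))
  have j1 := integrable_law hζT hc1.1 (hv.integrable_crossSource hvt hdv hu huc) hc1.2
  have j2 := integrable_law hζT hc2.1 hs2 hc2.2
  have h1 := hv.integral_crossEnergy_law hvt hdv hu hbox hζT
  have h2 := integral_crossEnergy_law_self hu hbox hζT
  have h3 := integral_sub (j2.const_mul (1 / 2)) j1
  rw [integral_const_mul, h1, h2, mul_zero, sub_zero] at h3
  rw [hcut, ← h3]
  refine integral_congr_ae (Eventually.of_forall fun z => ?_)
  simp only [relEnergy, relCurrent, relSource, Fin.sum_univ_three]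
  ring

theorem IsWeakWaveMapOn.integrable_relSource
    (hv : IsWeakWaveMapOn (truncCone τ p T) v vt dv)
    (hvt : MemLp vt 2 (volume.restrict (openCone τ p T)))
    (hdv : ∀ i, MemLp (dv i) 2 (volume.restrict (openCone τ p T)))
    (hu : ContDiff ℝ ∞ u) (huc : HasCompactSupport u) :
    IntegrableOn (relSource v vt dv u) (openCone τ p T) := by
  have hut : Continuous (timeDeriv u) := (contDiff_timeDeriv hu).continuous
  have hui : ∀ i, Continuous (spaceDeriv i u) := fun i => (contDiff_spaceDeriv hu i).continuous
  have hN := continuous_lagrangian hut hui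
  have hu0 := hu.continuous
  have h : IntegrableOn (crossSource u (timeDeriv u) (fun i => spaceDeriv i u) u)
      (openCone τ p T) := integrableOn_openCone_of_continuous
      ((hN.mul (hu0.inner hut)).add (hN.mul (hu0.inner hut)))
  exact (h.const_mul (1 / 2)).sub (hv.integrable_crossSource hvt hdv hu huc)

/-- The relative energy grows by at most the flux of `v` and the source. -/
theorem IsWeakWaveMapOn.integral_relEnergy_sub_le
    (hv : IsWeakWaveMapOn (truncCone τ p T) v vt dv)
    (hvt : MemLp vt 2 (volume.restrict (openCone τ p T)))
    (hdv : ∀ i, MemLp (dv i) 2 (volume.restrict (openCone τ p T)))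
    (hu : ContDiff ℝ ∞ u) (huc : HasCompactSupport u)
    (hbox : ∀ z ∈ openCone τ p T,
      box u z + lagrangian (timeDeriv u) (fun i => spaceDeriv i u) z • u z = 0)
    {E0 : ENNReal} (hE0 : E0 ≠ ⊤) (hTτ : T ≤ τ) (ht : t ∈ Ioo 0 T)
    (hE : ∀ s ∈ Icc 0 t, energy τ p s vt dv ≤ E0)
    {G : Fin 3 → SpaceTime → E3} (hG : IsSideTrace τ p t vt dv G) :
    (∫ x in disk τ p t, relEnergy vt dv u (t, x)) - (∫ x in disk τ p 0, relEnergy vt dv u (0, x)) ≤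
      1 / (2 * √2) * (∫ z, ∑ i, ‖G i z‖ ^ 2 ∂(sideMeasure τ p t)) +
        ∫ z in openCone τ p t, |relSource v vt dv u z| := by
  have hsub := openCone_subset_openCone τ p ht.2.le
  have hvt1 : IntegrableOn vt (openCone τ p t) := IntegrableOn.mono_set (integrable_of_memLp_two hvt) hsub
  have hdv1 : ∀ i, IntegrableOn (dv i) (openCone τ p t) := fun i =>
    IntegrableOn.mono_set (integrable_of_memLp_two (hdv i)) hsub
  have hr : IntegrableOn (relSource v vt dv u) (openCone τ p t) :=
    (hv.integrable_relSource hvt hdv hu huc).mono_set hsub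
  have he : IntegrableOn (relEnergy vt dv u) (openCone τ p t) :=
    ((integrable_crossEnergy hu huc
      (integrableOn_openCone_of_continuous (contDiff_timeDeriv hu).continuous)
      (fun i => integrableOn_openCone_of_continuous
        (contDiff_spaceDeriv hu i).continuous)).1.const_mul (1 / 2)).sub
      (integrable_crossEnergy hu huc hvt1 hdv1).1
  have hcont := hv.continuousOn_integral_relEnergy hu huc hE0 ht.2.le hTτ hE
  have ha : Tendsto (fun s => ∫ x in disk τ p s, relEnergy vt dv u (s, x)) (𝓝[>] 0)
      (𝓝 (∫ x in disk τ p 0, relEnergy vt dv u (0, x))) :=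
    (hcont 0 (left_mem_Icc.2 ht.1.le)).mono_left (by
      rw [← nhdsWithin_Ioc_eq_nhdsGT ht.1]
      exact nhdsWithin_mono _ Ioc_subset_Icc_self)
  have hb : Tendsto (fun s => ∫ x in disk τ p s, relEnergy vt dv u (s, x)) (𝓝[<] t)
      (𝓝 (∫ x in disk τ p t, relEnergy vt dv u (t, x))) :=
    (hcont t (right_mem_Icc.2 ht.1.le)).mono_left (by
      rw [← nhdsWithin_Ico_eq_nhdsLT ht.1]
      exact nhdsWithin_mono _ Ico_subset_Icc_self)
  have hlim := tendsto_integral_deriv_timeCutoff ht.1 (integrableOn_integral_disk he) ha hb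
  have hlow : ∀ n, - (1 / (2 * √2) * ∫ z, ∑ i, ‖G i z‖ ^ 2 ∂(sideMeasure τ p t)) -
      (∫ z in openCone τ p t, |relSource v vt dv u z|) ≤
      ∫ s in Ioo 0 t, deriv (timeCutoff t n) s •
        ∫ x in disk τ p s, relEnergy vt dv u (s, x) := by
    intro n
    have hη := contDiff_timeCutoff t n
    have h1 := neg_flux_le_integral_relEnergy hvt1 hdv1 hr hu huc (ht.2.trans_le hTτ)
      (fun ζ hζ => hv.integral_relEnergy_law hvt hdv hu huc hbox ht.2.le hζ) hG hη
      (hasCompactSupport_timeCutoff ht.1 n) (tsupport_timeCutoff_subset ht.1 n)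
      (timeCutoff_mem ht.1 n)
    have hd : Continuous (deriv (timeCutoff t n)) := hη.continuous_deriv (by simp)
    obtain ⟨C, -, hC⟩ := exists_norm_le_of_hasCompactSupport hd
      (hasCompactSupport_timeCutoff ht.1 n).deriv
    have i1 : IntegrableOn (fun z : SpaceTime => deriv (timeCutoff t n) z.1 * relEnergy vt dv u z)
        (openCone τ p t) :=
      integrable_smul_of_bounded he (hd.comp continuous_fst) fun z => hC z.1
    have i2 : IntegrableOn (fun z : SpaceTime => timeCutoff t n z.1 * relSource v vt dv u z)
        (openCone τ p t) :=
      integrable_smul_of_bounded hr (hη.continuous.comp continuous_fst) (C := 1) fun z => by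
        have h2 := timeCutoff_mem ht.1 n z.1
        change ‖timeCutoff t n z.1‖ ≤ 1
        rw [Real.norm_eq_abs, abs_of_nonneg h2.1]
        exact h2.2
    have h2 : ∫ z in openCone τ p t, deriv (timeCutoff t n) z.1 * relEnergy vt dv u z =
        ∫ s in Ioo 0 t, deriv (timeCutoff t n) s •
          ∫ x in disk τ p s, relEnergy vt dv u (s, x) := by
      rw [integral_openCone τ p t i1]
      refine setIntegral_congr_fun measurableSet_Ioo fun s _ => ?_
      simp only [smul_eq_mul, integral_const_mul]
    have h3 : - (∫ z in openCone τ p t, |relSource v vt dv u z|) ≤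
        ∫ z in openCone τ p t, timeCutoff t n z.1 * relSource v vt dv u z := by
      rw [← integral_neg]
      refine integral_mono hr.abs.neg i2 fun z => ?_
      have h4 := timeCutoff_mem ht.1 n z.1
      have h5 : |timeCutoff t n z.1 * relSource v vt dv u z| ≤ |relSource v vt dv u z| := by
        rw [abs_mul, abs_of_nonneg h4.1]
        exact mul_le_of_le_one_left (abs_nonneg _) h4.2
      exact (neg_le_neg h5).trans (neg_abs_le _)
    rw [integral_sub i1 i2, h2] at h1
    linarith
  have := ge_of_tendsto' hlim hlow
  linarith

end EnergyInequality

/-! ### The energy of the difference -/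

section DifferenceEnergy

variable {τ T t : ℝ} {p : E3} {v vt u : SpaceTime → E3} {dv : Fin 3 → SpaceTime → E3}

/-- Two maps which agree on the base of the cone have the same space derivatives there. -/
theorem IsWeakWaveMapOn.dv_zero_eq (hv : IsWeakWaveMapOn (truncCone τ p T) v vt dv)
    (hT : 0 ≤ T) (hu : ContDiff ℝ ∞ u)
    (h0 : ∀ᵐ x ∂volume.restrict (disk τ p 0), v (0, x) = u (0, x)) (i : Fin 3) :
    ∀ᵐ x ∂volume.restrict (disk τ p 0), dv i (0, x) = spaceDeriv i u (0, x) := by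
  have h0T : (0 : ℝ) ∈ Icc 0 T := left_mem_Icc.2 hT
  have hsl : ContDiff ℝ ∞ fun x : E3 => u (0, x) := hu.comp (by fun_prop)
  have hui : Continuous fun x : E3 => spaceDeriv i u (0, x) :=
    (contDiff_spaceDeriv hu i).continuous.comp (by fun_prop)
  have m1 : Integrable (fun x => dv i (0, x)) (volume.restrict (disk τ p 0)) :=
    integrable_of_memLp_two (hv.memLp_dv_slice i h0T le_rfl)
  have m2 : IntegrableOn (fun x : E3 => spaceDeriv i u (0, x)) (disk τ p 0) :=
    (hui.continuousOn.integrableOn_compact (isCompact_closedBall p (τ - 0))).mono_set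
      Metric.ball_subset_closedBall
  have h := ae_eq_zero_of_forall_integral_inner (D := disk τ p 0) Metric.isOpen_ball
    (W := fun x => dv i (0, x) - spaceDeriv i u (0, x)) (m1.sub m2) fun Ψ hΨ => by
    obtain ⟨C, -, hC⟩ := hΨ.exists_norm_le
    have h1 := hv.integral_inner_spaceDeriv_slice i h0T hΨ
    have h2 : ∫ x in disk τ p 0, inner ℝ (v (0, x)) (fderiv ℝ Ψ x (EuclideanSpace.single i 1)) =
        ∫ x in disk τ p 0, inner ℝ (u (0, x)) (fderiv ℝ Ψ x (EuclideanSpace.single i 1)) :=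
      integral_congr_ae (by filter_upwards [h0] with x hx; rw [hx])
    have h3 := integral_inner_fderiv_eq_neg hsl hΨ.1 hΨ.2.1 (EuclideanSpace.single i (1 : ℝ))
    rw [← setIntegral_eq_integral_of_forall_compl_eq_zero (s := disk τ p 0) fun z hz => by
        rw [image_eq_zero_of_notMem_tsupport
          (f := fun z => fderiv ℝ Ψ z (EuclideanSpace.single i 1))
          fun h' => hz (interior_subset (hΨ.2.2 (tsupport_fderiv_apply_subset ℝ _ h')))]; simp,
      ← setIntegral_eq_integral_of_forall_compl_eq_zero (s := disk τ p 0)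
        (f := fun z => inner ℝ (fderiv ℝ (fun x => u (0, x)) z (EuclideanSpace.single i 1)) (Ψ z))
        fun z hz => by rw [hΨ.eq_zero hz]; simp] at h3
    have h4 : ∀ x, fderiv ℝ (fun x => u (0, x)) x (EuclideanSpace.single i 1) =
        spaceDeriv i u (0, x) := fun x => fderiv_slice hu 0 x i
    simp only [h4] at h3
    simp only [inner_sub_left]
    rw [integral_sub (integrable_inner_of_bounded m1 hΨ.1.continuous hC)
      (integrable_inner_of_bounded m2 hΨ.1.continuous hC)]
    linarith
  filter_upwards [h] with x hx using sub_eq_zero.1 hx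

theorem toReal_flux_integral {G : Fin 3 → SpaceTime → E3} {μ : Measure SpaceTime}
    (hG : ∀ i, MemLp (G i) 2 μ) :
    (ENNReal.ofReal (1 / (2 * √2)) * ∫⁻ z, ∑ i, ‖G i z‖ₑ ^ 2 ∂μ).toReal =
      1 / (2 * √2) * ∫ z, ∑ i, ‖G i z‖ ^ 2 ∂μ := by
  have h : Integrable (fun z => ∑ i, ‖G i z‖ ^ 2) μ := integrable_finsetSum _ fun i _ =>
    (memLp_two_iff_integrable_sq_norm (hG i).1).1 (hG i)
  rw [ENNReal.toReal_mul, ENNReal.toReal_ofReal (by positivity),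
    integral_eq_lintegral_of_nonneg_ae (Eventually.of_forall fun z => by positivity) h.1]
  congr 3
  funext z
  rw [ENNReal.ofReal_sum_of_nonneg fun i _ => by positivity]
  simp only [ENNReal.ofReal_pow (norm_nonneg _), ofReal_norm]

/-- The energy of `v - u` grows at most by the source: the energy inequality for `v` compensates
exactly the flux in the balance of the relative energy. -/
theorem IsWeakWaveMapOn.integral_energyDensity_sub_le
    (hv : IsWeakWaveMapOn (truncCone τ p T) v vt dv)
    (hvt : MemLp vt 2 (volume.restrict (openCone τ p T)))
    (hdv : ∀ i, MemLp (dv i) 2 (volume.restrict (openCone τ p T)))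
    (hu : ContDiff ℝ ∞ u) (huc : HasCompactSupport u)
    (hbox : ∀ z ∈ openCone τ p T,
      box u z + lagrangian (timeDeriv u) (fun i => spaceDeriv i u) z • u z = 0)
    (hTτ : T ≤ τ)
    (henergy : ∀ t ∈ Ioo 0 T,
      energy τ p t vt dv + flux τ p t vt dv ≤ energy τ p 0 vt dv)
    (h0 : ∀ᵐ x ∂volume.restrict (disk τ p 0), v (0, x) = u (0, x))
    (h1 : ∀ᵐ x ∂volume.restrict (disk τ p 0), vt (0, x) = timeDeriv u (0, x))
    (ht : t ∈ Ioo 0 T) :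
    ∫ x in disk τ p t, energyDensity (fun z => vt z - timeDeriv u z)
        (fun i z => dv i z - spaceDeriv i u z) (t, x) ≤
      2 * ∫ z in openCone τ p t, |relSource v vt dv u z| := by
  have h0T : (0 : ℝ) ∈ Icc 0 T := left_mem_Icc.2 (ht.1.trans ht.2).le
  have htT : t ∈ Icc 0 T := Ioo_subset_Icc_self ht
  have hTu : IsTestOn univ u := ⟨hu, huc, by simp⟩
  obtain ⟨C, -, hC⟩ := hTu.timeDeriv.exists_norm_le
  choose Ci _ hCi using fun i => (hTu.spaceDeriv i).exists_norm_le
  have hE0 := hv.energy_ne_top h0T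
  have hEt := hv.energy_ne_top htT
  have hE : ∀ s ∈ Icc 0 t, energy τ p s vt dv ≤ energy τ p 0 vt dv := fun s hs => by
    rcases eq_or_lt_of_le hs.1 with rfl | h
    · exact le_rfl
    · exact le_self_add.trans (henergy s ⟨h, hs.2.trans_lt ht.2⟩)
  have hsplit : ∀ s ∈ Icc 0 T, ∫ x in disk τ p s, relEnergy vt dv u (s, x) =
      1 / 2 * (∫ x in disk τ p s, energyDensity (fun z => vt z - timeDeriv u z)
        (fun i z => dv i z - spaceDeriv i u z) (s, x)) - (energy τ p s vt dv).toReal := by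
    intro s hs
    have m1 := hv.memLp_vt_slice hs le_rfl
    have m2 := fun i => hv.memLp_dv_slice i hs le_rfl
    have m3 := memLp_slice_of_continuous (τ := τ) (p := p) hTu.timeDeriv.1.continuous hC s s
    have m4 := fun i => memLp_slice_of_continuous (τ := τ) (p := p)
      (hTu.spaceDeriv i).1.continuous (hCi i) s s
    have i1 := integrable_energyDensity m1 m2
    have i2 := integrable_energyDensity (vt := fun z => vt z - timeDeriv u z)
      (dv := fun i z => dv i z - spaceDeriv i u z) (m1.sub m3) fun i => (m2 i).sub (m4 i)
    simp only [relEnergy_eq]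
    rw [integral_sub (i2.const_mul _) (i1.const_mul _), integral_const_mul, integral_const_mul,
      toReal_energy m1 m2]
  have hw0 : ∫ x in disk τ p 0, energyDensity (fun z => vt z - timeDeriv u z)
      (fun i z => dv i z - spaceDeriv i u z) (0, x) = 0 := by
    refine integral_eq_zero_of_ae ?_
    filter_upwards [h1, ae_all_iff.2 fun i => hv.dv_zero_eq h0T.2 hu h0 i] with x hx hx'
    simp [energyDensity, hx, hx']
  have hflux : flux τ p t vt dv ≠ ⊤ :=
    ne_top_of_le_ne_top hE0 (le_add_self.trans (henergy t ht))
  refine le_of_forall_pos_le_add fun ε hε => ?_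
  -- The flux is an infimum over all traces; a trace which attains it up to `ε / 2` is enough.
  have hlt : flux τ p t vt dv < flux τ p t vt dv + ENNReal.ofReal (ε / 2) :=
    ENNReal.lt_add_right hflux (by simpa using hε)
  obtain ⟨G, hG'⟩ := iInf_lt_iff.1 hlt
  obtain ⟨hG, hGlt⟩ := iInf_lt_iff.1 hG'
  have h2 := hv.integral_relEnergy_sub_le hvt hdv hu huc hbox hE0 hTτ ht hE hG
  rw [hsplit t htT, hsplit 0 h0T, hw0, ← toReal_flux_integral hG.1] at h2
  have h3 : (energy τ p t vt dv).toReal + (ENNReal.ofReal (1 / (2 * √2)) *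
      ∫⁻ z, ∑ i, ‖G i z‖ₑ ^ 2 ∂(sideMeasure τ p t)).toReal ≤
      (energy τ p 0 vt dv).toReal + ε / 2 := by
    have h4 : energy τ p t vt dv + ENNReal.ofReal (1 / (2 * √2)) *
        ∫⁻ z, ∑ i, ‖G i z‖ₑ ^ 2 ∂(sideMeasure τ p t) ≤
        energy τ p 0 vt dv + ENNReal.ofReal (ε / 2) := by
      calc _ ≤ energy τ p t vt dv + (flux τ p t vt dv + ENNReal.ofReal (ε / 2)) := by
            gcongr
        _ = energy τ p t vt dv + flux τ p t vt dv + ENNReal.ofReal (ε / 2) := by rw [add_assoc]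
        _ ≤ _ := by gcongr; exact henergy t ht
    have h5 := ENNReal.toReal_mono (ENNReal.add_ne_top.2 ⟨hE0, ENNReal.ofReal_ne_top⟩) h4
    rw [ENNReal.toReal_add hEt hGlt.ne_top, ENNReal.toReal_add hE0 ENNReal.ofReal_ne_top,
      ENNReal.toReal_ofReal (by positivity)] at h5
    exact h5
  linarith

end DifferenceEnergy

/-! ### Gronwall's lemma and the source -/

section Gronwall

/-- A Gronwall lemma for integrable functions: `f ≤ K ∫₀ᵗ f` on `(0, T)` forces `f = 0` there. -/
theorem eq_zero_of_le_integral {f : ℝ → ℝ} {T K : ℝ} (hK : 0 ≤ K)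
    (hf : IntegrableOn f (Ioo 0 T)) (hf0 : ∀ t ∈ Ioo 0 T, 0 ≤ f t)
    (h : ∀ t ∈ Ioo 0 T, f t ≤ K * ∫ s in Ioo 0 t, f s) : ∀ t ∈ Ioo 0 T, f t = 0 := by
  set M := K * ∫ s in Ioo 0 T, f s with hM
  have hft : ∀ t ∈ Ioo 0 T, IntegrableOn f (Ioo 0 t) := fun t ht =>
    hf.mono_set (Ioo_subset_Ioo_right ht.2.le)
  have key : ∀ n : ℕ, ∀ t ∈ Ioo 0 T, f t ≤ M * ((K * t) ^ n / n.factorial) := by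
    intro n
    induction n with
    | zero =>
      intro t ht
      refine (h t ht).trans ?_
      simp only [pow_zero, Nat.factorial_zero, Nat.cast_one, div_one, mul_one, hM]
      refine mul_le_mul_of_nonneg_left (setIntegral_mono_set hf ?_
        (Ioo_subset_Ioo_right ht.2.le).eventuallyLE) hK
      rw [EventuallyLE, ae_restrict_iff' measurableSet_Ioo]
      exact Eventually.of_forall hf0
    | succ n ih =>
      intro t ht
      have hc : Continuous fun s : ℝ => M * ((K * s) ^ n / n.factorial) := by fun_prop
      have h1 : ∫ s in Ioo 0 t, f s ≤ ∫ s in Ioo 0 t, M * ((K * s) ^ n / n.factorial) :=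
        setIntegral_mono_on (hft t ht)
          ((hc.continuousOn.integrableOn_compact isCompact_Icc).mono_set Ioo_subset_Icc_self)
          measurableSet_Ioo fun s hs => ih s ⟨hs.1, hs.2.trans ht.2⟩
      have h2 : ∫ s in Ioo 0 t, M * ((K * s) ^ n / n.factorial) =
          M * (K ^ n / n.factorial) * (t ^ (n + 1) / (n + 1)) := by
        have h3 : (fun s : ℝ => M * ((K * s) ^ n / n.factorial)) =
            fun s => M * (K ^ n / n.factorial) * s ^ n := by
          funext s; rw [mul_pow]; ring
        rw [h3, integral_const_mul, ← integral_Ioc_eq_integral_Ioo,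
          ← intervalIntegral.integral_of_le ht.1.le, integral_pow]
        simp
      refine (h t ht).trans ((mul_le_mul_of_nonneg_left (h1.trans h2.le) hK).trans_eq ?_)
      rw [Nat.factorial_succ, Nat.cast_mul, mul_pow]
      push_cast
      field_simp
      ring
  intro t ht
  refine le_antisymm ?_ (hf0 t ht)
  have hlim := (FloorSemiring.tendsto_pow_div_factorial_atTop (K * t)).const_mul M
  rw [mul_zero] at hlim
  exact ge_of_tendsto' hlim fun n => key n t ht

end Gronwall

section SourceBound

theorem abs_lagrangian_le {a : E3} {b : Fin 3 → E3} {B : ℝ} (ha : ‖a‖ ≤ B) (hb : ∀ i, ‖b i‖ ≤ B) :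
    |‖a‖ ^ 2 - ∑ i, ‖b i‖ ^ 2| ≤ 4 * B ^ 2 := by
  have h1 : ‖a‖ ^ 2 ≤ B ^ 2 := by gcongr
  have h2 : ∀ i, ‖b i‖ ^ 2 ≤ B ^ 2 := fun i => by
    have := hb i
    gcongr
  have h3 := fun i => sq_nonneg ‖b i‖
  rw [Fin.sum_univ_three, abs_le]
  constructor <;> linarith [h2 0, h2 1, h2 2, h3 0, h3 1, h3 2, sq_nonneg ‖a‖]

theorem abs_norm_sq_sub_norm_sq_le {a b : E3} {B : ℝ} (hb : ‖b‖ ≤ B) :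
    |‖a‖ ^ 2 - ‖b‖ ^ 2| ≤ ‖a - b‖ ^ 2 + 2 * B * ‖a - b‖ := by
  have h1 : ‖a‖ ^ 2 - ‖b‖ ^ 2 = ‖a - b‖ ^ 2 + 2 * inner ℝ (a - b) b := by
    rw [norm_sub_sq_real, inner_sub_left, real_inner_self_eq_norm_sq]
    ring
  rw [h1]
  refine (abs_add_le _ _).trans ?_
  rw [abs_mul, abs_two, abs_of_nonneg (sq_nonneg _), mul_assoc, mul_comm B]
  have h2 := (abs_real_inner_le_norm (a - b) b).trans
    (mul_le_mul_of_nonneg_left hb (norm_nonneg (a - b)))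
  linarith

/-- The bookkeeping in the bound of the source, where `w = |v - u|`, `x = |∂ₜ(v - u)|` and `a`, `b`,
`c` are the norms of the space derivatives of `v - u`. One factor `w` of the terms of third order
is bounded by `2`. -/
theorem source_arith {B w : ℝ} (hB : 0 ≤ B) (hw2 : w ≤ 2) (x a b c : ℝ) :
    ((x ^ 2 + (a ^ 2 + b ^ 2 + c ^ 2)) + 2 * B * (x + (a + b + c))) * (w * B) +
      4 * B ^ 2 * (w * x) ≤
      (6 * B ^ 2 + 2 * B) * (x ^ 2 + (a ^ 2 + b ^ 2 + c ^ 2) + w ^ 2) := by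
  have h1 : (x ^ 2 + (a ^ 2 + b ^ 2 + c ^ 2)) * B * w ≤
      (x ^ 2 + (a ^ 2 + b ^ 2 + c ^ 2)) * B * 2 := by gcongr
  have h2 : ∀ y : ℝ, B ^ 2 * (2 * (w * y)) ≤ B ^ 2 * (w ^ 2 + y ^ 2) := fun y => by
    gcongr
    linarith [sq_nonneg (w - y)]
  have h3 := mul_nonneg hB (sq_nonneg w)
  have h4 : 0 ≤ B ^ 2 * (a ^ 2 + b ^ 2 + c ^ 2) := by positivity
  have h5 : 0 ≤ B ^ 2 * x ^ 2 := by positivity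
  linarith [h2 x, h2 a, h2 b, h2 c]

/-- On the sphere the source of the relative energy is quadratic in the difference of the two maps.
As `u · ∂ₜu = 0` and `v · ∂ₜv = 0`, with `w = v - u` it equals
`N(u) w · ∂ₜw - (N(v) - N(u)) w · ∂ₜu`, where `N` denotes the Lagrangian densities. -/
theorem abs_source_le {V Vt U Ut : E3} {dV dU : Fin 3 → E3} {B : ℝ} (hB : 0 ≤ B)
    (hV : ‖V‖ = 1) (hU : ‖U‖ = 1) (hVt : inner ℝ V Vt = 0) (hUt : inner ℝ U Ut = 0)
    (hUtB : ‖Ut‖ ≤ B) (hdUB : ∀ i, ‖dU i‖ ≤ B) :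
    |(‖Ut‖ ^ 2 - ∑ i, ‖dU i‖ ^ 2) * inner ℝ U Vt + (‖Vt‖ ^ 2 - ∑ i, ‖dV i‖ ^ 2) * inner ℝ V Ut| ≤
      (6 * B ^ 2 + 2 * B) * (‖Vt - Ut‖ ^ 2 + ∑ i, ‖dV i - dU i‖ ^ 2 + ‖V - U‖ ^ 2) := by
  set N := ‖Ut‖ ^ 2 - ∑ i, ‖dU i‖ ^ 2 with hN
  set N' := ‖Vt‖ ^ 2 - ∑ i, ‖dV i‖ ^ 2 with hN'
  have hid : N * inner ℝ U Vt + N' * inner ℝ V Ut =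
      (N' - N) * inner ℝ (V - U) Ut - N * inner ℝ (V - U) (Vt - Ut) := by
    simp only [inner_sub_left, inner_sub_right, hVt, hUt]
    ring
  have hw2 : ‖V - U‖ ≤ 2 := (norm_sub_le _ _).trans (by rw [hV, hU]; norm_num)
  have hN4 : |N| ≤ 4 * B ^ 2 := abs_lagrangian_le hUtB hdUB
  have h1 : |inner ℝ (V - U) Ut| ≤ ‖V - U‖ * B :=
    (abs_real_inner_le_norm _ _).trans (by gcongr)
  have h2 : |inner ℝ (V - U) (Vt - Ut)| ≤ ‖V - U‖ * ‖Vt - Ut‖ := abs_real_inner_le_norm _ _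
  have ht := abs_norm_sq_sub_norm_sq_le (a := Vt) hUtB
  have hi := fun i => abs_norm_sq_sub_norm_sq_le (a := dV i) (hdUB i)
  have hNN : |N' - N| ≤ (‖Vt - Ut‖ ^ 2 + ∑ i, ‖dV i - dU i‖ ^ 2) +
      2 * B * (‖Vt - Ut‖ + ∑ i, ‖dV i - dU i‖) := by
    have h3 : N' - N = (‖Vt‖ ^ 2 - ‖Ut‖ ^ 2) - ∑ i, (‖dV i‖ ^ 2 - ‖dU i‖ ^ 2) := by
      rw [hN, hN', Finset.sum_sub_distrib]
      ring
    rw [h3]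
    refine (abs_sub _ _).trans ((add_le_add ht ((Finset.abs_sum_le_sum_abs _ _).trans
      (Finset.sum_le_sum fun i _ => hi i))).trans_eq ?_)
    rw [Finset.sum_add_distrib, ← Finset.mul_sum]
    ring
  rw [hid]
  clear_value N N'
  refine (abs_sub _ _).trans ?_
  rw [abs_mul, abs_mul]
  refine (add_le_add (mul_le_mul hNN h1 (abs_nonneg _) ((abs_nonneg _).trans hNN))
    (mul_le_mul hN4 h2 (abs_nonneg _) ((abs_nonneg _).trans hN4))).trans ?_
  simp only [Fin.sum_univ_three]
  exact source_arith hB hw2 _ _ _ _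

end SourceBound

/-! ### Uniqueness -/

section Uniqueness

variable {τ T t : ℝ} {p : E3} {v vt u : SpaceTime → E3} {dv : Fin 3 → SpaceTime → E3}

/-- The source of the relative energy is bounded by the square of the first order jet of `v - u`. -/
theorem IsWeakWaveMapOn.exists_abs_relSource_le
    (hv : IsWeakWaveMapOn (truncCone τ p T) v vt dv) (hT : 0 < T)
    (hvt : MemLp vt 2 (volume.restrict (openCone τ p T)))
    (hu : ContDiff ℝ ∞ u) (huc : HasCompactSupport u)
    (hnorm : ∀ z ∈ openCone τ p T, ‖u z‖ = 1)
    (horth : ∀ z ∈ openCone τ p T, inner ℝ (u z) (timeDeriv u z) = 0) :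
    ∃ C, 0 ≤ C ∧ ∀ᵐ z ∂volume.restrict (openCone τ p T), |relSource v vt dv u z| ≤
      C * (energyDensity (fun z => vt z - timeDeriv u z)
        (fun i z => dv i z - spaceDeriv i u z) z + ‖v z - u z‖ ^ 2) := by
  have hTu : IsTestOn univ u := ⟨hu, huc, by simp⟩
  obtain ⟨B₀, hB₀, hutB⟩ := hTu.timeDeriv.exists_norm_le
  choose Bi hBi0 hBi using fun i => (hTu.spaceDeriv i).exists_norm_le
  set B := B₀ + ∑ i, Bi i with hB
  have hS : 0 ≤ ∑ i, Bi i := Finset.sum_nonneg fun i _ => hBi0 i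
  have hB0 : 0 ≤ B := by positivity
  have hiB : ∀ i, Bi i ≤ B := fun i =>
    (Finset.single_le_sum (fun i _ => hBi0 i) (Finset.mem_univ i)).trans
      (le_add_of_nonneg_left hB₀)
  refine ⟨6 * B ^ 2 + 2 * B, by positivity, ?_⟩
  filter_upwards [hv.norm_eq_one_ae, hv.inner_v_vt_eq_zero hT (integrable_of_memLp_two hvt),
    ae_restrict_mem (measurableSet_openCone τ p T)] with z h1 h2 hz
  have h3 := abs_source_le (dV := fun i => dv i z) (dU := fun i => spaceDeriv i u z) hB0 h1
    (hnorm z hz) h2 (horth z hz) ((hutB z).trans (le_add_of_nonneg_right hS))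
    fun i => (hBi i z).trans (hiB i)
  rw [← abs_neg] at h3
  refine (le_of_eq ?_).trans h3
  congr 1
  simp only [relSource, crossSource, lagrangian, horth z hz]
  ring

/-- Weak-strong uniqueness for a comparison map which is smooth and compactly supported on all of
space-time and a wave map on the cone. -/
theorem weak_strong_uniqueness_of_hasCompactSupport
    (hv : IsWeakWaveMapOn (truncCone τ p T) v vt dv) (hT : 0 < T) (hTτ : T ≤ τ)
    (hu : ContDiff ℝ ∞ u) (huc : HasCompactSupport u)
    (hnorm : ∀ z ∈ openCone τ p T, ‖u z‖ = 1)
    (horth : ∀ z ∈ openCone τ p T, inner ℝ (u z) (timeDeriv u z) = 0)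
    (hbox : ∀ z ∈ openCone τ p T,
      box u z + lagrangian (timeDeriv u) (fun i => spaceDeriv i u) z • u z = 0)
    (henergy : ∀ t ∈ Ioo 0 T,
      energy τ p t vt dv + flux τ p t vt dv ≤ energy τ p 0 vt dv)
    (h0 : ∀ᵐ x ∂volume.restrict (disk τ p 0), v (0, x) = u (0, x))
    (h1 : ∀ᵐ x ∂volume.restrict (disk τ p 0), vt (0, x) = timeDeriv u (0, x))
    (ht : t ∈ Ioc 0 T) : ∀ᵐ x ∂volume.restrict (disk τ p t), v (t, x) = u (t, x) := by
  have hE0 := hv.energy_ne_top (left_mem_Icc.2 hT.le)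
  have hle : ∀ t ∈ Ioo 0 T, energy τ p t vt dv ≤ energy τ p 0 vt dv :=
    fun t ht => le_self_add.trans (henergy t ht)
  have hvt := hv.memLp_vt hE0 hle
  have hdv := hv.memLp_dv hE0 hle
  obtain ⟨C, hC0, hC⟩ := hv.exists_abs_relSource_le hT hvt hu huc hnorm horth
  have hut : Continuous (timeDeriv u) := (contDiff_timeDeriv hu).continuous
  have hui : ∀ i, Continuous (spaceDeriv i u) := fun i => (contDiff_spaceDeriv hu i).continuous
  have hL2 : ∀ {a : SpaceTime → E3}, Continuous a → MemLp a 2 (volume.restrict (openCone τ p T)) :=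
    fun ha => (memLp_two_iff_integrable_sq_norm ha.aestronglyMeasurable).2
      (integrableOn_openCone_of_continuous (ha.norm.pow 2))
  have hwt : MemLp (fun z => vt z - timeDeriv u z) 2 (volume.restrict (openCone τ p T)) :=
    hvt.sub (hL2 hut)
  have hwi : ∀ i, MemLp (fun z => dv i z - spaceDeriv i u z) 2
    (volume.restrict (openCone τ p T)) := fun i => (hdv i).sub (hL2 (hui i))
  have hwt2 : IntegrableOn (fun z => ‖vt z - timeDeriv u z‖ ^ 2) (openCone τ p T) :=
    (memLp_two_iff_integrable_sq_norm hwt.1).1 hwt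
  set e : SpaceTime → ℝ := energyDensity (fun z => vt z - timeDeriv u z)
        (fun i z => dv i z - spaceDeriv i u z) with he
  have he0 : ∀ z, 0 ≤ e z := energyDensity_nonneg _ _
  have hwe : ∀ z, ‖vt z - timeDeriv u z‖ ^ 2 ≤ e z := fun z =>
    le_add_of_nonneg_right (by positivity)
  have hei : IntegrableOn e (openCone τ p T) := hwt2.add
    (integrable_finsetSum _ fun i _ => (memLp_two_iff_integrable_sq_norm (hwi i).1).1 (hwi i))
  have hw : MemLp (fun z => v z - u z) 2 (volume.restrict (openCone τ p T)) := by
    refine MemLp.of_bound (hv.aestronglyMeasurable_v.sub hu.continuous.aestronglyMeasurable) 2 ?_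
    filter_upwards [hv.norm_eq_one_ae, ae_restrict_mem (measurableSet_openCone τ p T)] with z h2 hz
    refine (norm_sub_le _ _).trans ?_
    rw [h2, hnorm z hz]
    norm_num
  have hw2 : IntegrableOn (fun z => ‖v z - u z‖ ^ 2) (openCone τ p T) :=
    (memLp_two_iff_integrable_sq_norm hw.1).1 hw
  -- The difference itself is controlled by its time derivative, as it vanishes at time `0`.
  have hpoinc : ∀ t ∈ Ioo 0 T, ∫ z in openCone τ p t, ‖v z - u z‖ ^ 2 ≤
      T ^ 2 * ∫ z in openCone τ p t, e z := by
    intro t ht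
    have hsub := openCone_subset_openCone τ p ht.2.le
    have hA0 : 0 ≤ ∫ z in openCone τ p t, e z := integral_nonneg he0
    rw [integral_openCone τ p t (hw2.mono_set hsub)]
    calc ∫ s in Ioo 0 t, ∫ x in disk τ p s, ‖v (s, x) - u (s, x)‖ ^ 2
        ≤ ∫ s in Ioo 0 t, T * ∫ z in openCone τ p t, e z := by
          refine setIntegral_mono_on (integrableOn_integral_disk (hw2.mono_set hsub))
            (integrable_const _) measurableSet_Ioo fun s hs => ?_
          refine (hv.integral_norm_sub_sq_le hvt hu h0 ⟨hs.1, (hs.2.trans ht.2).le⟩).trans ?_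
          have hsub' := openCone_subset_openCone τ p hs.2.le
          refine mul_le_mul (hs.2.trans ht.2).le ?_ (integral_nonneg fun z => sq_nonneg _) hT.le
          exact (integral_mono (hwt2.mono_set (hsub'.trans hsub))
            (hei.mono_set (hsub'.trans hsub)) hwe).trans
            (setIntegral_mono_set (hei.mono_set hsub) (Eventually.of_forall he0) hsub'.eventuallyLE)
      _ = t * (T * ∫ z in openCone τ p t, e z) := by
          rw [setIntegral_const, Real.volume_real_Ioo_of_le ht.1.le, sub_zero, smul_eq_mul]
      _ ≤ T * (T * ∫ z in openCone τ p t, e z) := by gcongr; exact ht.2.le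
      _ = _ := by ring
  have hgron : ∀ t ∈ Ioo 0 T, ∫ x in disk τ p t, e (t, x) ≤
      2 * C * (1 + T ^ 2) * ∫ s in Ioo 0 t, ∫ x in disk τ p s, e (s, x) := by
    intro t ht
    have hsub := openCone_subset_openCone τ p ht.2.le
    rw [← integral_openCone τ p t (hei.mono_set hsub)]
    have h2 := hv.integral_energyDensity_sub_le hvt hdv hu huc hbox hTτ henergy h0 h1 ht
    have h3 : ∫ z in openCone τ p t, |relSource v vt dv u z| ≤
        ∫ z in openCone τ p t, C * (e z + ‖v z - u z‖ ^ 2) :=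
      integral_mono_ae (((hv.integrable_relSource hvt hdv hu huc).mono_set hsub).abs)
        (((hei.add hw2).mono_set hsub).const_mul C)
        (ae_restrict_of_ae_restrict_of_subset hsub hC)
    rw [integral_const_mul, integral_add (hei.mono_set hsub) (hw2.mono_set hsub)] at h3
    have h4 := mul_le_mul_of_nonneg_left (hpoinc t ht) hC0
    linarith
  -- Only times `t < T` are available here, since the energy inequality is not assumed at `T`. The
  -- time `T` is reached below, as `v(T) - u(T)` is the integral of `∂ₜ(v - u)`.
  have hzero := eq_zero_of_le_integral (by positivity) (integrableOn_integral_disk hei)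
    (fun t _ => integral_nonneg fun x => he0 (t, x)) hgron
  have hsub := openCone_subset_openCone τ p ht.2
  have h2 : ∫ z in openCone τ p t, e z = 0 := by
    rw [integral_openCone τ p t (hei.mono_set hsub), setIntegral_congr_fun (g := fun _ => 0)
      measurableSet_Ioo fun s hs => hzero s ⟨hs.1, hs.2.trans_le ht.2⟩]
    simp
  have h3 : ∫ x in disk τ p t, ‖v (t, x) - u (t, x)‖ ^ 2 = 0 := by
    refine le_antisymm ((hv.integral_norm_sub_sq_le hvt hu h0 ht).trans ?_)
      (integral_nonneg fun x => sq_nonneg _)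
    have h4 := integral_mono (hwt2.mono_set hsub) (hei.mono_set hsub) hwe
    rw [h2] at h4
    exact mul_nonpos_of_nonneg_of_nonpos ht.1.le h4
  have htT : t ∈ Icc 0 T := Ioc_subset_Icc_self ht
  obtain ⟨Cu, -, hCu⟩ := exists_norm_le_of_hasCompactSupport hu.continuous huc
  have hwslice : MemLp (fun x => v (t, x) - u (t, x)) 2 (volume.restrict (disk τ p t)) :=
    (hv.memLp_v_slice htT le_rfl).sub (memLp_slice_of_continuous hu.continuous hCu t t)
  rw [integral_eq_zero_iff_of_nonneg (fun x => sq_nonneg _)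
    ((memLp_two_iff_integrable_sq_norm hwslice.1).1 hwslice)] at h3
  filter_upwards [h3] with x hx
  simpa [sub_eq_zero] using hx

end Uniqueness

end WaveMap

theorem mainTheorem3
    (τ T : ℝ) (p : WaveMap.E3) (hT : 0 < T) (hTτ : T ≤ τ)
    (U : Set WaveMap.SpaceTime) (hU : IsOpen U) (hUcone : WaveMap.closedTruncCone τ p T ⊆ U)
    (u : WaveMap.SpaceTime → WaveMap.E3) (hu : WaveMap.IsClassicalWaveMapOn U u)
    (v vt : WaveMap.SpaceTime → WaveMap.E3) (dv : Fin 3 → WaveMap.SpaceTime → WaveMap.E3)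
    (hv : WaveMap.IsWeakWaveMapOn (WaveMap.truncCone τ p T) v vt dv)
    (henergy : ∀ t ∈ Set.Ioo 0 T,
      WaveMap.energy τ p t vt dv + WaveMap.flux τ p t vt dv ≤ WaveMap.energy τ p 0 vt dv)
    (hdata : ∀ᵐ x : WaveMap.E3, x ∈ WaveMap.disk τ p 0 →
      v (0, x) = u (0, x) ∧ vt (0, x) = WaveMap.timeDeriv u (0, x)) :
    ∀ t ∈ Set.Icc 0 T, ∀ᵐ x : WaveMap.E3, x ∈ WaveMap.disk τ p t → v (t, x) = u (t, x) := by
  -- Only the germ of `u` along the compact cone matters, so `u` may be replaced by a map which is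
  -- smooth and compactly supported on all of space-time.
  have hK := WaveMap.isCompact_closedTruncCone τ p T
  obtain ⟨u', hu', huc', heq⟩ :=
    WaveMap.exists_contDiff_hasCompactSupport_eventuallyEq hK hU hUcone hu.smooth
  have hbase : ∀ x ∈ WaveMap.disk τ p 0,
      ((0, x) : WaveMap.SpaceTime) ∈ WaveMap.closedTruncCone τ p T :=
    fun x hx => ⟨Set.left_mem_Icc.2 hT.le, Metric.ball_subset_closedBall hx⟩
  have hO : WaveMap.openCone τ p T ⊆ WaveMap.closedTruncCone τ p T :=
    (WaveMap.openCone_subset_truncCone τ p T).trans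
      (WaveMap.truncCone_subset_closedTruncCone τ p T)
  have hm := WaveMap.measurableSet_disk τ p
  have h0 : ∀ᵐ x ∂volume.restrict (WaveMap.disk τ p 0), v (0, x) = u' (0, x) := by
    rw [ae_restrict_iff' (hm 0)]
    filter_upwards [hdata] with x hx hxd
    rw [(hx hxd).1, (heq _ (hbase x hxd)).self_of_nhds]
  have h1 : ∀ᵐ x ∂volume.restrict (WaveMap.disk τ p 0),
      vt (0, x) = WaveMap.timeDeriv u' (0, x) := by
    rw [ae_restrict_iff' (hm 0)]
    filter_upwards [hdata] with x hx hxd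
    rw [(hx hxd).2, (WaveMap.timeDeriv_congr (heq _ (hbase x hxd))).self_of_nhds]
  have hnorm : ∀ z ∈ WaveMap.closedTruncCone τ p T, ∀ᶠ y in 𝓝 z, ‖u' y‖ = 1 := fun z hz => by
    filter_upwards [heq z hz, hU.mem_nhds (hUcone hz)] with y hy hyU
    rw [hy, hu.norm_eq_one y hyU]
  intro t ht
  rcases eq_or_lt_of_le ht.1 with rfl | ht0
  · filter_upwards [hdata] with x hx hxd using (hx hxd).1
  have h := WaveMap.weak_strong_uniqueness_of_hasCompactSupport hv hT hTτ hu' huc'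
    (fun z hz => (hnorm z (hO hz)).self_of_nhds)
    (fun z hz => WaveMap.inner_timeDeriv_eq_zero (hu'.differentiable (by simp) z)
      (hnorm z (hO hz)))
    (fun z hz => by
      have h2 := heq z (hO hz)
      have h3 := hu.equation z (hUcone (hO hz))
      rw [WaveMap.box_congr h2, h2.self_of_nhds]
      simp only [WaveMap.lagrangian, (WaveMap.timeDeriv_congr h2).self_of_nhds,
        fun i => (WaveMap.spaceDeriv_congr i h2).self_of_nhds]
      exact h3)
    henergy h0 h1 ⟨ht0, ht.2⟩
  rw [ae_restrict_iff' (hm t)] at h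
  filter_upwards [h] with x hx hxd
  rw [hx hxd]
  exact (heq (t, x) ⟨ht, Metric.ball_subset_closedBall hxd⟩).self_of_nhds
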